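/- Let $2\le m<n$ be integers, $\alpha=\log m/\log n$, and $\phi(t)=t+\alpha \bmod 1$ on $[0,1)$. **Bernoulli measures.** Let $I=\{0,\dots,m-1\}$, $J=\{0,\dots,n-1\}$. A Borel probability measure $\nu$ on $I^{\mathbb N}\times J^{\mathbb N}$ is Bernoulli if there are weights $p_{ij}\in[0,1]$ with $\nu([\mathbf i i]\times[\mathbf j j])=p_{ij}\,\nu([\mathbf i]\times[\mathbf j])$ for all $i\in I$, $j\in J$ and all finite words $\mathbf i$ over $I$, $\mathbf j$ over $J$ of equal length. A Bernoulli measure for $T_{m,n}(x,y)=(mx \bmod 1,\,ny\bmod 1)$ is the image $\mu$ on $[0,1]^2$ of such a $\nu$ under the coding map of the natural Markov partition, $(\mathbf i,\mathbf j)\mapsto\big(\sum_{k\ge0} i_k m^{-k-1},\sum_{k\ge0} j_k n^{-k-1}\big)$. **Boxes.** A box is a product of two bounded nondegenerate intervals (each end point may or may not belong to it). For a box $B$ of area $|B|$ with lower left corner $b$ put $T_B(z)=|B|^{-1/2}(z-b)$ and $B^*=T_B(B)$. For a probability measure $\mu$ with $\mu(B)>0$ let $\mu^B=\mu(B)^{-1}T_B(\mu|_B)$.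 **Partition operators.** A partition operator $\Delta$ on a collection $\mathcal E$ of boxes assigns to each $B\in\mathcal E$ a partition $\Delta B\subset\mathcal E$ of $B$, with $S(\Delta B)=\Delta(SB)$ for $S(z)=rz+v$, $r>0$, whenever $B,SB\in\mathcal E$. Put $\Delta^0(B)=\{B\}$, $\Delta^{k+1}(B)=\bigcup_{A\in\Delta^k(B)}\Delta(A)$, and let $\Delta^k(x)$ be the element of $\Delta^k(B)$ containing $x$. The operator is $\delta$-regular, $0<\delta<1$, if for each $B\in\mathcal E$ there is $c>1$ such that for every $k\ge 0$ each $A\in\Delta^k(B)$ contains a disc of radius $\delta^k/c$ and is contained in a disc of radius $c\delta^k$. **CP-chains.** A $\delta$-regular CP-chain for a $\delta$-regular $\Delta$ is a stationary Markov process $Q$ on $\Omega=\{(B,\mu): B\in\mathcal E,\ \mu \text{ a probability measure with } \mu(B^*)=1\}$ that moves from $(B,\mu)$ to $(A,\mu^A)$ with probability $\mu(A)$, for $A\in\Delta(B^*)$. It is ergodic if the shift on $\Omega^{\mathbb N}$ is ergodic for the law of the process. Its measure component $\tilde Q$ is the law of $\mu$ in the state $(B,\mu)$. A probability measure $\mu$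 on $B^*$, $B\in\mathcal E$, generates $Q$ if for $\mu$-a.e. $x$ the distributions $\frac1N\sum_{k=0}^{N-1}\delta_{\mu^{\Delta^k(x)}}$, where $\Delta^k(x)\in\Delta^k(B^*)$, converge weakly to $\tilde Q$ as $N\to\infty$, and for every integer $q\ge1$ there is a distribution $\tilde Q_q$ such that for $\mu$-a.e. $x$ the distributions $\frac1N\sum_{k=0}^{N-1}\delta_{\mu^{\Delta^{qk}(x)}}$ converge weakly to $\tilde Q_q$. **Approximate squares.** Let $\mathcal E$ be the collection of all boxes which, up to the choice of the boundary points that belong to them, are obtained from some $R_t=[0,1]\times[0,n^t]$, $t\in[0,1)$, by scaling and translation. Cut a box of $\mathcal E$ of shape $R_t$ into $m$ columns of equal width and, if $t\ge1-\alpha$, also into $n$ rows of equal height. The resulting rectangles contain their left and lower but not their right and upper sides, except that on the boundary of the box they contain exactly what the box contains. This defines $\Delta$. **Theorem.** Let $\mu$ be a Bernoulli measure for $T_{m,n}$. Then $\Delta$ is a $\frac1m$-regular partition operator on $\mathcal E$, and $\mu$, as a measure on $[0,1]^2$, generates an ergodic $\frac1m$-regular CP-chain for $\Delta$. The measure component of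 the chain is the law of $$S_t(\pi_1\mu\times\mu_x),\qquad S_t=\begin{pmatrix}n^{-t/2}&0\\0&n^{t/2}\end{pmatrix},$$ where $\pi_1\mu$ is the projection of $\mu$ to the first coordinate, $x\sim\pi_1\mu$, $\mu_x$ is the conditional measure of $\mu$ on the vertical fibre over $x$ (a measure in the second coordinate), and $t\in[0,1)$ is independent of $x$. The parameter $t$ is distributed according to Lebesgue measure if $\alpha$ is irrational, and according to $\frac1q\sum_{k=0}^{q-1}\delta_{\phi^k(0)}$ if $\alpha=p/q$ in lowest terms. -/

import Mathlib

open MeasureTheory ProbabilityTheory Set Filter Topology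
open scoped NNReal ENNReal BoundedContinuousFunction

noncomputable section

/-! ### Boxes in the plane and blow-ups -/

/-- A box in the plane, that is, a product of two bounded intervals, recorded by its end points
and by the information which of its four sides belong to it. -/
structure Box where
  left : ℝ
  right : ℝ
  bottom : ℝ
  top : ℝ
  leftClosed : Bool
  rightClosed : Bool
  bottomClosed : Bool
  topClosed : Bool

namespace Box

/-- The interval with end points `a`, `b`; `ca`, `cb` say whether `a`, `b` belong to it. -/
def interval (a b : ℝ) (ca cb : Bool) : Set ℝ :=
  {x | (if ca then a ≤ x else a < x) ∧ (if cb then x ≤ b else x < b)}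

/-- The set of points of a box. -/
def toSet (B : Box) : Set (ℝ × ℝ) :=
  interval B.left B.right B.leftClosed B.rightClosed ×ˢ
    interval B.bottom B.top B.bottomClosed B.topClosed

/-- The σ-algebra on the space of boxes given by the end points and the four types of sides. -/
instance : MeasurableSpace Box :=
  MeasurableSpace.comap
    (fun B : Box => ((B.left, B.right, B.bottom, B.top),
      (B.leftClosed, B.rightClosed, B.bottomClosed, B.topClosed))) inferInstance

def width (B : Box) : ℝ := B.right - B.left

def height (B : Box) : ℝ := B.top - B.bottom

def area (B : Box) : ℝ := B.width * B.height

/-- The image of a box under the homothety `z ↦ r z + v`, `r > 0`. -/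
def homothety (r : ℝ) (v : ℝ × ℝ) (B : Box) : Box :=
  { B with
    left := r * B.left + v.1
    right := r * B.right + v.1
    bottom := r * B.bottom + v.2
    top := r * B.top + v.2 }

/-- The map `T_B (z) = |B|^{-1/2} (z - min B)`. -/
def rescale (B : Box) (z : ℝ × ℝ) : ℝ × ℝ :=
  ((z.1 - B.left) / √B.area, (z.2 - B.bottom) / √B.area)

/-- The normalised box `B^* = T_B (B)`, of area one and with lower left corner at the origin. -/
def normalise (B : Box) : Box :=
  { B with
    left := 0
    right := B.width / √B.area
    bottom := 0
    top := B.height / √B.area }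

theorem measurable_rescale (B : Box) : Measurable B.rescale := by
  unfold rescale
  fun_prop

open Classical in
/-- The blow-up `μ^B = T_B (μ|_B) / μ(B)`, a probability measure on `B^*`
(only meaningful if `μ(B) > 0`). -/
def blowUp (B : Box) (μ : ProbabilityMeasure (ℝ × ℝ)) : ProbabilityMeasure (ℝ × ℝ) :=
  if h : (μ : Measure (ℝ × ℝ)) B.toSet ≠ 0 then
    haveI := cond_isProbabilityMeasure h
    ⟨((μ : Measure (ℝ × ℝ))[|B.toSet]).map B.rescale,
      Measure.isProbabilityMeasure_map B.measurable_rescale.aemeasurable⟩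
  else μ

/-- The cell in column `i` and row `j` of the grid that divides `B` into `a` columns and `b` rows
of equal size, `i < a`, `j < b`. Cells contain their left and lower, but not their right and upper
sides, except that on the boundary of `B` they inherit the sides of `B`. -/
def gridCell (B : Box) (a b i j : ℕ) : Box where
  left := B.left + i * (B.width / a)
  right := B.left + (i + 1) * (B.width / a)
  bottom := B.bottom + j * (B.height / b)
  top := B.bottom + (j + 1) * (B.height / b)
  leftClosed := if i = 0 then B.leftClosed else true
  rightClosed := if i + 1 = a then B.rightClosed else false
  bottomClosed := if j = 0 then B.bottomClosed else true
  topClosed := if j + 1 = b then B.topClosed else false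

end Box

/-- The closed unit square. -/
def unitBox : Box := ⟨0, 1, 0, 1, true, true, true, true⟩

/-- The open Euclidean disc in the plane with centre `w` and radius `r`. -/
def euclDisc (w : ℝ × ℝ) (r : ℝ) : Set (ℝ × ℝ) :=
  {z | √((z.1 - w.1) ^ 2 + (z.2 - w.2) ^ 2) < r}

/-! ### Partition operators -/

/-- `Δ` is a partition operator on the collection of boxes `E`. -/
structure IsPartitionOperator (E : Set Box) (Δ : Box → Set Box) : Prop where
  subset : ∀ B ∈ E, Δ B ⊆ E
  nonempty : ∀ B ∈ E, ∀ A ∈ Δ B, A.toSet.Nonempty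
  pairwiseDisjoint : ∀ B ∈ E, (Δ B).PairwiseDisjoint Box.toSet
  iUnion_eq : ∀ B ∈ E, ⋃ A ∈ Δ B, A.toSet = B.toSet
  homothety : ∀ B ∈ E, ∀ r : ℝ, 0 < r → ∀ v : ℝ × ℝ, B.homothety r v ∈ E →
    Δ (B.homothety r v) = Box.homothety r v '' Δ B

/-- The filtration `Δ^0 (B) = {B}`, `Δ^{k+1} (B) = ⋃_{A ∈ Δ^k (B)} Δ (A)`. -/
def iterPartition (Δ : Box → Set Box) (B : Box) : ℕ → Set Box
  | 0 => {B}
  | k + 1 => ⋃ A ∈ iterPartition Δ B k, Δ A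

/-- `δ`-regularity of a partition operator. -/
def IsRegularOperator (δ : ℝ) (E : Set Box) (Δ : Box → Set Box) : Prop :=
  ∀ B ∈ E, ∃ c : ℝ, 1 < c ∧ ∀ k : ℕ, ∀ A ∈ iterPartition Δ B k,
    (∃ w, euclDisc w (δ ^ k / c) ⊆ A.toSet) ∧ (∃ w, A.toSet ⊆ euclDisc w (c * δ ^ k))

open Classical in
/-- `Δ^k (x)`: the element of `Δ^k (B)` that contains `x` (for `x` in `B`). -/
def cellAt (Δ : Box → Set Box) (B : Box) (k : ℕ) (x : ℝ × ℝ) : Box :=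
  if h : ∃ A ∈ iterPartition Δ B k, x ∈ A.toSet then h.choose else B

/-! ### CP-chains -/

/-- The state space `{(B, μ) : B ∈ E, μ a probability measure on B^*}`. -/
def CPState (E : Set Box) : Type :=
  {s : Box × ProbabilityMeasure (ℝ × ℝ) //
    s.1 ∈ E ∧ (s.2 : Measure (ℝ × ℝ)) s.1.normalise.toSet = 1}

instance (E : Set Box) : MeasurableSpace (CPState E) :=
  inferInstanceAs (MeasurableSpace {s : Box × ProbabilityMeasure (ℝ × ℝ) //
    s.1 ∈ E ∧ (s.2 : Measure (ℝ × ℝ)) s.1.normalise.toSet = 1})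

/-- The Furstenberg transition law `∑_{A ∈ Δ(B^*)} μ(A) δ_{(A, μ^A)}`. -/
def furstenbergLaw (Δ : Box → Set Box) (s : Box × ProbabilityMeasure (ℝ × ℝ)) :
    Measure (Box × ProbabilityMeasure (ℝ × ℝ)) :=
  Measure.sum fun A : Δ s.1.normalise =>
    (s.2 : Measure (ℝ × ℝ)) A.1.toSet • Measure.dirac (A.1, A.1.blowUp s.2)

/-- The left shift on sequences. -/
def shift {X : Type*} (ω : ℕ → X) : ℕ → X := fun k => ω (k + 1)

/-- The law `Q` on sequences is the law of a Markov process with transition kernel `κ`: given the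
states up to time `k`, the state at time `k + 1` has law `κ` of the state at time `k`. -/
def IsMarkovLaw {X : Type*} [MeasurableSpace X] (κ : Kernel X X) (Q : Measure (ℕ → X)) : Prop :=
  ∀ k : ℕ,
    Q.map (fun ω => ((fun l : Fin (k + 1) => ω l), ω (k + 1))) =
      (Q.map (fun ω => (fun l : Fin (k + 1) => ω l))) ⊗ₘ
        (κ.comap (fun h : Fin (k + 1) → X => h (Fin.last k)) (measurable_pi_apply _))

/-- `Q` is (the law on sequences of states of) a `δ`-regular CP-chain with respect to the partition
operator `Δ` on `E`: a stationary Markov process whose transition kernel is the Furstenberg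
kernel. -/
structure IsCPChain (δ : ℝ) (E : Set Box) (Δ : Box → Set Box) (Q : Measure (ℕ → CPState E)) :
    Prop where
  delta_mem : δ ∈ Ioo (0 : ℝ) 1
  partitionOperator : IsPartitionOperator E Δ
  regular : IsRegularOperator δ E Δ
  isProbabilityMeasure : IsProbabilityMeasure Q
  markov : ∃ κ : Kernel (CPState E) (CPState E), IsMarkovKernel κ ∧
    (∀ s, (κ s).map Subtype.val = furstenbergLaw Δ s.1) ∧ IsMarkovLaw κ Q
  stationary : MeasurePreserving shift Q Q

/-- The measure component of a CP-chain: the law of the measure `μ` in a state `(B, μ)`. -/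
def measureComponent {E : Set Box} (Q : Measure (ℕ → CPState E)) :
    Measure (ProbabilityMeasure (ℝ × ℝ)) :=
  Q.map fun ω => (ω 0).1.2

/-- The `q`-sparse scenery distributions `(1/N) ∑_{k<N} δ_{μ^{Δ^{qk}(x)}}` of `μ`, along the
filtration of `B` given by `Δ`, at `x`, converge weakly to the distribution `P`. -/
def SceneryConverges (Δ : Box → Set Box) (B : Box) (μ : ProbabilityMeasure (ℝ × ℝ)) (q : ℕ)
    (x : ℝ × ℝ) (P : Measure (ProbabilityMeasure (ℝ × ℝ))) : Prop :=
  ∀ f : ProbabilityMeasure (ℝ × ℝ) →ᵇ ℝ,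
    Tendsto (fun N : ℕ => (1 / (N : ℝ)) *
      ∑ k ∈ Finset.range N, f ((cellAt Δ B (q * k) x).blowUp μ)) atTop (𝓝 (∫ ν, f ν ∂P))

/-- The probability measure `μ` on `B^*` generates the CP-chain `Q`. -/
structure Generates {E : Set Box} (Δ : Box → Set Box) (B : Box) (μ : ProbabilityMeasure (ℝ × ℝ))
    (Q : Measure (ℕ → CPState E)) : Prop where
  mem : B ∈ E
  supported : (μ : Measure (ℝ × ℝ)) B.normalise.toSet = 1
  scenery : ∀ᵐ x ∂(μ : Measure (ℝ × ℝ)),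
    SceneryConverges Δ B.normalise μ 1 x (measureComponent Q)
  sparse : ∀ q : ℕ, 1 ≤ q → ∃ P : Measure (ProbabilityMeasure (ℝ × ℝ)),
    IsProbabilityMeasure P ∧
      ∀ᵐ x ∂(μ : Measure (ℝ × ℝ)), SceneryConverges Δ B.normalise μ q x P

/-! ### Bernoulli measures -/

/-- A measure on the symbolic space is Bernoulli if there are weights `p i j ∈ [0, 1]` with
`ν([𝐢 i] × [𝐣 j]) = p i j * ν([𝐢] × [𝐣])` for all words `𝐢`, `𝐣` of equal length. The words are
written as prefixes of sequences: `PiNat.cylinder u k` is the cylinder of the first `k` letters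
of `u`. -/
def IsBernoulli {m n : ℕ} (ν : Measure ((ℕ → Fin m) × (ℕ → Fin n))) : Prop :=
  ∃ p : Fin m → Fin n → ℝ≥0, (∀ i j, p i j ≤ 1) ∧
    ∀ (u : ℕ → Fin m) (v : ℕ → Fin n) (k : ℕ),
      ν (PiNat.cylinder u (k + 1) ×ˢ PiNat.cylinder v (k + 1)) =
        p (u k) (v k) * ν (PiNat.cylinder u k ×ˢ PiNat.cylinder v k)

/-- The coding map of the natural Markov partition of `T_{m,n}`, given by the `m`-adic and `n`-adic
expansions `(i, j) ↦ (∑ i_k m^{-k-1}, ∑ j_k n^{-k-1})`. -/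
def codingMap (m n : ℕ) (w : (ℕ → Fin m) × (ℕ → Fin n)) : ℝ × ℝ :=
  (Real.ofDigits w.1, Real.ofDigits w.2)

/-- `μ` is a Bernoulli measure for `T_{m,n}`, realised on the unit square. -/
def IsBernoulliFor (m n : ℕ) (μ : ProbabilityMeasure (ℝ × ℝ)) : Prop :=
  ∃ ν : Measure ((ℕ → Fin m) × (ℕ → Fin n)), IsProbabilityMeasure ν ∧ IsBernoulli ν ∧
    (μ : Measure (ℝ × ℝ)) = ν.map (codingMap m n)

/-! ### Approximate squares -/

/-- `α = log m / log n`. -/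
def rotationAngle (m n : ℕ) : ℝ := Real.log m / Real.log n

/-- The rotation `φ(t) = t + α mod 1` on `[0, 1)`. -/
def angleRotation (m n : ℕ) (t : ℝ) : ℝ := Int.fract (t + rotationAngle m n)

/-- The eccentricity `t` of a box: the box is, up to its boundary, a scaled and translated copy of
`R_t = [0, 1] × [0, n^t]`, i.e. `height = n^t * width`. -/
def Box.eccentricity (n : ℕ) (B : Box) : ℝ := Real.logb n (B.height / B.width)

/-- The collection of boxes similar to some `R_t`, `t ∈ [0, 1)`. -/
def approxSquares (n : ℕ) : Set Box :=
  {B | 0 < B.width ∧ 0 < B.height ∧ B.eccentricity n ∈ Ico (0 : ℝ) 1}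

open Classical in
/-- The approximate-square partition operator: a box similar to `R_t` is cut into `m` columns,
which are moreover cut into `n` pieces each if `t ≥ 1 - α`. -/
def approxSquareOperator (m n : ℕ) (B : Box) : Set Box :=
  if 1 - rotationAngle m n ≤ B.eccentricity n then
    {A | ∃ i < m, ∃ j < n, A = B.gridCell m n i j}
  else
    {A | ∃ i < m, A = B.gridCell m 1 i 0}

/-! ### The measure component -/

/-- The hyperbolic map `S_t = diag(n^{-t/2}, n^{t/2})`. -/
def hyperbolicMap (n : ℕ) (t : ℝ) (z : ℝ × ℝ) : ℝ × ℝ :=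
  ((n : ℝ) ^ (-t / 2) * z.1, (n : ℝ) ^ (t / 2) * z.2)

theorem measurable_hyperbolicMap (n : ℕ) (t : ℝ) : Measurable (hyperbolicMap n t) := by
  unfold hyperbolicMap
  fun_prop

/-- `S_t (π₁ μ × μ_x)`, where `μ_x` is the conditional measure of `μ` on the vertical fibre over
`x`. -/
def fibreProduct (n : ℕ) (μ : ProbabilityMeasure (ℝ × ℝ)) (t x : ℝ) :
    ProbabilityMeasure (ℝ × ℝ) :=
  ⟨((μ : Measure (ℝ × ℝ)).fst.prod ((μ : Measure (ℝ × ℝ)).condKernel x)).map (hyperbolicMap n t),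
    Measure.isProbabilityMeasure_map (measurable_hyperbolicMap n t).aemeasurable⟩

/-- The law of `S_t (π₁ μ × μ_x)` for independent `t ∼ τ` and `x ∼ π₁ μ`. -/
def fibreProductLaw (n : ℕ) (μ : ProbabilityMeasure (ℝ × ℝ)) (τ : Measure ℝ) :
    Measure (ProbabilityMeasure (ℝ × ℝ)) :=
  (τ.prod (μ : Measure (ℝ × ℝ)).fst).map fun p => fibreProduct n μ p.1 p.2

/-- The uniform measure on the first `q` points of the orbit of `0` under the rotation. -/
def periodicLaw (m n q : ℕ) : Measure ℝ :=
  (q : ℝ≥0∞)⁻¹ • ∑ k ∈ Finset.range q, Measure.dirac ((angleRotation m n)^[k] 0)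

end

/-!
A Bernoulli measure is made of independent letters (`IsBernoulli.exists_eq_map`). The first digits
`i` are i.i.d. with a law `ρ`, and the second digits are `R k (i k)`, where the random functions
`R k` are i.i.d. with a law `r` and independent of `i`. Hence `π₁ μ` is the law of the point with
digits `i`, and the fibre measure over the point with digits `u` is the law of the point with digits
`R k (u k)` (`ae_condKernel_eq`). So `limitLaw ρ r t u` is `S_t (π₁ μ × μ_x)`.

*Sceneries.* An approximate square of level `k` around a point fixes its first `k` digits in base
`m` and its first `l_k` digits in base `n`, where `l_k ≤ k` counts the wraps of the rotation by `α`
before time `k`, and its eccentricity `t_k` lies on the orbit of `0` under that rotation. As `R` is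
independent of `i`, the blow-up of `μ` along the square is the law of `S_{t_k} (x, y)`, where the
digits of `x` are fresh and those of `y` are selected from fresh functions by letters of which the
first `k - l_k` are known: they are the letters `X_s`, `l_k ≤ s < k`, of the point along which we
zoom (`exists_blowUp_digitCell`). Since `m < n`, the number `k - l_k` tends to infinity, and the
blow-up is asymptotic to `limitLaw ρ r t_k (shift^[l_k] X)` (`tendsto_sub_limitLaw`). It remains to
equidistribute the pairs `(t_k, shift^[l_k] X)`. The first entry is equidistributed by Weyl's
theorem, or by periodicity if `α` is rational. For the second one, a function of finitely many
letters has averages over `k` whose deviations from the mean are uncorrelated once the times are far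
apart, because `l_k` grows linearly; this yields a strong law of large numbers, and the joint
statement for the product of the two laws (`ae_equidistributed_sparse_shift`,
`ae_sceneryConverges`). Sampling every `q`-th level replaces `α` by `q α` and changes nothing else.

*The chain.* Let `skewMap` act on seeds `(t, u, i, R)` by rotating `t`, shifting `i`, and shifting
`u` and `R` exactly when the rotation wraps around. The law of the chain is the image of the
invariant product law under the coding of the orbit of a seed: the measure in a state is `limitLaw`
of the rotated `t` and the shifted `u`, and the box is the cell picked by the leading letters of `i`
and `R`. The Markov property expresses that the letters consumed at one step are independent of
those that remain (`furstenbergLaw_eq_map_rawState`, `isMarkovLaw_chainLaw`). For ergodicity, the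
fibre over `t` of an invariant set of seeds is a tail event for the letters, hence null or conull
(`fibre_zero_or_one`), so an invariant set comes from an invariant set of the rotation, which is
ergodic for the law of `t` (`ergodic_skewMap`).

*Digits and sides.* The coding of points by digits is injective only up to `μ`-null sets, and the
boxes of a partition own their right and upper sides only if these are inherited. If the last digit
does not have probability one, almost no sequence of digits ends in last digits, and half-open cells
determine the digits. If it has probability one, the coordinate is almost surely at the right end,
and that side is inherited by every box in sight. `Admissible` and `lastFlag` treat the two cases
together.
-/

/-! ### Splicing sequences of independent letters -/

section Splice

variable {S S₁ S₂ : Type*} [MeasurableSpace S] [MeasurableSpace S₁] [MeasurableSpace S₂]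

/-- The law of a sequence of independent letters with law `ρ`. -/
noncomputable abbrev iidLaw (ρ : Measure S) : Measure (ℕ → S) := Measure.infinitePi fun _ => ρ

/-- The sequence made of the first `N` letters of `x`, followed by `y`. -/
def splice {S : Type*} (N : ℕ) (x y : ℕ → S) : ℕ → S := fun k => if k < N then x k else y (k - N)

theorem shift_iterate_apply {X : Type*} (N : ℕ) (x : ℕ → X) (k : ℕ) :
    (shift^[N] x) k = x (k + N) := by
  induction N generalizing x with
  | zero => rfl
  | succ N ih =>
    rw [Function.iterate_succ_apply, ih]
    simp only [shift]
    congr 1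

theorem shift_iterate_splice {S : Type*} (N : ℕ) (x y : ℕ → S) :
    shift^[N] (splice N x y) = y := by
  ext k
  simp [shift_iterate_apply, splice]

theorem splice_shift_iterate {S : Type*} (N : ℕ) (x y : ℕ → S) (h : ∀ k < N, y k = x k) :
    splice N x (shift^[N] y) = y := by
  ext k
  simp only [splice, shift_iterate_apply]
  split_ifs with hk
  · exact (h k hk).symm
  · congr 1; omega

theorem splice_apply_of_lt {S : Type*} {N k : ℕ} (h : k < N) (x y : ℕ → S) :
    splice N x y k = x k := by simp [splice, h]

theorem measurable_shift {X : Type*} [MeasurableSpace X] :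
    Measurable (shift : (ℕ → X) → ℕ → X) :=
  measurable_pi_lambda _ fun k => measurable_pi_apply (k + 1)

theorem measurable_splice (N : ℕ) :
    Measurable fun p : (ℕ → S) × (ℕ → S) => splice N p.1 p.2 := by
  refine measurable_pi_lambda _ fun k => ?_
  unfold splice
  by_cases h : k < N
  · simp only [h, if_true]; fun_prop
  · simp only [h, if_false]; fun_prop

theorem measurePreserving_splice (ρ : Measure S) [IsProbabilityMeasure ρ] (N : ℕ) :
    MeasurePreserving (fun p : (ℕ → S) × (ℕ → S) => splice N p.1 p.2)
      ((iidLaw ρ).prod (iidLaw ρ)) (iidLaw ρ) := by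
  refine ⟨measurable_splice N, Measure.eq_infinitePi _ fun s t ht => ?_⟩
  rw [Measure.map_apply (measurable_splice N)
    (MeasurableSet.pi s.countable_toSet fun i _ => ht i)]
  have hset : (fun p : (ℕ → S) × (ℕ → S) => splice N p.1 p.2) ⁻¹' (s : Set ℕ).pi t =
      ((s.filter (· < N) : Finset ℕ) : Set ℕ).pi t ×ˢ
        (((s.filter (¬ · < N)).image (· - N) : Finset ℕ) : Set ℕ).pi (fun k => t (k + N)) := by
    ext ⟨x, y⟩
    simp only [mem_preimage, Set.mem_pi, mem_prod, Finset.mem_coe, Finset.mem_filter,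
      Finset.mem_image, splice]
    constructor
    · intro h
      refine ⟨fun i hi => by simpa [hi.2] using h i hi.1, ?_⟩
      rintro _ ⟨i, ⟨hi, hN⟩, rfl⟩
      have := h i hi
      rw [if_neg hN] at this
      rwa [Nat.sub_add_cancel (by omega)]
    · rintro ⟨h1, h2⟩ i hi
      by_cases hN : i < N
      · simpa [hN] using h1 i ⟨hi, hN⟩
      · have := h2 _ ⟨i, ⟨hi, hN⟩, rfl⟩
        rw [Nat.sub_add_cancel (by omega)] at this
        simpa [hN] using this
  rw [hset, Measure.prod_prod, Measure.infinitePi_pi _ fun i _ => ht i,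
    Measure.infinitePi_pi _ fun i _ => ht _, Finset.prod_image,
    ← Finset.prod_filter_mul_prod_filter_not s (· < N)]
  · congr 1
    refine Finset.prod_congr rfl fun i hi => ?_
    rw [Nat.sub_add_cancel]
    simpa using (Finset.mem_filter.1 hi).2
  · intro i hi j hj hij
    simp only [Finset.coe_filter, mem_ofPred_eq, not_lt] at hi hj
    simp only at hij
    omega

theorem measurePreserving_shift_iterate (ρ : Measure S) [IsProbabilityMeasure ρ] (N : ℕ) :
    MeasurePreserving shift^[N] (iidLaw ρ) (iidLaw ρ) := by
  have h1 : Measurable (shift^[N] : (ℕ → S) → ℕ → S) := measurable_shift.iterate N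
  refine ⟨h1, ?_⟩
  conv_lhs => rw [← (measurePreserving_splice ρ N).map_eq]
  rw [Measure.map_map h1 (measurable_splice N)]
  have : (shift^[N] ∘ fun p : (ℕ → S) × (ℕ → S) => splice N p.1 p.2) = Prod.snd := by
    ext p : 1
    exact shift_iterate_splice N p.1 p.2
  rw [this, ← Measure.snd, Measure.snd_prod]

variable {Y Y₁ Y₂ : Type*} [MeasurableSpace Y] [MeasurableSpace Y₁] [MeasurableSpace Y₂]

/-- The measurable equivalence `((a, b), (c, d)) ↦ ((a, c), (b, d))` preserves product measures. -/
theorem measurePreserving_prodProdProdComm {A B C D : Type*} [MeasurableSpace A]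
    [MeasurableSpace B] [MeasurableSpace C] [MeasurableSpace D] (a : Measure A) (b : Measure B)
    (c : Measure C) (d : Measure D) [SFinite a] [SFinite b] [SFinite c] [SFinite d] :
    MeasurePreserving (fun p : (A × B) × (C × D) => ((p.1.1, p.2.1), (p.1.2, p.2.2)))
      ((a.prod b).prod (c.prod d)) ((a.prod c).prod (b.prod d)) := by
  have h1 := measurePreserving_prodAssoc a b (c.prod d)
  have h2 := (measurePreserving_prodAssoc b c d).symm
  have h3 : MeasurePreserving Prod.swap (b.prod c) (c.prod b) := Measure.measurePreserving_swap
  have h4 := measurePreserving_prodAssoc c b d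
  have h5 := (measurePreserving_prodAssoc a c (b.prod d)).symm
  have hm := (h4.comp ((h3.prod (MeasurePreserving.id d)).comp h2))
  exact h5.comp (((MeasurePreserving.id a).prod hm).comp h1)

/-- A pair of splicings is a splicing of the product. -/
theorem measurePreserving_splice_prod {P₁ : Measure Y₁} {P₂ : Measure Y₂}
    [IsProbabilityMeasure P₁] [IsProbabilityMeasure P₂] {s₁ : Y₁ × Y₁ → Y₁} {s₂ : Y₂ × Y₂ → Y₂}
    (h₁ : MeasurePreserving s₁ (P₁.prod P₁) P₁) (h₂ : MeasurePreserving s₂ (P₂.prod P₂) P₂) :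
    MeasurePreserving (fun p : (Y₁ × Y₂) × (Y₁ × Y₂) => (s₁ (p.1.1, p.2.1), s₂ (p.1.2, p.2.2)))
      ((P₁.prod P₂).prod (P₁.prod P₂)) (P₁.prod P₂) :=
  (h₁.prod h₂).comp (measurePreserving_prodProdProdComm P₁ P₂ P₁ P₂)

/-- If splicing `x` with `y` preserves the law, then an event `E` that only sees the prefix `x` and
an event `A` that only sees the tail `y` are independent. -/
theorem measure_inter_of_splice {P : Measure Y} [IsProbabilityMeasure P] {s : Y × Y → Y}
    (h : MeasurePreserving s (P.prod P) P) {E A B : Set Y} (hE : s ⁻¹' E = E ×ˢ univ)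
    (hA : s ⁻¹' A = univ ×ˢ B) (mE : MeasurableSet E) (mA : MeasurableSet A) :
    P (E ∩ A) = P E * P B := by
  rw [← h.measure_preimage (mE.inter mA).nullMeasurableSet, preimage_inter, hE, hA,
    Set.prod_inter_prod, univ_inter, inter_univ, Measure.prod_prod]

/-- Conditionally on an event that only sees the prefix, the tail has the original law. -/
theorem map_cond_of_splice {P : Measure Y} [IsProbabilityMeasure P] {s : Y × Y → Y}
    (h : MeasurePreserving s (P.prod P) P) {E : Set Y} (hE : s ⁻¹' E = E ×ˢ univ)
    (mE : MeasurableSet E) (h0 : P E ≠ 0) {σ : Y → Y} (hσ : Measurable σ)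
    (hs : ∀ p, σ (s p) = p.2) : (P[|E]).map σ = P := by
  ext D hD
  rw [Measure.map_apply hσ hD, cond_apply mE,
    measure_inter_of_splice h hE (B := D) _ mE (hσ hD), ← mul_assoc,
    ENNReal.inv_mul_cancel h0 (measure_ne_top _ _), one_mul]
  ext p
  simp [hs]

/-- A zero-one law: an event that, for all `i`, only sees the tail of a splicing `s i`, where the
events that eventually only see the prefix generate the σ-algebra, has probability `0` or `1`. -/
theorem zero_or_one_of_splice {P : Measure Y} [IsProbabilityMeasure P] {s : ℕ → Y × Y → Y}
    (h : ∀ i, MeasurePreserving (s i) (P.prod P) P)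
    (hgen : ∀ A, MeasurableSet A → MeasurableSet[MeasurableSpace.generateFrom
      {E : Set Y | MeasurableSet E ∧ ∀ᶠ i in atTop, s i ⁻¹' E = E ×ˢ univ}] A)
    {A : Set Y} (mA : MeasurableSet A) (hA : ∀ i, ∃ B, s i ⁻¹' A = univ ×ˢ B) :
    P A = 0 ∨ P A = 1 := by
  set C := {E : Set Y | MeasurableSet E ∧ ∀ᶠ i in atTop, s i ⁻¹' E = E ×ˢ univ} with hC
  have hind : ∀ E ∈ C, P (E ∩ A) = P E * P A := by
    rintro E ⟨mE, hE⟩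
    obtain ⟨i, hi⟩ := hE.exists
    obtain ⟨B, hB⟩ := hA i
    have hAB : P A = P B := by
      have := measure_inter_of_splice (h i) (E := univ) (by simp) hB .univ mA
      simpa using this
    rw [measure_inter_of_splice (h i) hi hB mE mA, hAB]
  have hpi : IsPiSystem C := by
    rintro E ⟨mE, hE⟩ F ⟨mF, hF⟩ -
    refine ⟨mE.inter mF, ?_⟩
    filter_upwards [hE, hF] with i hi hj
    rw [preimage_inter, hi, hj, Set.prod_inter_prod, inter_univ]
  have hext : P.restrict A = P A • P := by
    refine ext_of_generate_finite C (le_antisymm (fun A hA => hgen A hA) ?_) hpi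
      (fun E hE => ?_) (by simp)
    · exact MeasurableSpace.generateFrom_le fun E hE => hE.1
    · rw [Measure.restrict_apply hE.1, hind E hE, Measure.smul_apply, smul_eq_mul, mul_comm]
  have := congrArg (fun Q : Measure Y => Q A) hext
  simp only [Measure.restrict_apply_self, Measure.smul_apply, smul_eq_mul] at this
  by_cases h0 : P A = 0
  · exact .inl h0
  · right
    have h2 : P A * 1 = P A * P A := by rw [mul_one]; exact this
    exact ((ENNReal.mul_right_inj h0 (measure_ne_top _ _)).1 h2).symm

/-- The square cylinders contain the whole space. -/
theorem nonempty_finiteSpanningSetsIn_squareCylinders (ρ : Measure S) [IsProbabilityMeasure ρ] :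
    Nonempty ((iidLaw ρ).FiniteSpanningSetsIn
      (squareCylinders fun _ : ℕ => {s : Set S | MeasurableSet s})) :=
  ⟨⟨fun _ => univ, fun _ => ⟨∅, fun _ => univ, by simp, by simp⟩, fun _ => by simp,
    iUnion_const _⟩⟩

/-- The law of two independent i.i.d. sequences, seen as a sequence of pairs, is i.i.d. -/
theorem measurePreserving_zip (ρ₁ : Measure S₁) (ρ₂ : Measure S₂) [IsProbabilityMeasure ρ₁]
    [IsProbabilityMeasure ρ₂] :
    MeasurePreserving (fun (p : (ℕ → S₁) × (ℕ → S₂)) k => (p.1 k, p.2 k))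
      ((iidLaw ρ₁).prod (iidLaw ρ₂)) (iidLaw (ρ₁.prod ρ₂)) := by
  have hz : Measurable fun (p : (ℕ → S₁) × (ℕ → S₂)) (k : ℕ) => (p.1 k, p.2 k) := by fun_prop
  have hu : Measurable fun (x : ℕ → S₁ × S₂) => ((fun k => (x k).1 : ℕ → S₁),
    (fun k => (x k).2 : ℕ → S₂)) := by fun_prop
  have key : (iidLaw ρ₁).prod (iidLaw ρ₂) = (iidLaw (ρ₁.prod ρ₂)).map
      fun (x : ℕ → S₁ × S₂) => ((fun k => (x k).1 : ℕ → S₁), (fun k => (x k).2 : ℕ → S₂)) := by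
    refine Measure.prod_eq_generateFrom generateFrom_squareCylinders generateFrom_squareCylinders
      (isPiSystem_squareCylinders (fun _ => MeasurableSpace.isPiSystem_measurableSet)
        fun _ => .univ)
      (isPiSystem_squareCylinders (fun _ => MeasurableSpace.isPiSystem_measurableSet)
        fun _ => .univ) (nonempty_finiteSpanningSetsIn_squareCylinders ρ₁).some
      (nonempty_finiteSpanningSetsIn_squareCylinders ρ₂).some ?_
    classical
    rintro _ ⟨s₁, t₁, h₁, rfl⟩ _ ⟨s₂, t₂, h₂, rfl⟩
    simp only [Set.mem_pi, mem_univ, mem_ofPred_eq, true_imp_iff] at h₁ h₂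
    rw [Measure.map_apply hu ((MeasurableSet.pi s₁.countable_toSet fun i _ => h₁ i).prod
      (MeasurableSet.pi s₂.countable_toSet fun i _ => h₂ i))]
    have hset : (fun (x : ℕ → S₁ × S₂) => ((fun k => (x k).1 : ℕ → S₁),
        (fun k => (x k).2 : ℕ → S₂))) ⁻¹' ((s₁ : Set ℕ).pi t₁ ×ˢ (s₂ : Set ℕ).pi t₂) =
        ((s₁ ∪ s₂ : Finset ℕ) : Set ℕ).pi fun k =>
          (if k ∈ s₁ then t₁ k else univ) ×ˢ (if k ∈ s₂ then t₂ k else univ) := by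
      ext x
      simp only [mem_preimage, mem_prod, Set.mem_pi, Finset.mem_coe, Finset.mem_union]
      constructor
      · rintro ⟨ha, hb⟩ i -
        constructor
        · split_ifs with hi
          exacts [ha i hi, mem_univ _]
        · split_ifs with hi
          exacts [hb i hi, mem_univ _]
      · intro h
        exact ⟨fun i hi => by simpa [hi] using (h i (.inl hi)).1,
          fun i hi => by simpa [hi] using (h i (.inr hi)).2⟩
    rw [hset, Measure.infinitePi_pi, Measure.infinitePi_pi _ fun i _ => h₁ i,
      Measure.infinitePi_pi _ fun i _ => h₂ i]
    · simp_rw [Measure.prod_prod, Finset.prod_mul_distrib]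
      congr 1
      · rw [← Finset.prod_subset Finset.subset_union_left (s₁ := s₁)]
        · exact Finset.prod_congr rfl fun i hi => by simp [hi]
        · intro i _ hi; simp [hi]
      · rw [← Finset.prod_subset Finset.subset_union_right (s₁ := s₂)]
        · exact Finset.prod_congr rfl fun i hi => by simp [hi]
        · intro i _ hi; simp [hi]
    · intro i _
      refine MeasurableSet.prod ?_ ?_
      · split_ifs
        exacts [h₁ i, .univ]
      · split_ifs
        exacts [h₂ i, .univ]
  refine ⟨hz, ?_⟩
  rw [key, Measure.map_map hz hu]
  exact Measure.map_id

end Splice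

/-! ### Averages of weakly correlated variables -/

/-- The variance bound behind `ae_tendsto_average_zero`. -/
theorem integral_sq_sum_le_of_uncorrelated {Ω : Type*} [MeasurableSpace Ω] {P : Measure Ω}
    [IsProbabilityMeasure P] {Y : ℕ → Ω → ℝ} (hY : ∀ k, Measurable (Y k)) {C : ℝ}
    (hC : ∀ k ω, |Y k ω| ≤ C) {L : ℕ} (hL : ∀ k l, k + L ≤ l → ∫ ω, Y k ω * Y l ω ∂P = 0)
    (N : ℕ) :
    ∫ ω, (∑ k ∈ Finset.range N, Y k ω) ^ 2 ∂P ≤ N * (2 * L * C ^ 2) := by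
  have hbd : ∀ k l ω, |Y k ω * Y l ω| ≤ C ^ 2 := fun k l ω => by
    rw [abs_mul, sq]
    exact mul_le_mul (hC k ω) (hC l ω) (abs_nonneg _) ((abs_nonneg _).trans (hC k ω))
  have hint : ∀ k l, Integrable (fun ω => Y k ω * Y l ω) P := fun k l =>
    Integrable.of_bound ((hY k).mul (hY l)).aestronglyMeasurable (C ^ 2)
      (ae_of_all _ fun ω => by rw [Real.norm_eq_abs]; exact hbd k l ω)
  simp_rw [sq (∑ k ∈ Finset.range N, Y k _), Finset.sum_mul_sum]
  rw [integral_finsetSum _ fun k _ => integrable_finsetSum _ fun l _ => hint k l]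
  have hrow : ∀ k ∈ Finset.range N,
      ∫ ω, ∑ l ∈ Finset.range N, Y k ω * Y l ω ∂P ≤ 2 * L * C ^ 2 := by
    intro k _
    rw [integral_finsetSum _ fun l _ => hint k l]
    have hle : ∀ l ∈ Finset.range N, ∫ ω, Y k ω * Y l ω ∂P ≤
        if l ∈ Finset.Ico (k + 1 - L) (k + L) then C ^ 2 else 0 := by
      intro l _
      split_ifs with h
      · calc ∫ ω, Y k ω * Y l ω ∂P ≤ ∫ _, C ^ 2 ∂P :=
              integral_mono (hint k l) (integrable_const _)
                fun ω => (le_abs_self _).trans (hbd k l ω)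
          _ = C ^ 2 := by simp
      · rw [Finset.mem_Ico, not_and_or] at h
        rcases h with h | h
        · simp_rw [mul_comm (Y k _)]
          exact (hL l k (by omega)).le
        · exact (hL k l (by omega)).le
    refine (Finset.sum_le_sum hle).trans ?_
    rw [← Finset.sum_filter, Finset.sum_const, nsmul_eq_mul]
    refine mul_le_mul_of_nonneg_right ?_ (sq_nonneg C)
    have : (Finset.filter (fun l => l ∈ Finset.Ico (k + 1 - L) (k + L)) (Finset.range N)).card ≤
        2 * L := by
      refine (Finset.card_le_card (t := Finset.Ico (k + 1 - L) (k + L)) fun l hl =>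
        (Finset.mem_filter.1 hl).2).trans ?_
      rw [Nat.card_Ico]; omega
    exact_mod_cast this
  refine (Finset.sum_le_sum hrow).trans ?_
  simp

/-- Strong law of large numbers for uniformly bounded variables that are uncorrelated (with zero
mean product) as soon as their indices differ by at least `L`. -/
theorem ae_tendsto_average_zero {Ω : Type*} [MeasurableSpace Ω] {P : Measure Ω}
    [IsProbabilityMeasure P] {Y : ℕ → Ω → ℝ} (hY : ∀ k, Measurable (Y k)) {C : ℝ}
    (hC : ∀ k ω, |Y k ω| ≤ C) {L : ℕ} (hL : ∀ k l, k + L ≤ l → ∫ ω, Y k ω * Y l ω ∂P = 0) :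
    ∀ᵐ ω ∂P, Tendsto (fun N : ℕ => (1 / (N : ℝ)) * ∑ k ∈ Finset.range N, Y k ω) atTop (𝓝 0) := by
  set S : ℕ → Ω → ℝ := fun N ω => ∑ k ∈ Finset.range N, Y k ω with hS
  have hSm : ∀ N, Measurable (S N) := fun N => Finset.measurable_fun_sum _ fun k _ => hY k
  have hSb : ∀ N ω, |S N ω| ≤ N * C := fun N ω => by
    refine (Finset.abs_sum_le_sum_abs _ _).trans ((Finset.sum_le_sum fun k _ => hC k ω).trans ?_)
    simp
  -- Along the squares the second moments are summable.
  have hsum : ∑' N : ℕ, ∫⁻ ω, ENNReal.ofReal ((S ((N + 1) ^ 2) ω / ((N + 1) ^ 2 : ℕ)) ^ 2) ∂P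
      ≠ ∞ := by
    have hle : ∀ N : ℕ, ∫⁻ ω, ENNReal.ofReal ((S ((N + 1) ^ 2) ω / ((N + 1) ^ 2 : ℕ)) ^ 2) ∂P ≤
        ENNReal.ofReal (2 * L * C ^ 2 * (1 / ((N + 1 : ℕ) : ℝ) ^ 2)) := by
      intro N
      rw [← ofReal_integral_eq_lintegral_ofReal]
      · refine ENNReal.ofReal_le_ofReal ?_
        simp_rw [div_pow]
        rw [integral_div]
        have h1 := integral_sq_sum_le_of_uncorrelated hY hC hL ((N + 1) ^ 2)
        have hp : (0 : ℝ) < (((N + 1) ^ 2 : ℕ) : ℝ) ^ 2 := by positivity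
        rw [div_le_iff₀ hp]
        refine h1.trans (le_of_eq ?_)
        push_cast
        field_simp
      · refine Integrable.of_bound (((hSm _).div_const _).pow_const 2).aestronglyMeasurable
          (C ^ 2) (ae_of_all _ fun ω => ?_)
        rw [Real.norm_eq_abs, abs_pow, abs_div, Nat.abs_cast]
        refine pow_le_pow_left₀ (by positivity) ?_ 2
        rw [div_le_iff₀ (by positivity), mul_comm]
        exact hSb _ ω
      · exact ae_of_all _ fun ω => sq_nonneg _
    refine ne_top_of_le_ne_top ?_ (ENNReal.tsum_le_tsum hle)
    rw [← ENNReal.ofReal_tsum_of_nonneg]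
    · exact ENNReal.ofReal_ne_top
    · intro N; positivity
    · refine Summable.mul_left _ ?_
      exact (summable_nat_add_iff 1).2 (Real.summable_one_div_nat_pow.2 one_lt_two)
  rw [← lintegral_tsum fun N => by
    exact (((hSm _).div_const _).pow_const 2).ennreal_ofReal.aemeasurable] at hsum
  filter_upwards [ae_lt_top' (AEMeasurable.tsum fun N =>
    (((hSm _).div_const _).pow_const 2).ennreal_ofReal.aemeasurable) hsum] with ω hω
  have hsq : Tendsto (fun N : ℕ => S ((N + 1) ^ 2) ω / ((N + 1) ^ 2 : ℕ)) atTop (𝓝 0) := by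
    have h1 := ENNReal.tendsto_atTop_zero_of_tsum_ne_top hω.ne
    have h2 := (ENNReal.tendsto_toReal (by simp : (0 : ℝ≥0∞) ≠ ∞)).comp h1
    have h3 : Tendsto (fun N : ℕ => (S ((N + 1) ^ 2) ω / ((N + 1) ^ 2 : ℕ)) ^ 2) atTop (𝓝 0) := by
      refine h2.congr fun N => ?_
      simp only [Function.comp_apply]
      exact ENNReal.toReal_ofReal (sq_nonneg _)
    have h4 := h3.sqrt
    rw [Real.sqrt_zero] at h4
    simp_rw [Real.sqrt_sq_eq_abs] at h4
    exact (tendsto_zero_iff_abs_tendsto_zero _).2 h4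
  -- Adding `C` to each term makes the sums monotone, so the convergence along squares suffices.
  have hmono : Tendsto (fun N : ℕ => (S N ω + N * C) / N) atTop (𝓝 C) := by
    refine tendsto_div_of_monotone_of_exists_subseq_tendsto_div (fun N => S N ω + N * C) C ?_ ?_
    · refine monotone_nat_of_le_succ fun N => ?_
      have := (abs_le.1 (hC N ω)).1
      simp only [hS, Finset.sum_range_succ]
      push_cast
      linarith
    · intro a ha
      refine ⟨fun N => (N + 1) ^ 2, ?_, ?_, ?_⟩
      · have h1 : Tendsto (fun N : ℕ => (((N + 1 + 1 : ℕ) : ℝ) / ((N + 1 : ℕ) : ℝ)) ^ 2) atTop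
            (𝓝 (1 ^ 2)) := by
          refine Tendsto.pow ?_ 2
          have h2 : Tendsto (fun N : ℕ => 1 + 1 / ((N : ℝ) + 1)) atTop (𝓝 (1 + 0)) :=
            tendsto_const_nhds.add tendsto_one_div_add_atTop_nhds_zero_nat
          rw [add_zero] at h2
          refine h2.congr fun N => ?_
          push_cast
          field_simp
        rw [one_pow] at h1
        filter_upwards [h1.eventually_lt_const ha] with N hN
        rw [div_pow, div_lt_iff₀ (by positivity)] at hN
        push_cast at hN ⊢
        exact hN.le
      · exact (tendsto_pow_atTop two_ne_zero).comp (tendsto_add_atTop_nat 1)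
      · have h1 := hsq.add_const C
        rw [zero_add] at h1
        refine h1.congr fun N => ?_
        have : ((((N + 1) ^ 2 : ℕ) : ℝ)) ≠ 0 := by positivity
        field_simp
  have h5 := hmono.sub_const C
  rw [sub_self] at h5
  refine h5.congr' ?_
  filter_upwards [eventually_gt_atTop 0] with N hN
  have : (N : ℝ) ≠ 0 := by positivity
  field_simp
  ring

/-! ### Weakly continuous functions are measurable -/

/-- A weakly continuous function on the probability measures on a separable metrizable space is
measurable for the Giry σ-algebra: it is the limit of its values at the images of the measures
under finitely valued approximations of the identity, which are continuous functions of finitely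
many weights. -/
theorem measurable_of_continuous_probabilityMeasure {X : Type*} [TopologicalSpace X]
    [TopologicalSpace.PseudoMetrizableSpace X] [SecondCountableTopology X] [MeasurableSpace X]
    [BorelSpace X] {f : ProbabilityMeasure X → ℝ} (hf : Continuous f) : Measurable f := by
  have hid : StronglyMeasurable (id : X → X) := stronglyMeasurable_id
  set d : ℕ → SimpleFunc X X := fun N => hid.approx N
  have hd : ∀ x, Tendsto (fun N => d N x) atTop (𝓝 x) := fun x => hid.tendsto_approx x
  set π : ℕ → ProbabilityMeasure X → ProbabilityMeasure X := fun N ν =>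
    ν.map (d N).measurable.aemeasurable
  have hlim : ∀ ν, Tendsto (fun N => π N ν) atTop (𝓝 ν) := by
    intro ν
    rw [ProbabilityMeasure.tendsto_iff_forall_integral_tendsto]
    intro g
    have hmap : ∀ N, ∫ x, g x ∂((π N ν : ProbabilityMeasure X) : Measure X) =
        ∫ x, g (d N x) ∂(ν : Measure X) := fun N => by
      simp only [π, ProbabilityMeasure.toMeasure_map]
      exact integral_map (d N).measurable.aemeasurable
        g.continuous.measurable.aestronglyMeasurable
    simp_rw [hmap]
    refine tendsto_integral_of_dominated_convergence (fun _ => ‖g‖)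
      (fun N => (g.continuous.measurable.comp (d N).measurable).aestronglyMeasurable)
      (integrable_const _) (fun N => ae_of_all _ fun x => g.norm_coe_le_norm _)
      (ae_of_all _ fun x => (g.continuous.tendsto x).comp (hd x))
  refine measurable_of_tendsto_metrizable (f := fun N ν => f (π N ν)) (fun N => ?_)
    (tendsto_pi_nhds.2 fun ν => (hf.tendsto ν).comp (hlim ν))
  -- `f (π N ν)` is a continuous function of the weights of the finitely many values of `d N`.
  set R := (d N).range
  let W : Type _ := {w : R → ℝ≥0 // ∑ z, w z = 1}
  have hW : ∀ w : W, IsProbabilityMeasure (∑ z, (w.1 z : ℝ≥0∞) • Measure.dirac (z : X)) := fun w =>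
    ⟨by
      rw [Measure.finsetSum_apply]
      simp only [Measure.smul_apply, measure_univ, smul_eq_mul, mul_one]
      exact_mod_cast congrArg ((↑) : ℝ≥0 → ℝ≥0∞) w.2⟩
  let Φ : W → ProbabilityMeasure X := fun w => ⟨∑ z, (w.1 z : ℝ≥0∞) • Measure.dirac (z : X), hW w⟩
  have hΦ : Continuous Φ := by
    rw [continuous_iff_continuousAt]
    intro w
    rw [ContinuousAt, ProbabilityMeasure.tendsto_iff_forall_integral_tendsto]
    intro g
    have : ∀ w : W, ∫ x, g x ∂((Φ w : ProbabilityMeasure X) : Measure X) =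
        ∑ z, (w.1 z : ℝ) * g z := fun w => by
      simp only [Φ, ProbabilityMeasure.coe_mk]
      rw [integral_finsetSum_measure]
      · refine Finset.sum_congr rfl fun z _ => ?_
        rw [integral_smul_measure, integral_dirac']
        · simp
        · exact g.continuous.stronglyMeasurable
      · intro z _
        exact Integrable.smul_measure (g.integrable _) ENNReal.coe_ne_top
    simp_rw [this]
    refine Continuous.tendsto ?_ w
    refine continuous_finsetSum _ fun z _ => Continuous.mul ?_ continuous_const
    exact NNReal.continuous_coe.comp ((continuous_apply z).comp continuous_subtype_val)
  have hweights : ∀ ν : ProbabilityMeasure X,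
      ∑ z : R, ν (d N ⁻¹' {(z : X)}) = 1 := fun ν => by
    rw [← ENNReal.coe_inj]
    push_cast
    simp only [ProbabilityMeasure.ennreal_coeFn_eq_coeFn_toMeasure]
    rw [Finset.sum_coe_sort R fun z => (ν : Measure X) (d N ⁻¹' {z}),
      SimpleFunc.sum_range_measure_preimage_singleton, measure_univ]
  have hfac : (fun ν => f (π N ν)) = (f ∘ Φ) ∘ fun ν : ProbabilityMeasure X =>
      (⟨fun z : R => ν (d N ⁻¹' {(z : X)}), hweights ν⟩ : W) := by
    ext ν
    simp only [Function.comp_apply]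
    congr 1
    ext s hs
    simp only [π, Φ, ProbabilityMeasure.toMeasure_map, ProbabilityMeasure.coe_mk,
      ProbabilityMeasure.ennreal_coeFn_eq_coeFn_toMeasure]
    rw [Measure.map_apply (d N).measurable hs, Measure.finsetSum_apply]
    simp only [Measure.smul_apply, Measure.dirac_apply' _ hs, smul_eq_mul]
    rw [Finset.sum_coe_sort R fun z => (ν : Measure X) (d N ⁻¹' {z}) * s.indicator 1 z]
    classical
    have : d N ⁻¹' s = d N ⁻¹' ((R.filter (· ∈ s) : Finset X) : Set X) := by
      ext x
      simp [R]
    rw [this, ← SimpleFunc.sum_measure_preimage_singleton, Finset.sum_filter]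
    refine Finset.sum_congr rfl fun z _ => ?_
    by_cases hz : z ∈ s <;> simp [hz]
  rw [hfac]
  refine (hf.comp hΦ).measurable.comp (Measurable.subtype_mk ?_)
  refine measurable_pi_lambda _ fun z => ?_
  exact ((Measure.measurable_coe ((d N).measurableSet_preimage _)).comp
    measurable_subtype_coe).ennreal_toNNReal

/-! ### Equidistribution -/

/-- The sequence `x` of real numbers is equidistributed with respect to `τ`, tested on continuous
functions. -/
def Equidistributed (x : ℕ → ℝ) (τ : Measure ℝ) : Prop :=
  ∀ g : ℝ → ℝ, Continuous g →
    Tendsto (fun N : ℕ => (1 / (N : ℝ)) * ∑ k ∈ Finset.range N, g (x k)) atTop (𝓝 (∫ t, g t ∂τ))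

/-- Pointwise convergence of `1`-Lipschitz maps passes to the closure. -/
theorem tendsto_of_mem_closure_of_lipschitz {E F : Type*} [PseudoMetricSpace E]
    [PseudoMetricSpace F] {A : ℕ → E → F} {I : E → F} (hA : ∀ N, LipschitzWith 1 (A N))
    (hI : LipschitzWith 1 I) {D : Set E} (hD : ∀ d ∈ D, Tendsto (fun N => A N d) atTop (𝓝 (I d)))
    {f : E} (hf : f ∈ closure D) : Tendsto (fun N => A N f) atTop (𝓝 (I f)) := by
  rw [Metric.tendsto_atTop]
  intro ε hε
  obtain ⟨d, hd, hfd⟩ := Metric.mem_closure_iff.1 hf (ε / 3) (by positivity)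
  obtain ⟨N₀, hN₀⟩ := Metric.tendsto_atTop.1 (hD d hd) (ε / 3) (by positivity)
  refine ⟨N₀, fun N hN => ?_⟩
  have h1 := (hA N).dist_le_mul f d
  have h2 := hI.dist_le_mul d f
  have h3 := hN₀ N hN
  rw [dist_comm d f] at h2
  simp only [NNReal.coe_one, one_mul] at h1 h2
  linarith [dist_triangle4 (A N f) (A N d) (I d) (I f)]

theorem norm_average_le {E : Type*} [NormedAddCommGroup E] [NormedSpace ℝ E] {a : ℕ → E} {C : ℝ}
    (h0 : 0 ≤ C) (h : ∀ k, ‖a k‖ ≤ C) (N : ℕ) :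
    ‖(1 / (N : ℝ)) • ∑ k ∈ Finset.range N, a k‖ ≤ C := by
  rw [norm_smul]
  have h1 : ‖∑ k ∈ Finset.range N, a k‖ ≤ N * C := by
    refine (norm_sum_le _ _).trans ((Finset.sum_le_sum fun k _ => h k).trans ?_)
    simp
  rcases Nat.eq_zero_or_pos N with rfl | hN
  · simpa using h0
  · have hN' : (0 : ℝ) < N := by exact_mod_cast hN
    calc ‖1 / (N : ℝ)‖ * ‖∑ k ∈ Finset.range N, a k‖ ≤ ‖1 / (N : ℝ)‖ * (N * C) := by gcongr
      _ = C := by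
        rw [Real.norm_eq_abs, abs_of_pos (by positivity)]
        field_simp

section Weyl

variable {β : ℝ} (hβ : Irrational β)
include hβ

theorem fourier_irrational_ne_one {n : ℤ} (hn : n ≠ 0) :
    (fourier n : C(UnitAddCircle, ℂ)) (β : UnitAddCircle) ≠ 1 := by
  rw [fourier_coe_apply, Ne, Complex.exp_eq_one_iff]
  rintro ⟨j, hj⟩
  have h1 : (n : ℂ) * β = j := by
    have h2 : (2 * Real.pi * Complex.I : ℂ) ≠ 0 := Complex.two_pi_I_ne_zero
    apply mul_left_cancel₀ h2
    rw [mul_comm (j : ℂ)] at *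
    simpa [mul_assoc] using hj
  have h2 : (n : ℝ) * β = j := by exact_mod_cast h1
  exact (hβ.intCast_mul hn).ne_int j h2

theorem tendsto_average_fourier (n : ℤ) :
    Tendsto (fun N : ℕ => (1 / (N : ℝ)) • ∑ k ∈ Finset.range N,
      (fourier n : C(UnitAddCircle, ℂ)) ((k * β : ℝ) : UnitAddCircle)) atTop
      (𝓝 (∫ x, (fourier n : C(UnitAddCircle, ℂ)) x)) := by
  rcases eq_or_ne n 0 with rfl | hn
  · simp only [fourier_zero, Finset.sum_const, Finset.card_range]
    have : ∫ _ : UnitAddCircle, (1 : ℂ) = 1 := by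
      simp [measureReal_def]
    rw [this]
    refine tendsto_const_nhds.congr' ?_
    filter_upwards [eventually_gt_atTop 0] with N hN
    have : (N : ℂ) ≠ 0 := by exact_mod_cast hN.ne'
    simp [this]
  set z := (fourier n : C(UnitAddCircle, ℂ)) (β : UnitAddCircle) with hz
  have hz1 : z ≠ 1 := fourier_irrational_ne_one hβ hn
  have hzn : ‖z‖ = 1 := by rw [hz, fourier_apply]; exact Circle.norm_coe _
  have hpow : ∀ k : ℕ, (fourier n : C(UnitAddCircle, ℂ)) ((k * β : ℝ) : UnitAddCircle) = z ^ k := by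
    intro k
    rw [hz, fourier_coe_apply, fourier_coe_apply, ← Complex.exp_nat_mul]
    congr 1
    push_cast
    ring
  have hint : ∫ x, (fourier n : C(UnitAddCircle, ℂ)) x = 0 := by
    have h1 : ∫ x, (fourier n : C(UnitAddCircle, ℂ)) x =
        z * ∫ x, (fourier n : C(UnitAddCircle, ℂ)) x := by
      conv_lhs => rw [← integral_add_right_eq_self _ (β : UnitAddCircle)]
      rw [← integral_const_mul]
      refine integral_congr_ae (ae_of_all _ fun x => ?_)
      simp only [fourier_apply, hz, smul_add, AddCircle.toCircle_add, Circle.coe_mul]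
      ring
    have h2 : (1 - z) * ∫ x, (fourier n : C(UnitAddCircle, ℂ)) x = 0 := by
      rw [sub_mul, one_mul, ← h1, sub_self]
    exact (mul_eq_zero.1 h2).resolve_left (sub_ne_zero.2 hz1.symm)
  rw [hint]
  simp_rw [hpow, geom_sum_eq hz1]
  refine squeeze_zero_norm (a := fun N : ℕ => (2 / ‖z - 1‖) * (1 / (N : ℝ))) (fun N => ?_) ?_
  · rw [norm_smul, Real.norm_eq_abs, abs_of_nonneg (by positivity), mul_comm, norm_div]
    have h2 : ‖z ^ N - 1‖ ≤ 2 := by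
      refine (norm_sub_le _ _).trans ?_
      rw [norm_pow, hzn, one_pow, norm_one]
      norm_num
    gcongr
  · have := (tendsto_one_div_atTop_nhds_zero_nat (𝕜 := ℝ)).const_mul (2 / ‖z - 1‖)
    simpa using this

/-- Weyl's theorem on the circle. -/
theorem tendsto_average_circle (f : C(UnitAddCircle, ℂ)) :
    Tendsto (fun N : ℕ => (1 / (N : ℝ)) • ∑ k ∈ Finset.range N, f ((k * β : ℝ) : UnitAddCircle))
      atTop (𝓝 (∫ x, f x)) := by
  have hint : ∀ g : C(UnitAddCircle, ℂ), Integrable g := fun g =>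
    Integrable.of_bound g.continuous.aestronglyMeasurable ‖g‖ (ae_of_all _ g.norm_coe_le_norm)
  refine tendsto_of_mem_closure_of_lipschitz
    (A := fun N (f : C(UnitAddCircle, ℂ)) =>
      (1 / (N : ℝ)) • ∑ k ∈ Finset.range N, f ((k * β : ℝ) : UnitAddCircle))
    (I := fun f => ∫ x, f x) (D := ((Submodule.span ℂ (range fourier) : Submodule ℂ C(UnitAddCircle, ℂ)) :
      Set C(UnitAddCircle, ℂ))) ?_ ?_ ?_ ?_
  · refine fun N => LipschitzWith.of_dist_le_mul fun f g => ?_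
    rw [dist_eq_norm, ← smul_sub, ← Finset.sum_sub_distrib, NNReal.coe_one, one_mul]
    refine norm_average_le dist_nonneg (fun k => ?_) N
    rw [← dist_eq_norm]
    exact ContinuousMap.dist_apply_le_dist _
  · refine LipschitzWith.of_dist_le_mul fun f g => ?_
    rw [dist_eq_norm, ← integral_sub (hint f) (hint g), NNReal.coe_one, one_mul]
    refine (norm_integral_le_of_norm_le_const (C := dist f g) (ae_of_all _ fun x => ?_)).trans ?_
    · rw [← dist_eq_norm]
      exact ContinuousMap.dist_apply_le_dist _
    · simp [measureReal_def]
  · intro d hd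
    induction hd using Submodule.span_induction with
    | mem x hx => obtain ⟨n, rfl⟩ := hx; exact tendsto_average_fourier hβ n
    | zero => simp
    | add x y _ _ hx hy =>
      have := hx.add hy
      rw [← integral_add (hint x) (hint y)] at this
      refine this.congr fun N => ?_
      simp only [ContinuousMap.add_apply, Finset.sum_add_distrib, smul_add]
    | smul a x _ hx =>
      have := hx.const_mul a
      rw [← integral_const_mul] at this
      refine this.congr fun N => ?_
      simp only [ContinuousMap.smul_apply, smul_eq_mul, ← Finset.mul_sum]
      rw [mul_smul_comm]
  · have := span_fourier_closure_eq_top (T := (1 : ℝ))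
    rw [← Submodule.topologicalClosure_coe, this]
    trivial

theorem tendsto_average_of_eq_endpoints {g : ℝ → ℝ} (hg : Continuous g) (h01 : g 0 = g 1) :
    Tendsto (fun N : ℕ => (1 / (N : ℝ)) * ∑ k ∈ Finset.range N, g (Int.fract (k * β))) atTop
      (𝓝 (∫ t in Ico (0 : ℝ) 1, g t)) := by
  have hc : Continuous (AddCircle.liftIco (1 : ℝ) 0 g) :=
    AddCircle.liftIco_zero_continuous h01 hg.continuousOn
  have h := tendsto_average_circle hβ 
    ⟨fun x : UnitAddCircle => ((AddCircle.liftIco (1 : ℝ) 0 g x : ℝ) : ℂ),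
      Complex.continuous_ofReal.comp hc⟩
  have hval : ∀ x : ℝ, AddCircle.liftIco (1 : ℝ) 0 g (x : UnitAddCircle) = g (Int.fract x) := by
    intro x
    have : (x : UnitAddCircle) = (Int.fract x : ℝ) := by
      rw [Int.fract, AddCircle.coe_sub, eq_comm, sub_eq_self, AddCircle.coe_eq_zero_iff]
      exact ⟨⌊x⌋, by simp⟩
    rw [this, AddCircle.liftIco_zero_coe_apply ⟨Int.fract_nonneg _, Int.fract_lt_one _⟩]
  have hlim : ∫ x : UnitAddCircle, ((AddCircle.liftIco (1 : ℝ) 0 g x : ℝ) : ℂ) =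
      ((∫ t in Ico (0 : ℝ) 1, g t : ℝ) : ℂ) := by
    rw [integral_complex_ofReal, ← UnitAddCircle.integral_preimage 0, zero_add,
      ← setIntegral_congr_set Ico_ae_eq_Ioc]
    congr 1
    refine setIntegral_congr_fun measurableSet_Ico fun t ht => ?_
    rw [hval, Int.fract_eq_self.2 ht]
  simp only [ContinuousMap.coe_mk, hval] at h
  rw [hlim] at h
  have h2 := (Complex.continuous_re.tendsto _).comp h
  simp only [Complex.ofReal_re] at h2
  refine h2.congr fun N => ?_
  simp only [Function.comp_apply]
  rw [← Complex.ofReal_sum, Complex.real_smul, ← Complex.ofReal_mul, Complex.ofReal_re]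

/-- Weyl's theorem for the sawtooth: it is squeezed between continuous functions with equal values
at `0` and `1`. -/
theorem tendsto_average_fract :
    Tendsto (fun N : ℕ => (1 / (N : ℝ)) * ∑ k ∈ Finset.range N, Int.fract (k * β)) atTop
      (𝓝 (∫ t in Ico (0 : ℝ) 1, t)) := by
  have hae : ∀ᵐ t ∂(volume.restrict (Ico (0 : ℝ) 1)), t ∈ Ioo (0 : ℝ) 1 := by
    rw [← restrict_Ioo_eq_restrict_Ico]
    exact ae_restrict_mem measurableSet_Ioo
  have hbound : ∀ (s : ℕ → ℝ → ℝ), (∀ K, Continuous (s K)) →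
      (∀ K t, t ∈ Ioo (0 : ℝ) 1 → |s K t - t| ≤ 1) →
      (∀ t ∈ Ioo (0 : ℝ) 1, ∀ᶠ K in atTop, s K t = t) →
      Tendsto (fun K => ∫ t in Ico (0 : ℝ) 1, s K t) atTop (𝓝 (∫ t in Ico (0 : ℝ) 1, t)) := by
    intro s hs hb he
    refine tendsto_integral_of_dominated_convergence (fun _ => 2)
      (fun K => (hs K).aestronglyMeasurable) (integrable_const _) (fun K => ?_) ?_
    · filter_upwards [hae] with t ht
      have := abs_le.1 (hb K t ht)
      rw [Real.norm_eq_abs, abs_le]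
      constructor <;> linarith [ht.1, ht.2]
    · filter_upwards [hae] with t ht
      exact tendsto_const_nhds.congr' ((he t ht).mono fun K hK => hK.symm)
  have hmono : ∀ (a b : ℝ → ℝ), (∀ t ∈ Ico (0 : ℝ) 1, a t ≤ b t) → ∀ N : ℕ,
      (1 / (N : ℝ)) * ∑ k ∈ Finset.range N, a (Int.fract (k * β)) ≤
      (1 / (N : ℝ)) * ∑ k ∈ Finset.range N, b (Int.fract (k * β)) := fun a b hab N =>
    mul_le_mul_of_nonneg_left (Finset.sum_le_sum fun k _ =>
      hab _ ⟨Int.fract_nonneg _, Int.fract_lt_one _⟩) (by positivity)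
  rw [tendsto_order]
  constructor
  · intro a ha
    have hs := hbound (fun K t => min t (K * (1 - t))) (fun K => by fun_prop)
      (fun K t ht => by
        have : (0 : ℝ) ≤ K * (1 - t) := mul_nonneg K.cast_nonneg (by linarith [ht.2])
        rw [abs_le]
        rcases min_cases t ((K : ℝ) * (1 - t)) with h | h <;> rw [h.1] <;>
          constructor <;> linarith [ht.1, ht.2])
      (fun t ht => by
        have h1 : Tendsto (fun K : ℕ => (K : ℝ) * (1 - t)) atTop atTop :=
          tendsto_natCast_atTop_atTop.atTop_mul_const (by linarith [ht.2])
        filter_upwards [h1.eventually_ge_atTop t] with K hK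
        exact min_eq_left hK)
    obtain ⟨K, hK⟩ := (hs.eventually_const_lt ha).exists
    have := tendsto_average_of_eq_endpoints hβ (g := fun t => min t (K * (1 - t)))
      (by fun_prop) (by simp)
    filter_upwards [this.eventually_const_lt hK] with N hN
    exact hN.trans_le (hmono (fun t => min t (K * (1 - t))) (fun t => t) (fun t _ => min_le_left _ _) N)
  · intro a ha
    have hs := hbound (fun K t => max t (1 - K * t)) (fun K => by fun_prop)
      (fun K t ht => by
        have : (0 : ℝ) ≤ K * t := mul_nonneg K.cast_nonneg ht.1.le
        rw [abs_le]
        rcases max_cases t (1 - (K : ℝ) * t) with h | h <;> rw [h.1] <;>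
          constructor <;> linarith [ht.1, ht.2])
      (fun t ht => by
        have h1 : Tendsto (fun K : ℕ => (K : ℝ) * t) atTop atTop :=
          tendsto_natCast_atTop_atTop.atTop_mul_const ht.1
        filter_upwards [h1.eventually_ge_atTop 1] with K hK
        exact max_eq_left (by linarith [ht.1]))
    obtain ⟨K, hK⟩ := (hs.eventually_lt_const ha).exists
    have := tendsto_average_of_eq_endpoints hβ (g := fun t => max t (1 - K * t))
      (by fun_prop) (by simp)
    filter_upwards [this.eventually_lt_const hK] with N hN
    exact (hmono (fun t => t) (fun t => max t (1 - K * t)) (fun t _ => le_max_left _ _) N).trans_lt hN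

/-- Weyl's theorem: the fractional parts of the multiples of an irrational number are
equidistributed, also with respect to functions that do not close up at the end points. -/
theorem equidistributed_fract_of_irrational :
    Equidistributed (fun k => Int.fract (k * β)) (volume.restrict (Ico (0 : ℝ) 1)) := by
  intro g hg
  have h1 := tendsto_average_of_eq_endpoints hβ (g := fun t => g t - (g 1 - g 0) * t)
    (by fun_prop) (by ring)
  have h2 := h1.add ((tendsto_average_fract hβ).const_mul (g 1 - g 0))
  have hi : ∀ f : ℝ → ℝ, Continuous f → Integrable f (volume.restrict (Ico (0 : ℝ) 1)) :=
    fun f hf => (hf.integrableOn_Icc (a := 0) (b := 1)).mono_set Ico_subset_Icc_self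
  rw [← integral_const_mul, ← integral_add (hi _ (by fun_prop)) (hi _ (by fun_prop))] at h2
  simp only [sub_add_cancel] at h2
  refine h2.congr fun N => ?_
  simp only [Finset.sum_sub_distrib, ← Finset.mul_sum]
  ring

end Weyl

/-- A periodic sequence is equidistributed with respect to the uniform measure on its period. -/
theorem equidistributed_of_periodic {x : ℕ → ℝ} {q : ℕ} (hq : 0 < q) (hx : ∀ k, x (k + q) = x k) :
    Equidistributed x ((q : ℝ≥0∞)⁻¹ • ∑ k ∈ Finset.range q, Measure.dirac (x k)) := by
  intro g hg
  set s : ℕ → ℝ := fun N => ∑ k ∈ Finset.range N, g (x k) with hs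
  have hq' : (0 : ℝ) < q := by exact_mod_cast hq
  have hint : ∫ t, g t ∂((q : ℝ≥0∞)⁻¹ • ∑ k ∈ Finset.range q, Measure.dirac (x k)) = s q / q := by
    rw [integral_smul_measure, integral_finsetSum_measure fun k _ => by
      exact integrable_dirac (by simp)]
    simp [hs, integral_dirac, div_eq_inv_mul]
  rw [hint]
  -- The deviation of the sums from linear growth is periodic, hence bounded.
  set d : ℕ → ℝ := fun N => s N - N * (s q / q) with hd
  have hper : ∀ N, s (N + q) = s N + s q := by
    intro N
    induction N with
    | zero => simp [hs]
    | succ N ih =>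
      have h1 : s (N + 1 + q) = s (N + q) + g (x (N + q)) := by
        rw [show N + 1 + q = N + q + 1 by ring]; exact Finset.sum_range_succ _ _
      have h2 : s (N + 1) = s N + g (x N) := Finset.sum_range_succ _ _
      rw [h1, h2, ih, hx]; ring
  have hdper : Function.Periodic d q := by
    intro N
    simp only [hd, hper]
    push_cast
    field_simp
    ring
  obtain ⟨C, hC⟩ : ∃ C, ∀ N, |d N| ≤ C := by
    refine ⟨∑ k ∈ Finset.range q, |d k|, fun N => ?_⟩
    rw [← hdper.map_mod_nat]
    exact Finset.single_le_sum (f := fun k => |d k|) (fun k _ => abs_nonneg _)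
      (Finset.mem_range.2 (Nat.mod_lt _ hq))
  have h0 : Tendsto (fun N : ℕ => (1 / (N : ℝ)) * d N) atTop (𝓝 0) := by
    refine squeeze_zero_norm (a := fun N : ℕ => C * (1 / (N : ℝ))) (fun N => ?_) ?_
    · rw [norm_mul, Real.norm_eq_abs, Real.norm_eq_abs, abs_of_nonneg (by positivity), mul_comm]
      exact mul_le_mul_of_nonneg_right (hC N) (by positivity)
    · have := (tendsto_one_div_atTop_nhds_zero_nat (𝕜 := ℝ)).const_mul C
      simpa using this
  have h1 := h0.add_const (s q / q)
  rw [zero_add] at h1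
  refine h1.congr' ?_
  filter_upwards [eventually_gt_atTop 0] with N hN
  have : (0 : ℝ) < N := by exact_mod_cast hN
  simp only [hd]
  field_simp
  ring

/-! ### Equidistribution of sparse shifts of a random sequence -/

theorem continuous_splice_left {S : Type*} [TopologicalSpace S] (N : ℕ) (y : ℕ → S) :
    Continuous fun x => splice N x y := by
  refine continuous_pi fun k => ?_
  unfold splice
  by_cases h : k < N
  · simp only [h, if_true]; fun_prop
  · simp only [h, if_false]; fun_prop

section SparseShifts

variable {S : Type*} [Finite S] [TopologicalSpace S] [DiscreteTopology S]

/-- A continuous function on `[0, 1] × S^ℕ` depends, up to `ε`, on finitely many letters only. -/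
theorem exists_forall_dist_lt_of_cylinder (F : C(Icc (0 : ℝ) 1 × (ℕ → S), ℝ)) {ε : ℝ} (hε : 0 < ε) :
    ∃ K : ℕ, ∀ t u v, (∀ k < K, u k = v k) → dist (F (t, u)) (F (t, v)) < ε := by
  by_contra! hcon
  choose t u v huv hd using hcon
  obtain ⟨⟨t₀, u₀, v₀⟩, φ, hφ, hlim⟩ := CompactSpace.tendsto_subseq fun K => (t K, u K, v K)
  have ht : Tendsto (fun K => t (φ K)) atTop (𝓝 t₀) := (continuous_fst.tendsto _).comp hlim
  have hu : Tendsto (fun K => u (φ K)) atTop (𝓝 u₀) :=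
    ((continuous_fst.comp continuous_snd).tendsto _).comp hlim
  have hv : Tendsto (fun K => v (φ K)) atTop (𝓝 v₀) :=
    ((continuous_snd.comp continuous_snd).tendsto _).comp hlim
  have heq : u₀ = v₀ := by
    ext k
    refine tendsto_nhds_unique_of_eventuallyEq (tendsto_pi_nhds.1 hu k) (tendsto_pi_nhds.1 hv k) ?_
    filter_upwards [eventually_gt_atTop k] with K hK
    exact huv (φ K) k (hK.trans_le hφ.le_apply)
  subst heq
  have h0 : Tendsto (fun K => dist (F (t (φ K), u (φ K))) (F (t (φ K), v (φ K)))) atTop (𝓝 0) := by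
    have h := ((F.continuous.tendsto _).comp (ht.prodMk_nhds hu)).dist
      ((F.continuous.tendsto _).comp (ht.prodMk_nhds hv))
    rwa [dist_self] at h
  obtain ⟨K, hK⟩ := (h0.eventually_lt_const hε).exists
  exact absurd (hd (φ K)) (not_le.2 hK)

variable [MeasurableSpace S] [BorelSpace S]

theorem ae_tendsto_average_of_cylinder (ρ : Measure S) [IsProbabilityMeasure ρ] {x : ℕ → ℝ}
    {l : ℕ → ℕ} {τ : Measure ℝ} (hxτ : Equidistributed x τ)
    (hl : ∀ K, ∃ L, ∀ k k', k + L ≤ k' → l k + K ≤ l k') {F : ℝ × (ℕ → S) → ℝ}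
    (hF : Continuous F) {C : ℝ} (hC : ∀ z, |F z| ≤ C) {K : ℕ}
    (hK : ∀ t u v, F (t, splice K u v) = F (t, u)) :
    ∀ᵐ u ∂iidLaw ρ, Tendsto (fun N : ℕ => (1 / (N : ℝ)) *
      ∑ k ∈ Finset.range N, F (x k, shift^[l k] u)) atTop
      (𝓝 (∫ t, ∫ u, F (t, u) ∂iidLaw ρ ∂τ)) := by
  set G : ℝ → ℝ := fun t => ∫ u, F (t, u) ∂iidLaw ρ with hG
  have hFi : ∀ t, Integrable (fun u => F (t, u)) (iidLaw ρ) := fun t =>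
    Integrable.of_bound (Continuous.aestronglyMeasurable (by fun_prop)) C
      (ae_of_all _ fun u => hC _)
  have hGc : Continuous G := by
    refine continuous_of_dominated (bound := fun _ => C)
      (fun t => Continuous.aestronglyMeasurable (by fun_prop))
      (fun t => ae_of_all _ fun u => hC _) (integrable_const _)
      (ae_of_all _ fun u => by fun_prop)
  have hGC : ∀ t, |G t| ≤ C := fun t => by
    have := norm_integral_le_of_norm_le_const (μ := iidLaw ρ) (f := fun u => F (t, u))
      (C := C) (ae_of_all _ fun u => hC _)
    simpa using this
  have hshift : ∀ N : ℕ, Measurable (shift^[N] : (ℕ → S) → ℕ → S) := fun N =>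
    measurable_shift.iterate N
  -- The centred variables are uncorrelated as soon as they see disjoint blocks of letters.
  set Y : ℕ → (ℕ → S) → ℝ := fun k u => F (x k, shift^[l k] u) - G (x k) with hY
  have hYm : ∀ k, Measurable (Y k) := fun k =>
    (hF.measurable.comp (measurable_const.prodMk (hshift _))).sub_const _
  have hYb : ∀ k u, |Y k u| ≤ 2 * C := fun k u => by
    have := abs_sub (F (x k, shift^[l k] u)) (G (x k))
    linarith [hC (x k, shift^[l k] u), hGC (x k)]
  obtain ⟨L, hL⟩ := hl K
  have huncor : ∀ k k', k + L ≤ k' → ∫ u, Y k u * Y k' u ∂iidLaw ρ = 0 := by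
    intro k k' hkk
    have hll := hL k k' hkk
    have hmp := measurePreserving_splice ρ (l k')
    rw [← hmp.map_eq, integral_map hmp.aemeasurable
      (f := fun u => Y k u * Y k' u) ((hYm k).mul (hYm k')).aestronglyMeasurable]
    have hfac : ∀ p : (ℕ → S) × (ℕ → S), Y k (splice (l k') p.1 p.2) * Y k' (splice (l k') p.1 p.2) =
        Y k p.1 * (F (x k', p.2) - G (x k')) := by
      intro p
      have h1 : shift^[l k] (splice (l k') p.1 p.2) =
          splice K (shift^[l k] p.1) (shift^[K] (shift^[l k] (splice (l k') p.1 p.2))) := by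
        refine (splice_shift_iterate K _ _ fun j hj => ?_).symm
        rw [shift_iterate_apply, shift_iterate_apply, splice_apply_of_lt (by omega)]
      simp only [hY, shift_iterate_splice]
      rw [h1, hK]
    simp_rw [hfac]
    rw [integral_prod_mul (f := Y k) (g := fun v => F (x k', v) - G (x k')),
      integral_sub (hFi _) (integrable_const _)]
    simp [hG]
  filter_upwards [ae_tendsto_average_zero hYm hYb huncor] with u hu
  have h := hu.add (hxτ G hGc)
  rw [zero_add] at h
  refine h.congr fun N => ?_
  rw [← mul_add, ← Finset.sum_add_distrib]
  simp [hY]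

/-- If `x` is equidistributed with respect to `τ`, and the times `l` grow at a linear speed, then
for almost every i.i.d. sequence `u` the points `(x k, shift^[l k] u)` are equidistributed with
respect to the product of `τ` and the i.i.d. law. -/
theorem ae_equidistributed_sparse_shift (ρ : Measure S) [IsProbabilityMeasure ρ] {x : ℕ → ℝ}
    {l : ℕ → ℕ} {τ : Measure ℝ} [IsProbabilityMeasure τ] (hx : ∀ k, x k ∈ Icc (0 : ℝ) 1)
    (hτ : ∀ᵐ t ∂τ, t ∈ Icc (0 : ℝ) 1) (hxτ : Equidistributed x τ)
    (hl : ∀ K, ∃ L, ∀ k k', k + L ≤ k' → l k + K ≤ l k') :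
    ∀ᵐ u ∂iidLaw ρ, ∀ F : ℝ × (ℕ → S) → ℝ, Continuous F →
      Tendsto (fun N : ℕ => (1 / (N : ℝ)) * ∑ k ∈ Finset.range N, F (x k, shift^[l k] u)) atTop
        (𝓝 (∫ t, ∫ u, F (t, u) ∂iidLaw ρ ∂τ)) := by
  obtain ⟨u₀⟩ : Nonempty (ℕ → S) := (iidLaw ρ).nonempty_of_neZero
  let ext : C(Icc (0 : ℝ) 1 × (ℕ → S), ℝ) → ℝ × (ℕ → S) → ℝ := fun F z =>
    F (projIcc 0 1 zero_le_one z.1, z.2)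
  have hext : ∀ F, Continuous (ext F) := fun F =>
    F.continuous.comp ((continuous_projIcc.comp continuous_fst).prodMk continuous_snd)
  have hextb : ∀ F z, |ext F z| ≤ ‖F‖ := fun F z => F.norm_coe_le_norm _
  let trunc : ℕ → C(Icc (0 : ℝ) 1 × (ℕ → S), ℝ) → C(Icc (0 : ℝ) 1 × (ℕ → S), ℝ) := fun K F =>
    ⟨fun z => F (z.1, splice K z.2 u₀), F.continuous.comp (continuous_fst.prodMk
      ((continuous_splice_left K u₀).comp continuous_snd))⟩
  have hcountable : ∀ᵐ u ∂iidLaw ρ, ∀ j K : ℕ, Tendsto (fun N : ℕ => (1 / (N : ℝ)) *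
      ∑ k ∈ Finset.range N, ext (trunc K (TopologicalSpace.denseSeq _ j)) (x k, shift^[l k] u))
      atTop (𝓝 (∫ t, ∫ u, ext (trunc K (TopologicalSpace.denseSeq _ j)) (t, u) ∂iidLaw ρ ∂τ)) := by
    rw [ae_all_iff]
    intro j
    rw [ae_all_iff]
    intro K
    refine ae_tendsto_average_of_cylinder ρ hxτ hl (hext _) (hextb _) (K := K) fun t u v => ?_
    simp only [ext, trunc, ContinuousMap.coe_mk]
    congr 2
    ext k
    simp only [splice]
    split_ifs <;> rfl
  filter_upwards [hcountable] with u hu F hF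
  let F' : C(Icc (0 : ℝ) 1 × (ℕ → S), ℝ) := ⟨fun z => F (z.1, z.2), by fun_prop⟩
  have hF' : ∀ t ∈ Icc (0 : ℝ) 1, ∀ v, F (t, v) = ext F' (t, v) := fun t ht v => by
    simp only [ext, F', ContinuousMap.coe_mk]
    rw [projIcc_of_mem _ ht]
  have hlim : ∫ t, ∫ u, F (t, u) ∂iidLaw ρ ∂τ = ∫ t, ∫ u, ext F' (t, u) ∂iidLaw ρ ∂τ :=
    integral_congr_ae (hτ.mono fun t ht => by simp only [hF' t ht])
  rw [hlim]
  have hsum : ∀ N : ℕ, ∑ k ∈ Finset.range N, F (x k, shift^[l k] u) =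
      ∑ k ∈ Finset.range N, ext F' (x k, shift^[l k] u) := fun N =>
    Finset.sum_congr rfl fun k _ => hF' _ (hx k) _
  simp_rw [hsum]
  have hint : ∀ F t, Integrable (fun u => ext F (t, u)) (iidLaw ρ) := fun F t =>
    Integrable.of_bound (((hext F).comp (by fun_prop)).aestronglyMeasurable) ‖F‖
      (ae_of_all _ fun u => hextb F _)
  have hint2 : ∀ F, Integrable (fun t => ∫ u, ext F (t, u) ∂iidLaw ρ) τ := fun F => by
    refine Integrable.of_bound (Continuous.aestronglyMeasurable ?_) ‖F‖ (ae_of_all _ fun t => ?_)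
    · exact continuous_of_dominated (bound := fun _ => ‖F‖)
        (fun t => ((hext F).comp (by fun_prop)).aestronglyMeasurable)
        (fun t => ae_of_all _ fun u => hextb F _) (integrable_const _)
        (ae_of_all _ fun u => (hext F).comp (by fun_prop))
    · have := norm_integral_le_of_norm_le_const (μ := iidLaw ρ) (f := fun u => ext F (t, u))
        (C := ‖F‖) (ae_of_all _ fun u => hextb F _)
      simpa using this
  refine tendsto_of_mem_closure_of_lipschitz
    (A := fun N F => (1 / (N : ℝ)) * ∑ k ∈ Finset.range N, ext F (x k, shift^[l k] u))
    (I := fun F => ∫ t, ∫ u, ext F (t, u) ∂iidLaw ρ ∂τ)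
    (D := {F | ∃ j K, F = trunc K (TopologicalSpace.denseSeq _ j)}) ?_ ?_ ?_ ?_
  · refine fun N => LipschitzWith.of_dist_le_mul fun F G => ?_
    rw [dist_eq_norm, ← mul_sub, ← Finset.sum_sub_distrib, NNReal.coe_one, one_mul]
    refine norm_average_le dist_nonneg (fun k => ?_) N
    rw [← dist_eq_norm]
    exact ContinuousMap.dist_apply_le_dist _
  · refine LipschitzWith.of_dist_le_mul fun F G => ?_
    rw [dist_eq_norm, ← integral_sub (hint2 F) (hint2 G), NNReal.coe_one, one_mul]
    refine (norm_integral_le_of_norm_le_const (C := dist F G) (ae_of_all _ fun t => ?_)).trans ?_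
    · rw [← integral_sub (hint F t) (hint G t)]
      refine (norm_integral_le_of_norm_le_const (C := dist F G) (ae_of_all _ fun v => ?_)).trans ?_
      · rw [← dist_eq_norm]
        exact ContinuousMap.dist_apply_le_dist _
      · simp
    · simp
  · rintro _ ⟨j, K, rfl⟩
    exact hu j K
  · rw [Metric.mem_closure_iff]
    intro ε hε
    obtain ⟨j, hj⟩ := (TopologicalSpace.denseRange_denseSeq C(Icc (0 : ℝ) 1 × (ℕ → S), ℝ)).exists_dist_lt
      F' (half_pos hε)
    obtain ⟨K, hK⟩ := exists_forall_dist_lt_of_cylinder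
      (TopologicalSpace.denseSeq C(Icc (0 : ℝ) 1 × (ℕ → S), ℝ) j) (half_pos hε)
    refine ⟨_, ⟨j, K, rfl⟩, ?_⟩
    have h1 : dist (TopologicalSpace.denseSeq C(Icc (0 : ℝ) 1 × (ℕ → S), ℝ) j)
        (trunc K (TopologicalSpace.denseSeq _ j)) ≤ ε / 2 := by
      rw [ContinuousMap.dist_le (half_pos hε).le]
      rintro ⟨t, v⟩
      exact (hK t v _ fun k hk => (splice_apply_of_lt hk _ _).symm).le
    linarith [dist_triangle F' (TopologicalSpace.denseSeq C(Icc (0 : ℝ) 1 × (ℕ → S), ℝ) j)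
      (trunc K (TopologicalSpace.denseSeq _ j))]

end SparseShifts

/-! ### The rotation of the eccentricities -/

/-- The number of digits in base `n` of the second coordinate that are revealed when a box of
eccentricity `t` is subdivided: `1` if the rotation wraps around at `t`, and `0` otherwise. -/
noncomputable def carry (m n : ℕ) (t : ℝ) : ℕ :=
  open Classical in if 1 - rotationAngle m n ≤ t then 1 else 0

/-- The number of times the rotation wraps around in its first `k` steps from `t`. -/
noncomputable def carries (m n : ℕ) (t : ℝ) : ℕ → ℕ
  | 0 => 0
  | k + 1 => carries m n t k + carry m n ((angleRotation m n)^[k] t)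

section Rotation

variable {m n : ℕ}

theorem measurable_angleRotation : Measurable (angleRotation m n) := by
  unfold angleRotation
  fun_prop

theorem measurable_carry : Measurable (carry m n) := by
  unfold carry
  exact Measurable.ite measurableSet_Ici measurable_const measurable_const

theorem carry_le_one (t : ℝ) : carry m n t ≤ 1 := by
  unfold carry
  split_ifs <;> omega

theorem carries_le (t : ℝ) (k : ℕ) : carries m n t k ≤ k := by
  induction k with
  | zero => simp [carries]
  | succ k ih =>
    have := carry_le_one (m := m) (n := n) ((angleRotation m n)^[k] t)
    simp only [carries]
    omega

theorem carries_mono (t : ℝ) : Monotone (carries m n t) :=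
  monotone_nat_of_le_succ fun k => by simp only [carries]; omega

theorem angleRotation_mem_Ico (t : ℝ) : angleRotation m n t ∈ Ico (0 : ℝ) 1 :=
  ⟨Int.fract_nonneg _, Int.fract_lt_one _⟩

theorem angleRotation_iterate_mem_Ico {t : ℝ} (ht : t ∈ Ico (0 : ℝ) 1) (k : ℕ) :
    (angleRotation m n)^[k] t ∈ Ico (0 : ℝ) 1 := by
  cases k with
  | zero => exact ht
  | succ k => rw [Function.iterate_succ_apply']; exact angleRotation_mem_Ico _

theorem angleRotation_iterate_zero (k : ℕ) :
    (angleRotation m n)^[k] 0 = Int.fract (k * rotationAngle m n) := by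
  induction k with
  | zero => simp
  | succ k ih =>
    rw [Function.iterate_succ_apply', ih, angleRotation, Int.fract_eq_fract]
    refine ⟨-⌊k * rotationAngle m n⌋, ?_⟩
    rw [Int.fract]
    push_cast
    ring

variable (hm : 2 ≤ m) (hmn : m < n)
include hm hmn

theorem rotationAngle_mem_Ioo : rotationAngle m n ∈ Ioo (0 : ℝ) 1 := by
  have h1 : (1 : ℝ) < m := by exact_mod_cast hm
  have h2 : (m : ℝ) < n := by exact_mod_cast hmn
  have hlm := Real.log_pos h1
  have hln := Real.log_lt_log (by linarith) h2
  exact ⟨div_pos hlm (hlm.trans hln), (div_lt_one (hlm.trans hln)).2 hln⟩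

theorem angleRotation_add_carry {t : ℝ} (ht : t ∈ Ico (0 : ℝ) 1) :
    angleRotation m n t + carry m n t = t + rotationAngle m n := by
  obtain ⟨h0, h1⟩ := rotationAngle_mem_Ioo hm hmn
  obtain ⟨ht0, ht1⟩ := ht
  unfold angleRotation carry
  split_ifs with h
  · have : Int.fract (t + rotationAngle m n) = t + rotationAngle m n - 1 := by
      rw [Int.fract_eq_iff]
      exact ⟨by linarith, by linarith, 1, by simp⟩
    rw [this]; simp
  · rw [Int.fract_eq_self.2 ⟨by linarith, by linarith⟩]; simp

theorem angleRotation_iterate_add_carries {t : ℝ} (ht : t ∈ Ico (0 : ℝ) 1) (k : ℕ) :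
    (angleRotation m n)^[k] t + carries m n t k = t + k * rotationAngle m n := by
  induction k with
  | zero => simp [carries]
  | succ k ih =>
    have h := angleRotation_add_carry hm hmn (angleRotation_iterate_mem_Ico (m := m) (n := n) ht k)
    rw [Function.iterate_succ_apply', carries]
    push_cast at h ⊢
    linarith

theorem tendsto_carries {t : ℝ} (ht : t ∈ Ico (0 : ℝ) 1) : Tendsto (carries m n t) atTop atTop := by
  have hα := rotationAngle_mem_Ioo hm hmn
  rw [← tendsto_natCast_atTop_iff (R := ℝ)]
  have h1 : Tendsto (fun k : ℕ => (k : ℝ) * rotationAngle m n - 1) atTop atTop :=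
    tendsto_atTop_add_const_right _ _ (tendsto_natCast_atTop_atTop.atTop_mul_const hα.1)
  refine tendsto_atTop_mono (fun k => ?_) h1
  have := angleRotation_iterate_add_carries hm hmn ht k
  have h2 := angleRotation_iterate_mem_Ico (m := m) (n := n) ht k
  linarith [ht.1, h2.2]

theorem tendsto_sub_carries : Tendsto (fun k => k - carries m n 0 k) atTop atTop := by
  have hα := rotationAngle_mem_Ioo hm hmn
  rw [← tendsto_natCast_atTop_iff (R := ℝ)]
  have h1 : Tendsto (fun k : ℕ => (k : ℝ) * (1 - rotationAngle m n)) atTop atTop :=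
    tendsto_natCast_atTop_atTop.atTop_mul_const (by linarith [hα.2])
  refine tendsto_atTop_mono (fun k => ?_) h1
  have := angleRotation_iterate_add_carries hm hmn (t := 0) (by simp) k
  have h2 := angleRotation_iterate_mem_Ico (m := m) (n := n) (t := 0) (by simp) k
  rw [Nat.cast_sub (carries_le 0 k)]
  linarith [h2.1]

theorem exists_carries_add_le {q : ℕ} (hq : 1 ≤ q) (K : ℕ) :
    ∃ L, ∀ k k', k + L ≤ k' → carries m n 0 (q * k) + K ≤ carries m n 0 (q * k') := by
  have hα := rotationAngle_mem_Ioo hm hmn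
  obtain ⟨L, hL⟩ := exists_nat_ge ((K + 1) / rotationAngle m n)
  refine ⟨L, fun k k' h => ?_⟩
  have h0 : (0 : ℝ) ∈ Ico (0 : ℝ) 1 := by simp
  have e1 := angleRotation_iterate_add_carries hm hmn h0 (q * k)
  have e2 := angleRotation_iterate_add_carries hm hmn h0 (q * k')
  have b1 := angleRotation_iterate_mem_Ico (m := m) (n := n) h0 (q * k)
  have b2 := angleRotation_iterate_mem_Ico (m := m) (n := n) h0 (q * k')
  rw [div_le_iff₀ hα.1] at hL
  have h3 : q * k + L ≤ q * k' := by nlinarith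
  have h4 : ((q * k : ℕ) : ℝ) * rotationAngle m n + L * rotationAngle m n ≤
      (q * k' : ℕ) * rotationAngle m n := by
    rw [← add_mul]
    exact mul_le_mul_of_nonneg_right (by exact_mod_cast h3) hα.1.le
  have h5 : (carries m n 0 (q * k) : ℝ) + K ≤ carries m n 0 (q * k') := by
    linarith [b1.1, b2.2]
  exact_mod_cast h5

end Rotation

theorem ergodic_angleRotation_of_irrational {m n : ℕ} (h : Irrational (rotationAngle m n)) :
    Ergodic (angleRotation m n) (volume.restrict (Ico (0 : ℝ) 1)) := by
  set α := rotationAngle m n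
  let e : UnitAddCircle → ℝ := fun x => (AddCircle.equivIco 1 0 x : ℝ)
  have he_mem : ∀ x, e x ∈ Ico (0 : ℝ) 1 := fun x => by
    have := (AddCircle.equivIco (1 : ℝ) 0 x).2
    simpa only [zero_add] using this
  have he_coe : ∀ x, ((e x : ℝ) : UnitAddCircle) = x := fun x => AddCircle.coe_equivIco
  have hinj : ∀ {s t : ℝ}, s ∈ Ico (0 : ℝ) 1 → t ∈ Ico (0 : ℝ) 1 →
      (s : UnitAddCircle) = t → s = t := fun hs ht hst =>
    (AddCircle.coe_eq_coe_iff_of_mem_Ico (p := (1 : ℝ)) (a := 0) (by simpa using hs)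
      (by simpa using ht)).1 hst
  have hem : Measurable e :=
    measurable_subtype_coe.comp (AddCircle.measurableEquivIco (1 : ℝ) 0).measurable
  have hmk := UnitAddCircle.measurePreserving_mk 0
  rw [zero_add, ← restrict_Ico_eq_restrict_Ioc] at hmk
  have hmp : MeasurePreserving e volume (volume.restrict (Ico (0 : ℝ) 1)) := by
    refine ⟨hem, ?_⟩
    rw [← hmk.map_eq, Measure.map_map hem hmk.measurable]
    conv_rhs => rw [← Measure.map_id (μ := volume.restrict (Ico (0 : ℝ) 1))]
    refine Measure.map_congr ?_
    filter_upwards [ae_restrict_mem measurableSet_Ico] with t ht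
    exact hinj (he_mem _) ht (he_coe _)
  have hrot : Ergodic (fun x : UnitAddCircle => (α : UnitAddCircle) + x) := by
    rw [AddCircle.ergodic_add_left, addOrderOf_eq_zero_iff,
      AddCircle.not_isOfFinAddOrder_iff_forall_rat_ne_div]
    intro q hq
    rw [div_one] at hq
    exact h ⟨q, hq⟩
  refine hmp.ergodic_of_ergodic_semiconj hrot measurable_angleRotation fun x => ?_
  refine hinj (he_mem _) (angleRotation_mem_Ico _) ?_
  have hfract : ∀ x : ℝ, ((Int.fract x : ℝ) : UnitAddCircle) = x := fun x => by
    rw [Int.fract, AddCircle.coe_sub, sub_eq_self, AddCircle.coe_eq_zero_iff]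
    exact ⟨⌊x⌋, by simp⟩
  rw [he_coe, angleRotation, hfract, AddCircle.coe_add, he_coe, add_comm]

theorem isProbabilityMeasure_uniform_dirac {q : ℕ} (hq : 0 < q) (x : ℕ → ℝ) : IsProbabilityMeasure
    ((q : ℝ≥0∞)⁻¹ • ∑ k ∈ Finset.range q, Measure.dirac (x k)) := by
  constructor
  rw [Measure.smul_apply, Measure.finsetSum_apply]
  simp only [measure_univ, Finset.sum_const, Finset.card_range, nsmul_eq_mul, mul_one, smul_eq_mul]
  exact ENNReal.inv_mul_cancel (by exact_mod_cast hq.ne') (ENNReal.natCast_ne_top q)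

section Periodic

variable {m n p q : ℕ} (hq : 0 < q) (h : rotationAngle m n = (p : ℝ) / q)
include hq h

theorem angleRotation_iterate_zero_add (k : ℕ) :
    (angleRotation m n)^[k + q] 0 = (angleRotation m n)^[k] 0 := by
  rw [angleRotation_iterate_zero, angleRotation_iterate_zero, Int.fract_eq_fract]
  refine ⟨p, ?_⟩
  have : (q : ℝ) ≠ 0 := by positivity
  rw [h]
  push_cast
  field_simp
  ring

theorem ergodic_angleRotation_periodicLaw : Ergodic (angleRotation m n) (periodicLaw m n q) := by
  have := isProbabilityMeasure_uniform_dirac hq fun k => (angleRotation m n)^[k] 0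
  refine ⟨⟨measurable_angleRotation, ?_⟩, ⟨fun s hs hinv => ?_⟩⟩
  · unfold periodicLaw
    rw [Measure.map_smul]
    congr 1
    ext s hs
    rw [Measure.map_apply measurable_angleRotation hs, Measure.finsetSum_apply,
      Measure.finsetSum_apply]
    simp only [Measure.dirac_apply' _ hs, Measure.dirac_apply' _ (measurable_angleRotation hs)]
    have hshift : ∀ k, (angleRotation m n ⁻¹' s).indicator (1 : ℝ → ℝ≥0∞)
        ((angleRotation m n)^[k] 0) =
        s.indicator (1 : ℝ → ℝ≥0∞) ((angleRotation m n)^[k + 1] 0) := fun k => by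
      rw [Function.iterate_succ_apply']; rfl
    simp only [hshift]
    obtain ⟨q', rfl⟩ : ∃ q', q = q' + 1 := ⟨q - 1, by omega⟩
    rw [Finset.sum_range_succ, Finset.sum_range_succ' _ q']
    have := angleRotation_iterate_zero_add hq h 0
    simp only [zero_add] at this
    rw [this]
  · have hk : ∀ k, (angleRotation m n)^[k] 0 ∈ s ↔ (0 : ℝ) ∈ s := by
      intro k
      induction k with
      | zero => rfl
      | succ k ih =>
        rw [Function.iterate_succ_apply', ← ih]
        conv_rhs => rw [← hinv]
        rfl
    have hval : ∀ s, MeasurableSet s → periodicLaw m n q s = (q : ℝ≥0∞)⁻¹ *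
        ∑ k ∈ Finset.range q, s.indicator 1 ((angleRotation m n)^[k] 0) := fun s hs => by
      rw [periodicLaw, Measure.smul_apply, Measure.finsetSum_apply]
      simp only [Measure.dirac_apply' _ hs, smul_eq_mul]
    rw [eventuallyConst_set']
    by_cases h0 : (0 : ℝ) ∈ s
    · right
      rw [ae_eq_univ, hval _ hs.compl]
      simp [hk, h0]
    · left
      rw [ae_eq_empty, hval _ hs]
      simp [hk, h0]

end Periodic

/-! ### The approximate-square partition operator -/

theorem Box.mem_interval {a b x : ℝ} {ca cb : Bool} :
    x ∈ Box.interval a b ca cb ↔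
      (a < x ∨ x = a ∧ ca = true) ∧ (x < b ∨ x = b ∧ cb = true) := by
  unfold Box.interval
  cases ca <;> cases cb <;> simp [le_iff_lt_or_eq, eq_comm]

theorem Box.interval_subset_Icc (a b : ℝ) (ca cb : Bool) : Box.interval a b ca cb ⊆ Icc a b := by
  intro x hx
  rw [Box.mem_interval] at hx
  exact ⟨hx.1.elim le_of_lt fun h => h.1.ge, hx.2.elim le_of_lt fun h => h.1.le⟩

theorem Box.Ioo_subset_interval (a b : ℝ) (ca cb : Bool) : Ioo a b ⊆ Box.interval a b ca cb :=
  fun _ hx => Box.mem_interval.2 ⟨.inl hx.1, .inl hx.2⟩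

/-- The interval number `i` in the subdivision of an interval into `a` pieces of length `h`. -/
def subinterval (l h : ℝ) (lc rc : Bool) (a i : ℕ) : Set ℝ :=
  Box.interval (l + i * h) (l + (i + 1) * h) (if i = 0 then lc else true)
    (if i + 1 = a then rc else false)

theorem disjoint_subinterval {l h : ℝ} (hh : 0 < h) {lc rc : Bool} {a i j : ℕ} (hj : j < a)
    (hij : i < j) : Disjoint (subinterval l h lc rc a i) (subinterval l h lc rc a j) := by
  rw [Set.disjoint_left]
  intro x hx hx'
  have h1 := (Box.mem_interval.1 hx).2
  rw [if_neg (by omega)] at h1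
  have h2 := (Box.interval_subset_Icc _ _ _ _ hx').1
  have h3 : ((i : ℝ) + 1) * h ≤ j * h := mul_le_mul_of_nonneg_right (by exact_mod_cast hij) hh.le
  rcases h1 with h1 | h1
  · linarith
  · simp at h1

theorem eq_of_mem_subinterval {l h : ℝ} (hh : 0 < h) {lc rc : Bool} {a i j : ℕ} (hi : i < a)
    (hj : j < a) {x : ℝ} (hx : x ∈ subinterval l h lc rc a i)
    (hx' : x ∈ subinterval l h lc rc a j) : i = j := by
  rcases lt_trichotomy i j with hij | hij | hij
  · exact absurd hx' (Set.disjoint_left.1 (disjoint_subinterval hh hj hij) hx)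
  · exact hij
  · exact absurd hx (Set.disjoint_left.1 (disjoint_subinterval hh hi hij) hx')

theorem mem_interval_iff_exists_subinterval {l h : ℝ} (hh : 0 < h) {lc rc : Bool} {a : ℕ}
    (ha : 0 < a) {x : ℝ} :
    x ∈ Box.interval l (l + a * h) lc rc ↔ ∃ i < a, x ∈ subinterval l h lc rc a i := by
  have ha' : (1 : ℝ) ≤ a := by exact_mod_cast ha
  constructor
  · intro hx
    have hI := Box.interval_subset_Icc _ _ _ _ hx
    rw [Box.mem_interval] at hx
    rcases eq_or_lt_of_le hI.2 with he | hlt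
    · refine ⟨a - 1, by omega, ?_⟩
      have hc : ((a - 1 : ℕ) : ℝ) = a - 1 := by rw [Nat.cast_sub ha]; simp
      rw [subinterval, Box.mem_interval, hc]
      refine ⟨.inl (by rw [he]; nlinarith), .inr ⟨by rw [he]; ring, ?_⟩⟩
      rcases hx.2 with h2 | h2
      · linarith
      · rw [if_pos (by omega)]; exact h2.2
    · have h0 : 0 ≤ (x - l) / h := div_nonneg (by linarith [hI.1]) hh.le
      have h1 := Nat.floor_le h0
      have h2 := Nat.lt_floor_add_one ((x - l) / h)
      rw [le_div_iff₀ hh] at h1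
      rw [div_lt_iff₀ hh] at h2
      have h3 : ⌊(x - l) / h⌋₊ < a := by
        rw [Nat.floor_lt h0, div_lt_iff₀ hh]
        linarith
      refine ⟨⌊(x - l) / h⌋₊, h3, ?_⟩
      rw [subinterval, Box.mem_interval]
      refine ⟨?_, .inl (by linarith)⟩
      rcases eq_or_lt_of_le h1 with he | hlt'
      · refine .inr ⟨by linarith, ?_⟩
        split_ifs with hz
        · rcases hx.1 with h4 | h4
          · rw [hz] at he; simp at he; linarith
          · exact h4.2
        · rfl
      · exact .inl (by linarith)
  · rintro ⟨i, hi, hx⟩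
    have hI := Box.interval_subset_Icc _ _ _ _ hx
    rw [subinterval, Box.mem_interval] at hx
    have hi' : ((i : ℝ) + 1) * h ≤ a * h := mul_le_mul_of_nonneg_right (by exact_mod_cast hi) hh.le
    have hi0 : 0 ≤ (i : ℝ) * h := by positivity
    rw [Box.mem_interval]
    constructor
    · rcases hx.1 with h1 | h1
      · exact .inl (by linarith)
      · rcases Nat.eq_zero_or_pos i with rfl | hpos
        · exact .inr ⟨by simpa using h1.1, by simpa using h1.2⟩
        · have : 0 < (i : ℝ) * h := by positivity
          exact .inl (by linarith [h1.1])
    · rcases hx.2 with h1 | h1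
      · exact .inl (by linarith)
      · have h3 := h1.2
        split_ifs at h3 with he
        refine .inr ⟨?_, h3⟩
        rw [h1.1, ← he]
        push_cast
        ring

namespace Box

theorem width_gridCell (B : Box) (a b i j : ℕ) : (B.gridCell a b i j).width = B.width / a := by
  simp only [width, gridCell]; ring

theorem height_gridCell (B : Box) (a b i j : ℕ) : (B.gridCell a b i j).height = B.height / b := by
  simp only [height, gridCell]; ring

theorem toSet_gridCell (B : Box) (a b i j : ℕ) : (B.gridCell a b i j).toSet =
    subinterval B.left (B.width / a) B.leftClosed B.rightClosed a i ×ˢ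
      subinterval B.bottom (B.height / b) B.bottomClosed B.topClosed b j := by
  simp only [toSet, gridCell, subinterval]

theorem mem_toSet_iff_exists_gridCell {B : Box} (hw : 0 < B.width) (hh : 0 < B.height) {a b : ℕ}
    (ha : 0 < a) (hb : 0 < b) {z : ℝ × ℝ} :
    z ∈ B.toSet ↔ ∃ i < a, ∃ j < b, z ∈ (B.gridCell a b i j).toSet := by
  have ha' : (0 : ℝ) < a := by exact_mod_cast ha
  have hb' : (0 : ℝ) < b := by exact_mod_cast hb
  have h1 := mem_interval_iff_exists_subinterval (l := B.left) (lc := B.leftClosed)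
    (rc := B.rightClosed) (x := z.1) (div_pos hw ha') ha
  have h2 := mem_interval_iff_exists_subinterval (l := B.bottom) (lc := B.bottomClosed)
    (rc := B.topClosed) (x := z.2) (div_pos hh hb') hb
  rw [mul_div_cancel₀ _ ha'.ne'] at h1
  rw [mul_div_cancel₀ _ hb'.ne'] at h2
  have e1 : B.left + B.width = B.right := by simp [width]
  have e2 : B.bottom + B.height = B.top := by simp [height]
  rw [e1] at h1
  rw [e2] at h2
  simp only [toSet_gridCell]
  rw [toSet, Set.mem_prod, h1, h2]
  constructor
  · rintro ⟨⟨i, hi, hi'⟩, j, hj, hj'⟩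
    exact ⟨i, hi, j, hj, hi', hj'⟩
  · rintro ⟨i, hi, j, hj, hi', hj'⟩
    exact ⟨⟨i, hi, hi'⟩, j, hj, hj'⟩

theorem eq_of_mem_gridCell {B : Box} (hw : 0 < B.width) (hh : 0 < B.height) {a b i j i' j' : ℕ}
    (hi : i < a) (hj : j < b) (hi' : i' < a) (hj' : j' < b) {z : ℝ × ℝ}
    (h : z ∈ (B.gridCell a b i j).toSet) (h' : z ∈ (B.gridCell a b i' j').toSet) :
    i = i' ∧ j = j' := by
  rw [toSet_gridCell] at h h'
  have ha' : (0 : ℝ) < a := by exact_mod_cast (by omega : 0 < a)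
  have hb' : (0 : ℝ) < b := by exact_mod_cast (by omega : 0 < b)
  exact ⟨eq_of_mem_subinterval (div_pos hw ha') hi hi' h.1 h'.1,
    eq_of_mem_subinterval (div_pos hh hb') hj hj' h.2 h'.2⟩

theorem toSet_nonempty {B : Box} (hw : 0 < B.width) (hh : 0 < B.height) : B.toSet.Nonempty := by
  obtain ⟨x, hx⟩ := exists_between (sub_pos.1 hw)
  obtain ⟨y, hy⟩ := exists_between (sub_pos.1 hh)
  exact ⟨(x, y), Ioo_subset_interval _ _ _ _ hx, Ioo_subset_interval _ _ _ _ hy⟩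

theorem width_homothety (r : ℝ) (v : ℝ × ℝ) (B : Box) :
    (B.homothety r v).width = r * B.width := by
  simp only [width, homothety]; ring

theorem height_homothety (r : ℝ) (v : ℝ × ℝ) (B : Box) :
    (B.homothety r v).height = r * B.height := by
  simp only [height, homothety]; ring

theorem eccentricity_homothety (n : ℕ) {r : ℝ} (hr : 0 < r) (v : ℝ × ℝ) (B : Box) :
    (B.homothety r v).eccentricity n = B.eccentricity n := by
  rw [eccentricity, width_homothety, height_homothety, mul_div_mul_left _ _ hr.ne', eccentricity]

theorem gridCell_homothety (r : ℝ) (v : ℝ × ℝ) (B : Box) (a b i j : ℕ) :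
    (B.homothety r v).gridCell a b i j = (B.gridCell a b i j).homothety r v := by
  have h1 := width_homothety r v B
  have h2 := height_homothety r v B
  simp only [gridCell, h1, h2]
  simp only [homothety, mk.injEq, and_true]
  refine ⟨?_, ?_, ?_, ?_⟩ <;> ring

theorem measurableSet_interval (a b : ℝ) (ca cb : Bool) : MeasurableSet (interval a b ca cb) := by
  unfold interval
  refine MeasurableSet.inter ?_ ?_
  · cases ca
    · exact measurableSet_Ioi
    · exact measurableSet_Ici
  · cases cb
    · exact measurableSet_Iio
    · exact measurableSet_Iic

theorem measurableSet_toSet (B : Box) : MeasurableSet B.toSet :=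
  (measurableSet_interval _ _ _ _).prod (measurableSet_interval _ _ _ _)

end Box

/-- The number of rows into which the operator cuts the box `B`. -/
noncomputable def rowCount (m n : ℕ) (B : Box) : ℕ :=
  open Classical in if 1 - rotationAngle m n ≤ B.eccentricity n then n else 1

theorem approxSquareOperator_eq (m n : ℕ) (B : Box) : approxSquareOperator m n B =
    {A | ∃ i < m, ∃ j < rowCount m n B, A = B.gridCell m (rowCount m n B) i j} := by
  unfold approxSquareOperator rowCount
  split_ifs with h
  · rfl
  · simp

section Partition

variable {m n : ℕ} (hm : 2 ≤ m) (hmn : m < n)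
include hm hmn

theorem rowCount_pos (B : Box) : 0 < rowCount m n B := by
  unfold rowCount
  split_ifs <;> omega

theorem eccentricity_gridCell {B : Box} (hB : B ∈ approxSquares n) (i j : ℕ) :
    (B.gridCell m (rowCount m n B) i j).eccentricity n =
      angleRotation m n (B.eccentricity n) := by
  obtain ⟨hw, hh, ht⟩ := hB
  have hrot := angleRotation_add_carry hm hmn ht
  have hm0 : (0 : ℝ) < m := by exact_mod_cast (by omega : 0 < m)
  have hn1 : (1 : ℝ) < n := by exact_mod_cast (by omega : 1 < n)
  have hr0 : (0 : ℝ) < rowCount m n B := by exact_mod_cast rowCount_pos hm hmn B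
  have hlog : Real.logb n (rowCount m n B) = carry m n (B.eccentricity n) := by
    unfold rowCount carry
    split_ifs
    · simp [Real.logb_self_eq_one hn1]
    · simp
  have : B.height / rowCount m n B / (B.width / m) =
      B.height / B.width * m / rowCount m n B := by
    field_simp
  rw [Box.eccentricity, Box.width_gridCell, Box.height_gridCell, this,
    Real.logb_div (by positivity) hr0.ne', Real.logb_mul (by positivity) hm0.ne', hlog,
    ← Box.eccentricity]
  have : Real.logb n m = rotationAngle m n := rfl
  rw [this]
  linarith

theorem gridCell_mem_approxSquares {B : Box} (hB : B ∈ approxSquares n) (i j : ℕ) :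
    B.gridCell m (rowCount m n B) i j ∈ approxSquares n := by
  have hm0 : (0 : ℝ) < m := by exact_mod_cast (by omega : 0 < m)
  have hr0 : (0 : ℝ) < rowCount m n B := by exact_mod_cast rowCount_pos hm hmn B
  refine ⟨?_, ?_, ?_⟩
  · rw [Box.width_gridCell]; exact div_pos hB.1 hm0
  · rw [Box.height_gridCell]; exact div_pos hB.2.1 hr0
  · rw [eccentricity_gridCell hm hmn hB]; exact angleRotation_mem_Ico _

theorem isPartitionOperator_approxSquareOperator :
    IsPartitionOperator (approxSquares n) (approxSquareOperator m n) where
  subset B hB := by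
    rw [approxSquareOperator_eq]
    rintro _ ⟨i, -, j, -, rfl⟩
    exact gridCell_mem_approxSquares hm hmn hB i j
  nonempty B hB := by
    rw [approxSquareOperator_eq]
    rintro _ ⟨i, -, j, -, rfl⟩
    have := gridCell_mem_approxSquares hm hmn hB i j
    exact Box.toSet_nonempty this.1 this.2.1
  pairwiseDisjoint B hB := by
    rw [approxSquareOperator_eq]
    rintro _ ⟨i, hi, j, hj, rfl⟩ _ ⟨i', hi', j', hj', rfl⟩ hne
    rw [Function.onFun, Set.disjoint_left]
    intro z hz hz'
    obtain ⟨rfl, rfl⟩ := Box.eq_of_mem_gridCell hB.1 hB.2.1 hi hj hi' hj' hz hz'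
    exact hne rfl
  iUnion_eq B hB := by
    ext z
    rw [Box.mem_toSet_iff_exists_gridCell hB.1 hB.2.1 (by omega : 0 < m) (rowCount_pos hm hmn B),
      approxSquareOperator_eq]
    simp only [mem_iUnion, mem_ofPred_eq, exists_prop]
    constructor
    · rintro ⟨_, ⟨i, hi, j, hj, rfl⟩, hz⟩
      exact ⟨i, hi, j, hj, hz⟩
    · rintro ⟨i, hi, j, hj, hz⟩
      exact ⟨_, ⟨i, hi, j, hj, rfl⟩, hz⟩
  homothety B _ r hr v _ := by
    have hrow : rowCount m n (B.homothety r v) = rowCount m n B := by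
      unfold rowCount
      rw [Box.eccentricity_homothety n hr]
    rw [approxSquareOperator_eq, approxSquareOperator_eq, hrow]
    ext A
    simp only [mem_ofPred_eq, mem_image]
    constructor
    · rintro ⟨i, hi, j, hj, rfl⟩
      exact ⟨_, ⟨i, hi, j, hj, rfl⟩, (Box.gridCell_homothety r v B _ _ _ _).symm⟩
    · rintro ⟨_, ⟨i, hi, j, hj, rfl⟩, rfl⟩
      exact ⟨i, hi, j, hj, (Box.gridCell_homothety r v B _ _ _ _).symm⟩

theorem mem_iterPartition_width {B : Box} (hB : B ∈ approxSquares n) (k : ℕ) :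
    ∀ A ∈ iterPartition (approxSquareOperator m n) B k,
      A ∈ approxSquares n ∧ A.width = B.width / m ^ k := by
  induction k with
  | zero =>
    rintro A rfl
    exact ⟨hB, by simp⟩
  | succ k ih =>
    intro A hA
    obtain ⟨C, hC, hAC⟩ := mem_iUnion₂.1 hA
    obtain ⟨hCE, hCw⟩ := ih C hC
    refine ⟨(isPartitionOperator_approxSquareOperator hm hmn).subset C hCE hAC, ?_⟩
    rw [approxSquareOperator_eq] at hAC
    obtain ⟨i, -, j, -, rfl⟩ := hAC
    rw [Box.width_gridCell, hCw, pow_succ, div_div]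

theorem isRegularOperator_approxSquareOperator :
    IsRegularOperator (1 / (m : ℝ)) (approxSquares n) (approxSquareOperator m n) := by
  intro B hB
  have hm0 : (0 : ℝ) < m := by exact_mod_cast (by omega : 0 < m)
  have hn1 : (1 : ℝ) < n := by exact_mod_cast (by omega : 1 < n)
  have hW := hB.1
  set c : ℝ := 2 + 2 / B.width + 2 * (1 + n) * B.width with hc
  have hc0 : 0 < c := by positivity
  refine ⟨c, ?_, fun k A hA => ?_⟩
  · have h1 : 0 < 2 / B.width := by positivity
    have h2 : 0 < 2 * (1 + n) * B.width := by positivity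
    linarith
  obtain ⟨⟨hw, hh, he⟩, hAw⟩ := mem_iterPartition_width hm hmn hB k A hA
  set d : ℝ := (1 / (m : ℝ)) ^ k with hd
  have hd0 : 0 < d := by positivity
  have hAw' : A.width = B.width * d := by rw [hAw, hd, one_div, inv_pow]; rfl
  -- The eccentricity lies in `[0, 1)`, so the height is between `width` and `n * width`.
  have hratio : 1 ≤ A.height / A.width ∧ A.height / A.width < n := by
    have hpos : 0 < A.height / A.width := div_pos hh hw
    constructor
    · rw [← Real.logb_nonneg_iff hn1 hpos]; exact he.1
    · have := (Real.logb_lt_iff_lt_rpow hn1 hpos).1 he.2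
      simpa using this
  rw [le_div_iff₀ hw, div_lt_iff₀ hw, one_mul] at hratio
  set w : ℝ × ℝ := (A.left + A.width / 2, A.bottom + A.height / 2) with hwdef
  have hright : A.right = A.left + A.width := by simp [Box.width]
  have htop : A.top = A.bottom + A.height := by simp [Box.height]
  constructor
  · refine ⟨w, fun z hz => ?_⟩
    simp only [euclDisc, mem_ofPred_eq] at hz
    have hr : d / c ≤ A.width / 2 := by
      rw [div_le_iff₀ hc0, hAw']
      have : 2 / B.width ≤ c := by
        have h2 : 0 < 2 * (1 + n) * B.width := by positivity
        linarith
      have h3 : B.width * (2 / B.width) = 2 := by field_simp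
      nlinarith [mul_le_mul_of_nonneg_left this (mul_pos hW hd0).le]
    have h1 : |z.1 - w.1| < A.width / 2 :=
      (Real.abs_le_sqrt (by nlinarith [sq_nonneg (z.2 - w.2)])).trans_lt (hz.trans_le hr)
    have h2 : |z.2 - w.2| < A.width / 2 :=
      (Real.abs_le_sqrt (by nlinarith [sq_nonneg (z.1 - w.1)])).trans_lt (hz.trans_le hr)
    rw [abs_lt] at h1 h2
    simp only [hwdef] at h1 h2
    exact ⟨Box.Ioo_subset_interval _ _ _ _ ⟨by linarith, by linarith⟩,
      Box.Ioo_subset_interval _ _ _ _ ⟨by linarith, by linarith⟩⟩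
  · refine ⟨w, fun z hz => ?_⟩
    obtain ⟨h1, h2⟩ := hz
    replace h1 := Box.interval_subset_Icc _ _ _ _ h1
    replace h2 := Box.interval_subset_Icc _ _ _ _ h2
    simp only [euclDisc, mem_ofPred_eq]
    have ha1 : |z.1 - w.1| ≤ A.width / 2 := by
      rw [abs_le]; simp only [hwdef]; constructor <;> linarith [h1.1, h1.2]
    have ha2 : |z.2 - w.2| ≤ A.height / 2 := by
      rw [abs_le]; simp only [hwdef]; constructor <;> linarith [h2.1, h2.2]
    have hlt : A.width + A.height < c * d := by
      have h3 : A.width + A.height < (1 + n) * B.width * d := by rw [mul_assoc, ← hAw']; linarith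
      have h4 : (1 + n) * B.width ≤ c := by
        have h5 : 0 < 2 / B.width := by positivity
        have h6 : 0 < (1 + n) * B.width := by positivity
        linarith
      exact h3.trans_le (mul_le_mul_of_nonneg_right h4 hd0.le)
    refine lt_of_le_of_lt ?_ hlt
    refine Real.sqrt_le_iff.2 ⟨by linarith, ?_⟩
    have := sq_le_sq' (abs_le.1 ha1).1 (abs_le.1 ha1).2
    have := sq_le_sq' (abs_le.1 ha2).1 (abs_le.1 ha2).2
    nlinarith [mul_pos hw hh]

end Partition

/-- Distinct cells of an iterated partition are disjoint. -/
theorem IsPartitionOperator.eq_of_mem_iterPartition {E : Set Box} {Δ : Box → Set Box}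
    (h : IsPartitionOperator E Δ) {B : Box} (hB : B ∈ E) (k : ℕ) :
    (∀ A ∈ iterPartition Δ B k, A ∈ E) ∧ ∀ A ∈ iterPartition Δ B k, ∀ A' ∈ iterPartition Δ B k,
      ∀ z ∈ A.toSet, z ∈ A'.toSet → A = A' := by
  induction k with
  | zero =>
    refine ⟨by rintro A rfl; exact hB, ?_⟩
    rintro A rfl A' rfl z _ _
    rfl
  | succ k ih =>
    obtain ⟨hE, hu⟩ := ih
    refine ⟨fun A hA => ?_, fun A hA A' hA' z hz hz' => ?_⟩
    · obtain ⟨C, hC, hAC⟩ := mem_iUnion₂.1 hA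
      exact h.subset C (hE C hC) hAC
    · obtain ⟨C, hC, hAC⟩ := mem_iUnion₂.1 hA
      obtain ⟨C', hC', hAC'⟩ := mem_iUnion₂.1 hA'
      have hzC : z ∈ C.toSet := by
        rw [← h.iUnion_eq C (hE C hC)]; exact mem_iUnion₂.2 ⟨A, hAC, hz⟩
      have hzC' : z ∈ C'.toSet := by
        rw [← h.iUnion_eq C' (hE C' hC')]; exact mem_iUnion₂.2 ⟨A', hAC', hz'⟩
      obtain rfl := hu C hC C' hC' z hzC hzC'
      by_contra hne
      exact Set.disjoint_left.1 (h.pairwiseDisjoint C (hE C hC) hAC hAC' hne) hz hz'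

theorem IsPartitionOperator.cellAt_eq {E : Set Box} {Δ : Box → Set Box}
    (h : IsPartitionOperator E Δ) {B : Box} (hB : B ∈ E) {k : ℕ} {A : Box}
    (hA : A ∈ iterPartition Δ B k) {z : ℝ × ℝ} (hz : z ∈ A.toSet) : cellAt Δ B k z = A := by
  have hex : ∃ A ∈ iterPartition Δ B k, z ∈ A.toSet := ⟨A, hA, hz⟩
  rw [cellAt, dif_pos hex]
  exact (h.eq_of_mem_iterPartition hB k).2 _ hex.choose_spec.1 _ hA z hex.choose_spec.2 hz

/-! ### Digit cells -/

/-- A sequence of digits is admissible if it is not eventually equal to the last digit or, provided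
the right end point is included (`f = true`), if it is constantly equal to the last digit. Among
admissible sequences the half-open cells of the Markov partition determine the digits. -/
def Admissible {b : ℕ} (f : Bool) (X : ℕ → Fin b) : Prop :=
  (∀ k, ∃ s ≥ k, (X s : ℕ) + 1 ≠ b) ∨ f = true ∧ ∀ k, (X k : ℕ) + 1 = b

theorem Admissible.of_true {b : ℕ} {f : Bool} {X : ℕ → Fin b} (h : Admissible f X) :
    Admissible true X := h.imp id fun h => ⟨rfl, h.2⟩

/-- The value of the first `k` digits. -/
noncomputable def prefixValue {b : ℕ} (X : ℕ → Fin b) (k : ℕ) : ℝ :=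
  ∑ i ∈ Finset.range k, Real.ofDigitsTerm X i

theorem ofDigits_eq_prefixValue_add {b : ℕ} (X : ℕ → Fin b) (k : ℕ) :
    Real.ofDigits X = prefixValue X k + ((b : ℝ) ^ k)⁻¹ * Real.ofDigits (shift^[k] X) := by
  rw [Real.ofDigits_eq_sum_add_ofDigits X k, prefixValue]
  congr 3
  ext i
  rw [shift_iterate_apply]

theorem prefixValue_succ {b : ℕ} (X : ℕ → Fin b) (k : ℕ) :
    prefixValue X (k + 1) = prefixValue X k + X k * ((b : ℝ) ^ (k + 1))⁻¹ :=
  Finset.sum_range_succ _ _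

theorem prefixValue_congr {b : ℕ} {X X' : ℕ → Fin b} {k : ℕ} (h : ∀ s < k, X s = X' s) :
    prefixValue X k = prefixValue X' k :=
  Finset.sum_congr rfl fun s hs => by
    simp only [Real.ofDigitsTerm, h s (Finset.mem_range.1 hs)]

theorem ofDigits_lt_one {b : ℕ} (hb : 1 < b) {X : ℕ → Fin b} (h : ∃ s, (X s : ℕ) + 1 ≠ b) :
    Real.ofDigits X < 1 := by
  obtain ⟨s, hs⟩ := h
  have : NeZero b := ⟨by omega⟩
  rw [← Real.ofDigits_const_last_eq_one' hb]
  refine Summable.tsum_lt_tsum (i := s) (fun i => ?_) ?_ Real.summable_ofDigitsTerm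
    Real.summable_ofDigitsTerm
  · simp only [Real.ofDigitsTerm]
    have h1 : (X i : ℕ) ≤ b - 1 := by have := (X i).2; omega
    gcongr
  · simp only [Real.ofDigitsTerm]
    have h1 : (X s : ℕ) < b - 1 := by have := (X s).2; omega
    gcongr

/-- The interval of the points of `[l, l + w]` whose first `k` digits are those of `a`; `rc` says
whether the right end point of the large interval is included. -/
noncomputable def digitInterval {b : ℕ} (l w : ℝ) (rc : Bool) (a : ℕ → Fin b) (k : ℕ) : Set ℝ :=
  Box.interval (l + w * prefixValue a k) (l + w * prefixValue a k + w / b ^ k) true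
    (rc && decide (∀ s < k, (a s : ℕ) + 1 = b))

theorem digitInterval_succ {b : ℕ} (hb : 1 < b) {l w : ℝ} {rc : Bool} (a : ℕ → Fin b) (k : ℕ) :
    digitInterval l w rc a (k + 1) =
      subinterval (l + w * prefixValue a k) (w / b ^ k / b) true
        (rc && decide (∀ s < k, (a s : ℕ) + 1 = b)) b (a k) := by
  have hb0 : (b : ℝ) ≠ 0 := by exact_mod_cast (by omega : b ≠ 0)
  unfold digitInterval subinterval
  congr 1
  · rw [prefixValue_succ]; field_simp; ring
  · rw [prefixValue_succ]; field_simp; ring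
  · simp
  · rw [Bool.eq_iff_iff]
    have : (∀ s < k + 1, (a s : ℕ) + 1 = b) ↔ (∀ s < k, (a s : ℕ) + 1 = b) ∧ (a k : ℕ) + 1 = b :=
      Nat.forall_lt_succ_right
    simp only [this]
    by_cases h : (a k : ℕ) + 1 = b <;> simp [h]

section Digits

variable {b : ℕ} (hb : 1 < b) {l w : ℝ} (hw : 0 < w) {rc : Bool}
include hb hw

theorem mem_digitInterval_self {X : ℕ → Fin b} (hX : Admissible rc X) (k : ℕ) :
    l + w * Real.ofDigits X ∈ digitInterval l w rc X k := by
  have hb0 : (0 : ℝ) < b := by exact_mod_cast (by omega : 0 < b)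
  have h0 := Real.ofDigits_nonneg (shift^[k] X)
  have h1 := Real.ofDigits_le_one (shift^[k] X)
  have hpos : 0 < w * ((b : ℝ) ^ k)⁻¹ := by positivity
  have heq : l + w * Real.ofDigits X =
      l + w * prefixValue X k + w * ((b : ℝ) ^ k)⁻¹ * Real.ofDigits (shift^[k] X) := by
    rw [ofDigits_eq_prefixValue_add X k]; ring
  rw [digitInterval, Box.mem_interval, heq, div_eq_mul_inv]
  refine ⟨?_, ?_⟩
  · rcases eq_or_lt_of_le (mul_nonneg hpos.le h0) with h | h
    · exact .inr ⟨by rw [← h]; ring, rfl⟩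
    · exact .inl (by linarith)
  · rcases hX with hX | ⟨hrc, hX⟩
    · left
      obtain ⟨s, hs, hne⟩ := hX k
      have : Real.ofDigits (shift^[k] X) < 1 := ofDigits_lt_one hb ⟨s - k, by
        rw [shift_iterate_apply, Nat.sub_add_cancel hs]; exact hne⟩
      nlinarith
    · rcases eq_or_lt_of_le h1 with h | h
      · exact .inr ⟨by rw [h]; ring, by simp [hrc, hX]⟩
      · exact .inl (by nlinarith)

/-- The digits of an admissible sequence can be read off from the digit intervals. -/
theorem mem_digitInterval_iff {X : ℕ → Fin b} (hX : Admissible rc X) (a : ℕ → Fin b) (k : ℕ) :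
    l + w * Real.ofDigits X ∈ digitInterval l w rc a k ↔ ∀ s < k, X s = a s := by
  have hb0 : (0 : ℝ) < b := by exact_mod_cast (by omega : 0 < b)
  constructor
  · induction k with
    | zero => simp
    | succ k ih =>
      intro h
      rw [digitInterval_succ hb] at h
      have hpos : 0 < w / (b : ℝ) ^ k / b := by positivity
      have hk : ∀ s < k, X s = a s := by
        refine ih ?_
        have := (mem_interval_iff_exists_subinterval hpos (by omega : 0 < b)).2 ⟨_, (a k).2, h⟩
        rwa [mul_div_cancel₀ _ hb0.ne'] at this
      have hself := mem_digitInterval_self hb hw hX (k + 1) (l := l)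
      rw [digitInterval_succ hb] at hself
      have hflag : (∀ s < k, (X s : ℕ) + 1 = b) ↔ ∀ s < k, (a s : ℕ) + 1 = b :=
        forall₂_congr fun s hs => by rw [hk s hs]
      simp only [prefixValue_congr hk, hflag] at hself
      exact Nat.forall_lt_succ_right.2
        ⟨hk, Fin.ext (eq_of_mem_subinterval hpos (X k).2 (a k).2 hself h)⟩
  · intro h
    have hself := mem_digitInterval_self hb hw hX k (l := l)
    have hflag : (∀ s < k, (X s : ℕ) + 1 = b) ↔ ∀ s < k, (a s : ℕ) + 1 = b :=
      forall₂_congr fun s hs => by rw [h s hs]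
    unfold digitInterval at hself ⊢
    simpa only [prefixValue_congr h, hflag] using hself

end Digits

theorem injOn_ofDigits {b : ℕ} (hb : 1 < b) {f : Bool} :
    InjOn (Real.ofDigits : (ℕ → Fin b) → ℝ) {X | Admissible f X} := by
  intro X hX X' hX' h
  ext k : 1
  have h1 := mem_digitInterval_self hb one_pos hX' (l := 0) (k + 1)
  simp only [← h] at h1
  exact (mem_digitInterval_iff hb one_pos hX X' (k + 1)).1 h1 k (by omega)

theorem measurableSet_admissible {b : ℕ} (f : Bool) :
    MeasurableSet {X : ℕ → Fin b | Admissible f X} := by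
  have h1 : ∀ s, MeasurableSet {X : ℕ → Fin b | (X s : ℕ) + 1 = b} := fun s =>
    measurableSet_eq_fun ((measurable_of_countable fun i : Fin b => (i : ℕ) + 1).comp
      (measurable_pi_apply (X := fun _ : ℕ => Fin b) s)) measurable_const
  have h2 : {X : ℕ → Fin b | Admissible f X} =
      (⋂ k, ⋃ s, ⋃ (_ : s ≥ k), {X : ℕ → Fin b | (X s : ℕ) + 1 = b}ᶜ) ∪
        {_X | f = true} ∩ ⋂ k, {X : ℕ → Fin b | (X k : ℕ) + 1 = b} := by
    ext X
    simp [Admissible]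
  rw [h2]
  exact (MeasurableSet.iInter fun k => MeasurableSet.iUnion fun s => MeasurableSet.iUnion fun _ =>
    (h1 s).compl).union ((MeasurableSet.const _).inter (MeasurableSet.iInter h1))

theorem measurableSet_prefix {S : Type*} [MeasurableSpace S] [MeasurableSingletonClass S]
    (a : ℕ → S) (k : ℕ) : MeasurableSet {x : ℕ → S | ∀ s < k, x s = a s} := by
  have : {x : ℕ → S | ∀ s < k, x s = a s} =
      ⋂ s, ⋂ (_ : s < k), (fun x : ℕ → S => x s) ⁻¹' {a s} := by
    ext; simp
  rw [this]
  exact MeasurableSet.iInter fun s => MeasurableSet.iInter fun _ =>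
    measurable_pi_apply s (measurableSet_singleton _)

theorem measurable_ofDigits {b : ℕ} : Measurable (Real.ofDigits : (ℕ → Fin b) → ℝ) :=
  Real.continuous_ofDigits.measurable

namespace Box

theorem coe_blowUp {B : Box} {μ : ProbabilityMeasure (ℝ × ℝ)}
    (h : (μ : Measure (ℝ × ℝ)) B.toSet ≠ 0) :
    ((B.blowUp μ : ProbabilityMeasure (ℝ × ℝ)) : Measure (ℝ × ℝ)) =
      ((μ : Measure (ℝ × ℝ))[|B.toSet]).map B.rescale := by
  have := cond_isProbabilityMeasure h
  have h1 : B.blowUp μ = ⟨((μ : Measure (ℝ × ℝ))[|B.toSet]).map B.rescale,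
      Measure.isProbabilityMeasure_map B.measurable_rescale.aemeasurable⟩ := dif_pos h
  rw [h1]
  rfl

/-- The cell of the points of `B` whose first `k` digits horizontally are those of `a` and whose
first `l` digits vertically are those of `c`. -/
noncomputable def digitCell {m n : ℕ} (B : Box) (a : ℕ → Fin m) (c : ℕ → Fin n) (k l : ℕ) : Box where
  left := B.left + B.width * prefixValue a k
  right := B.left + B.width * prefixValue a k + B.width / m ^ k
  bottom := B.bottom + B.height * prefixValue c l
  top := B.bottom + B.height * prefixValue c l + B.height / n ^ l
  leftClosed := true
  rightClosed := B.rightClosed && decide (∀ s < k, (a s : ℕ) + 1 = m)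
  bottomClosed := true
  topClosed := B.topClosed && decide (∀ s < l, (c s : ℕ) + 1 = n)

/-- The point of `B` with the given digits. -/
noncomputable def digitPoint {m n : ℕ} (B : Box) (z : (ℕ → Fin m) × (ℕ → Fin n)) : ℝ × ℝ :=
  (B.left + B.width * Real.ofDigits z.1, B.bottom + B.height * Real.ofDigits z.2)

variable {m n : ℕ}

theorem measurable_digitPoint (B : Box) : Measurable (B.digitPoint (m := m) (n := n)) :=
  (((measurable_ofDigits.comp measurable_fst).const_mul _).const_add _).prodMk
    (((measurable_ofDigits.comp measurable_snd).const_mul _).const_add _)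

theorem width_digitCell (B : Box) (a : ℕ → Fin m) (c : ℕ → Fin n) (k l : ℕ) :
    (B.digitCell a c k l).width = B.width / m ^ k := by
  simp [width, digitCell]

theorem height_digitCell (B : Box) (a : ℕ → Fin m) (c : ℕ → Fin n) (k l : ℕ) :
    (B.digitCell a c k l).height = B.height / n ^ l := by
  simp [height, digitCell]

theorem digitCell_zero {B : Box} (hl : B.leftClosed = true) (hb : B.bottomClosed = true)
    (a : ℕ → Fin m) (c : ℕ → Fin n) : B.digitCell a c 0 0 = B := by
  obtain ⟨l, r, b, t, lc, rc, bc, tc⟩ := B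
  simp only at hl hb
  subst hl hb
  simp [digitCell, prefixValue, width, height]

theorem toSet_digitCell (B : Box) (a : ℕ → Fin m) (c : ℕ → Fin n) (k l : ℕ) :
    (B.digitCell a c k l).toSet = digitInterval B.left B.width B.rightClosed a k ×ˢ
      digitInterval B.bottom B.height B.topClosed c l := rfl

theorem digitPoint_mem_digitCell_iff (hm : 1 < m) (hn : 1 < n) {B : Box} (hw : 0 < B.width)
    (hh : 0 < B.height) {z : (ℕ → Fin m) × (ℕ → Fin n)} (h1 : Admissible B.rightClosed z.1)
    (h2 : Admissible B.topClosed z.2) (a : ℕ → Fin m) (c : ℕ → Fin n) (k l : ℕ) :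
    B.digitPoint z ∈ (B.digitCell a c k l).toSet ↔
      (∀ s < k, z.1 s = a s) ∧ ∀ s < l, z.2 s = c s := by
  rw [toSet_digitCell, digitPoint, Set.mem_prod, mem_digitInterval_iff hm hw h1,
    mem_digitInterval_iff hn hh h2]

theorem digitCell_succ_succ (hm : 0 < m) (hn : 0 < n) (B : Box) (a : ℕ → Fin m) (c : ℕ → Fin n)
    (k l : ℕ) : B.digitCell a c (k + 1) (l + 1) = (B.digitCell a c k l).gridCell m n (a k) (c l) := by
  have hm0 : (m : ℝ) ≠ 0 := by exact_mod_cast hm.ne'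
  have hn0 : (n : ℝ) ≠ 0 := by exact_mod_cast hn.ne'
  have h1 : (∀ s < k + 1, (a s : ℕ) + 1 = m) ↔ (∀ s < k, (a s : ℕ) + 1 = m) ∧ (a k : ℕ) + 1 = m :=
    Nat.forall_lt_succ_right
  have h2 : (∀ s < l + 1, (c s : ℕ) + 1 = n) ↔ (∀ s < l, (c s : ℕ) + 1 = n) ∧ (c l : ℕ) + 1 = n :=
    Nat.forall_lt_succ_right
  simp only [gridCell, width_digitCell, height_digitCell]
  simp only [digitCell, mk.injEq, prefixValue_succ, h1, h2]
  refine ⟨by field_simp; ring, by field_simp; ring, by field_simp; ring, by field_simp; ring,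
    by simp, ?_, by simp, ?_⟩
  · by_cases h : (a k : ℕ) + 1 = m <;> simp [h]
  · by_cases h : (c l : ℕ) + 1 = n <;> simp [h]

theorem digitCell_succ (hm : 0 < m) (B : Box) (a : ℕ → Fin m) (c : ℕ → Fin n)
    (k l : ℕ) : B.digitCell a c (k + 1) l = (B.digitCell a c k l).gridCell m 1 (a k) 0 := by
  have hm0 : (m : ℝ) ≠ 0 := by exact_mod_cast hm.ne'
  have h1 : (∀ s < k + 1, (a s : ℕ) + 1 = m) ↔ (∀ s < k, (a s : ℕ) + 1 = m) ∧ (a k : ℕ) + 1 = m :=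
    Nat.forall_lt_succ_right
  simp only [gridCell, width_digitCell, height_digitCell]
  simp only [digitCell, mk.injEq, prefixValue_succ, h1]
  refine ⟨by field_simp; ring, by field_simp; ring, by simp, by simp, by simp, ?_, by simp,
    by simp⟩
  by_cases h : (a k : ℕ) + 1 = m <;> simp [h]

section BlowUp

variable {Ω : Type*} [MeasurableSpace Ω] {P : Measure Ω}
  {Z : Ω → (ℕ → Fin m) × (ℕ → Fin n)} (hZ : Measurable Z) {B : Box} (hw : 0 < B.width)
  (hh : 0 < B.height) (hm : 1 < m) (hn : 1 < n)
  (hadm : ∀ᵐ ω ∂P, Admissible B.rightClosed (Z ω).1 ∧ Admissible B.topClosed (Z ω).2)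
  {μ : ProbabilityMeasure (ℝ × ℝ)} (hμ : (μ : Measure (ℝ × ℝ)) = P.map fun ω => B.digitPoint (Z ω))
  (a : ℕ → Fin m) (c : ℕ → Fin n) (k l : ℕ)
include hZ hw hh hm hn hadm hμ

theorem measure_digitCell : (μ : Measure (ℝ × ℝ)) (B.digitCell a c k l).toSet =
    P {ω | (∀ s < k, (Z ω).1 s = a s) ∧ ∀ s < l, (Z ω).2 s = c s} := by
  have hp : Measurable fun ω => B.digitPoint (Z ω) := B.measurable_digitPoint.comp hZ
  rw [hμ, Measure.map_apply hp (measurableSet_toSet _)]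
  refine measure_congr ?_
  filter_upwards [hadm] with ω hω
  exact propext (digitPoint_mem_digitCell_iff hm hn hw hh hω.1 hω.2 a c k l)

/-- The blow-up of a measure along a digit cell is the conditional law of the remaining digits. -/
theorem blowUp_digitCell
    (h0 : P {ω | (∀ s < k, (Z ω).1 s = a s) ∧ ∀ s < l, (Z ω).2 s = c s} ≠ 0) :
    (((B.digitCell a c k l).blowUp μ : ProbabilityMeasure (ℝ × ℝ)) : Measure (ℝ × ℝ)) =
      (P[|{ω | (∀ s < k, (Z ω).1 s = a s) ∧ ∀ s < l, (Z ω).2 s = c s}]).map fun ω =>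
        ((B.digitCell a c k l).width / √(B.digitCell a c k l).area *
            Real.ofDigits (shift^[k] (Z ω).1),
          (B.digitCell a c k l).height / √(B.digitCell a c k l).area *
            Real.ofDigits (shift^[l] (Z ω).2)) := by
  have hmeas := measure_digitCell hZ hw hh hm hn hadm hμ a c k l
  have hE : MeasurableSet {ω | (∀ s < k, (Z ω).1 s = a s) ∧ ∀ s < l, (Z ω).2 s = c s} 
      :=
    ((measurable_fst.comp hZ) (measurableSet_prefix a k)).inter
      ((measurable_snd.comp hZ) (measurableSet_prefix c l))
  set A := B.digitCell a c k l with hA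
  set E := {ω | (∀ s < k, (Z ω).1 s = a s) ∧ ∀ s < l, (Z ω).2 s = c s} with hEdef
  have hm0 : (m : ℝ) ≠ 0 := by exact_mod_cast (by omega : m ≠ 0)
  have hn0 : (n : ℝ) ≠ 0 := by exact_mod_cast (by omega : n ≠ 0)
  have hF : Measurable fun ω => (A.width / √A.area * Real.ofDigits (shift^[k] (Z ω).1),
      A.height / √A.area * Real.ofDigits (shift^[l] (Z ω).2)) :=
    ((measurable_ofDigits.comp ((measurable_shift.iterate k).comp
      (measurable_fst.comp hZ))).const_mul _).prodMk
      ((measurable_ofDigits.comp ((measurable_shift.iterate l).comp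
        (measurable_snd.comp hZ))).const_mul _)
  have hp : Measurable fun ω => B.digitPoint (Z ω) := B.measurable_digitPoint.comp hZ
  rw [coe_blowUp (by rw [hmeas]; exact h0)]
  ext D hD
  rw [Measure.map_apply A.measurable_rescale hD, Measure.map_apply hF hD,
    cond_apply A.measurableSet_toSet, cond_apply hE, hmeas, hμ,
    Measure.map_apply hp
      (A.measurableSet_toSet.inter (A.measurable_rescale hD))]
  congr 1
  refine measure_congr ?_
  filter_upwards [hadm] with ω hω
  have hiff := digitPoint_mem_digitCell_iff hm hn hw hh hω.1 hω.2 a c k l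
  have hval : ω ∈ E → A.rescale (B.digitPoint (Z ω)) =
      (A.width / √A.area * Real.ofDigits (shift^[k] (Z ω).1),
        A.height / √A.area * Real.ofDigits (shift^[l] (Z ω).2)) := by
    intro hωE
    have e1 : A.left = B.left + B.width * prefixValue a k := rfl
    have e2 : A.bottom = B.bottom + B.height * prefixValue c l := rfl
    rw [rescale, digitPoint, ofDigits_eq_prefixValue_add (Z ω).1 k,
      ofDigits_eq_prefixValue_add (Z ω).2 l, prefixValue_congr hωE.1, prefixValue_congr hωE.2, e1,
      e2, hA, width_digitCell, height_digitCell, ← hA]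
    refine Prod.ext ?_ ?_ <;> simp only <;> ring
  refine propext ⟨fun h => ?_, fun h => ?_⟩
  · have h1 := hiff.1 h.1
    refine ⟨h1, ?_⟩
    rw [mem_preimage, ← hval h1]
    exact h.2
  · refine ⟨hiff.2 h.1, ?_⟩
    change A.rescale (B.digitPoint (Z ω)) ∈ D
    rw [hval h.1]
    exact h.2

end BlowUp

/-- The box `[0, n^{-t/2}] × [0, n^{t/2}]` of area one; the flags say whether its right and its
upper side are included. -/
noncomputable def normalised (n : ℕ) (t : ℝ) (rc tc : Bool) : Box :=
  ⟨0, (n : ℝ) ^ (-t / 2), 0, (n : ℝ) ^ (t / 2), true, rc, true, tc⟩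

section Normalised

variable (hn : 1 < n)
include hn

theorem width_div_sqrt_area {A : Box} (hA : A ∈ approxSquares n) :
    A.width / √A.area = (n : ℝ) ^ (-A.eccentricity n / 2) ∧
      A.height / √A.area = (n : ℝ) ^ (A.eccentricity n / 2) := by
  obtain ⟨hw, hh, -⟩ := hA
  have hn0 : (0 : ℝ) < n := by exact_mod_cast (by omega : 0 < n)
  have hn1 : (n : ℝ) ≠ 1 := by exact_mod_cast (by omega : n ≠ 1)
  have hpow : (n : ℝ) ^ A.eccentricity n = A.height / A.width := by
    rw [eccentricity, Real.rpow_logb hn0 hn1 (div_pos hh hw)]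
  have h1 : (n : ℝ) ^ (A.eccentricity n / 2) = √(A.height / A.width) := by
    rw [Real.sqrt_eq_rpow, ← hpow, ← Real.rpow_mul hn0.le]; congr 1; ring
  have h2 : (n : ℝ) ^ (-A.eccentricity n / 2) = (√(A.height / A.width))⁻¹ := by
    rw [← h1, ← Real.rpow_neg hn0.le]; congr 1; ring
  have hsw := Real.sqrt_pos.2 hw
  have hsh := Real.sqrt_pos.2 hh
  rw [h1, h2, area, Real.sqrt_mul hw.le, Real.sqrt_div hh.le]
  have ew := Real.sq_sqrt hw.le
  have eh := Real.sq_sqrt hh.le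
  constructor
  · field_simp; exact ew.symm
  · field_simp; exact eh.symm

theorem normalise_eq_normalised {A : Box} (hA : A ∈ approxSquares n) (hl : A.leftClosed = true)
    (hb : A.bottomClosed = true) :
    A.normalise = normalised n (A.eccentricity n) A.rightClosed A.topClosed := by
  obtain ⟨h1, h2⟩ := width_div_sqrt_area hn hA
  simp only [normalise, normalised, mk.injEq]
  exact ⟨trivial, h1, trivial, h2, hl, trivial, hb, trivial⟩

theorem eccentricity_normalised (t : ℝ) (rc tc : Bool) :
    (normalised n t rc tc).eccentricity n = t := by
  have hn0 : (0 : ℝ) < n := by exact_mod_cast (by omega : 0 < n)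
  have hn1 : (n : ℝ) ≠ 1 := by exact_mod_cast (by omega : n ≠ 1)
  simp only [eccentricity, width, height, normalised, sub_zero]
  rw [← Real.rpow_sub hn0, Real.logb_rpow hn0 hn1]
  ring

theorem width_normalised_pos (t : ℝ) (rc tc : Bool) : 0 < (normalised n t rc tc).width := by
  have hn0 : (0 : ℝ) < n := by exact_mod_cast (by omega : 0 < n)
  simp only [width, normalised, sub_zero]
  positivity

theorem height_normalised_pos (t : ℝ) (rc tc : Bool) : 0 < (normalised n t rc tc).height := by
  have hn0 : (0 : ℝ) < n := by exact_mod_cast (by omega : 0 < n)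
  simp only [height, normalised, sub_zero]
  positivity

theorem normalised_mem_approxSquares {t : ℝ} (ht : t ∈ Ico (0 : ℝ) 1) (rc tc : Bool) :
    normalised n t rc tc ∈ approxSquares n :=
  ⟨width_normalised_pos hn t rc tc, height_normalised_pos hn t rc tc, by
    rwa [eccentricity_normalised hn]⟩

end Normalised

theorem digitPoint_normalised (t : ℝ) (rc tc : Bool) (z : (ℕ → Fin m) × (ℕ → Fin n)) :
    (normalised n t rc tc).digitPoint z =
      hyperbolicMap n t (Real.ofDigits z.1, Real.ofDigits z.2) := by
  simp [digitPoint, normalised, hyperbolicMap, width, height]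

end Box

/-! ### Bernoulli measures and their fibre measures -/

/-- The flag saying whether the last digit has probability one. -/
noncomputable def lastFlag {b : ℕ} (ρ : Measure (Fin b)) : Bool :=
  open Classical in decide (ρ {i | (i : ℕ) + 1 = b} = 1)

/-- Almost surely the digits are admissible for the box that contains its right side exactly if the
last digit has probability one; in that case all the digits are the last one. -/
theorem ae_admissible {b : ℕ} (ρ : Measure (Fin b)) [IsProbabilityMeasure ρ] :
    ∀ᵐ X ∂iidLaw ρ, Admissible (lastFlag ρ) X ∧
      (lastFlag ρ = true → ∀ k, (X k : ℕ) + 1 = b) := by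
  set L : Set (Fin b) := {i | (i : ℕ) + 1 = b} with hL
  have mL : MeasurableSet L := MeasurableSet.of_discrete
  by_cases h : ρ L = 1
  · have h1 : ∀ᵐ X ∂iidLaw ρ, ∀ k : ℕ, X k ∈ L := by
      rw [ae_all_iff]
      intro k
      have hmp := measurePreserving_eval_infinitePi (fun _ : ℕ => ρ) k
      have h2 : ∀ᵐ i ∂ρ, i ∈ L := (prob_compl_eq_zero_iff mL).2 h
      exact hmp.quasiMeasurePreserving.ae h2
    filter_upwards [h1] with X hX
    exact ⟨.inr ⟨by simp [lastFlag, ← hL, h], hX⟩, fun _ => hX⟩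
  · have h1 : ∀ᵐ X ∂iidLaw ρ, ∀ k : ℕ, ¬ ∀ s ≥ k, X s ∈ L := by
      rw [ae_all_iff]
      intro k
      rw [ae_iff]
      simp only [not_not]
      have hle : ∀ j : ℕ, iidLaw ρ {X | ∀ s ≥ k, X s ∈ L} ≤ ρ L ^ j := by
        intro j
        calc iidLaw ρ {X | ∀ s ≥ k, X s ∈ L} ≤
            iidLaw ρ (((Finset.Ico k (k + j) : Finset ℕ) : Set ℕ).pi fun _ => L) := by
              refine measure_mono fun X hX s hs => hX s ?_
              exact (Finset.mem_Ico.1 (Finset.mem_coe.1 hs)).1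
          _ = ρ L ^ j := by
              rw [Measure.infinitePi_pi _ fun _ _ => mL, Finset.prod_const, Nat.card_Ico]
              congr 1; omega
      have hlt : ρ L < 1 := lt_of_le_of_ne prob_le_one h
      exact le_antisymm (ge_of_tendsto' (ENNReal.tendsto_pow_atTop_nhds_zero_of_lt_one hlt) hle)
        zero_le
    filter_upwards [h1] with X hX
    refine ⟨.inl fun k => ?_, fun hf => absurd hf (by simp [lastFlag, ← hL, h])⟩
    have := hX k
    push Not at this
    exact this

/-- The sequence of the values of the random functions `R k` at the letters `u k`. -/
def select {A B : Type*} (R : ℕ → A → B) (u : ℕ → A) : ℕ → B := fun k => R k (u k)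

section Select

variable {m n : ℕ}

theorem measurable_select :
    Measurable fun p : (ℕ → Fin m → Fin n) × (ℕ → Fin m) => select p.1 p.2 := by
  refine measurable_pi_lambda _ fun k => ?_
  have h1 : Measurable fun q : (Fin m → Fin n) × Fin m => q.1 q.2 := measurable_of_countable _
  have h2 : Measurable fun p : (ℕ → Fin m → Fin n) × (ℕ → Fin m) => (p.1 k, p.2 k) := by fun_prop
  exact h1.comp h2

theorem continuous_select (R : ℕ → Fin m → Fin n) : Continuous fun u => select R u :=
  continuous_pi fun k => (continuous_of_discreteTopology (f := R k)).comp (continuous_apply k)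

theorem shift_iterate_select (R : ℕ → Fin m → Fin n) (u : ℕ → Fin m) (l : ℕ) :
    shift^[l] (select R u) = select (shift^[l] R) (shift^[l] u) := by
  ext k
  simp only [select, shift_iterate_apply]

variable (ρ : Measure (Fin m)) (r : Measure (Fin m → Fin n)) [IsProbabilityMeasure ρ]
  [IsProbabilityMeasure r]

/-- The law of one digit in base `n`. -/
noncomputable def rowLaw : Measure (Fin n) := (ρ.prod r).map fun p => p.2 p.1

instance : IsProbabilityMeasure (rowLaw ρ r) :=
  Measure.isProbabilityMeasure_map (measurable_of_countable _).aemeasurable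

/-- The pairs of digits built from an i.i.d. sequence of letters and an i.i.d. sequence of
functions are i.i.d. -/
theorem measurePreserving_zip_select :
    MeasurePreserving (fun z : (ℕ → Fin m) × (ℕ → Fin m → Fin n) => fun k => (z.1 k, z.2 k (z.1 k)))
      ((iidLaw ρ).prod (iidLaw r)) (iidLaw ((ρ.prod r).map fun p => (p.1, p.2 p.1))) := by
  have h1 : Measurable fun p : Fin m × (Fin m → Fin n) => (p.1, p.2 p.1) :=
    measurable_of_countable _
  have h2 : MeasurePreserving (fun (x : ℕ → Fin m × (Fin m → Fin n)) k => ((x k).1, (x k).2 (x k).1))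
      (iidLaw (ρ.prod r)) (iidLaw ((ρ.prod r).map fun p => (p.1, p.2 p.1))) :=
    ⟨measurable_pi_lambda _ fun k => h1.comp (measurable_pi_apply k),
      Measure.infinitePi_map_pi (fun _ : ℕ => ρ.prod r) fun _ => h1⟩
  exact h2.comp (measurePreserving_zip ρ r)

theorem ae_admissible_select :
    ∀ᵐ z ∂(iidLaw ρ).prod (iidLaw r), Admissible (lastFlag (rowLaw ρ r)) (select z.2 z.1) ∧
      (lastFlag (rowLaw ρ r) = true → ∀ k, ((select z.2 z.1 k : Fin n) : ℕ) + 1 = n) := by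
  have h1 : Measurable fun p : Fin m × (Fin m → Fin n) => p.2 p.1 := measurable_of_countable _
  have h2 : MeasurePreserving (fun (x : ℕ → Fin m × (Fin m → Fin n)) k => (x k).2 (x k).1)
      (iidLaw (ρ.prod r)) (iidLaw (rowLaw ρ r)) :=
    ⟨measurable_pi_lambda _ fun k => h1.comp (measurable_pi_apply k),
      Measure.infinitePi_map_pi (fun _ : ℕ => ρ.prod r) fun _ => h1⟩
  exact (h2.comp (measurePreserving_zip ρ r)).quasiMeasurePreserving.ae
    (ae_admissible (rowLaw ρ r))

end Select

/-- Finite measures on sequences over a finite alphabet are determined by the cylinders. -/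
theorem ext_of_cylinder {S : Type*} [Finite S] [TopologicalSpace S] [DiscreteTopology S]
    [MeasurableSpace S] [BorelSpace S] {P Q : Measure (ℕ → S)} [IsProbabilityMeasure P]
    [IsProbabilityMeasure Q]
    (h : ∀ (a : ℕ → S) (k : ℕ), P (PiNat.cylinder a k) = Q (PiNat.cylinder a k)) : P = Q := by
  refine ext_of_generate_finite {s | ∃ (a : ℕ → S) (k : ℕ), s = PiNat.cylinder a k} ?_ ?_ ?_ ?_
  · rw [BorelSpace.measurable_eq (α := ℕ → S)]
    exact (PiNat.isTopologicalBasis_cylinders fun _ : ℕ => S).borel_eq_generateFrom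
  · rintro _ ⟨a, k, rfl⟩ _ ⟨b, l, rfl⟩ ⟨z, hz1, hz2⟩
    refine ⟨z, max k l, ?_⟩
    ext x
    simp only [PiNat.cylinder, mem_inter_iff, mem_ofPred_eq] at hz1 hz2 ⊢
    constructor
    · rintro ⟨h1, h2⟩ i hi
      rcases lt_max_iff.1 hi with hi | hi
      · rw [h1 i hi, hz1 i hi]
      · rw [h2 i hi, hz2 i hi]
    · intro h
      exact ⟨fun i hi => by rw [h i (hi.trans_le (le_max_left _ _)), hz1 i hi],
        fun i hi => by rw [h i (hi.trans_le (le_max_right _ _)), hz2 i hi]⟩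
  · rintro _ ⟨a, k, rfl⟩
    exact h a k
  · simp

theorem iidLaw_cylinder {S : Type*} [MeasurableSpace S] [MeasurableSingletonClass S]
    (q : Measure S) [IsProbabilityMeasure q] (a : ℕ → S) (k : ℕ) :
    iidLaw q (PiNat.cylinder a k) = ∏ s ∈ Finset.range k, q {a s} := by
  rw [← Measure.infinitePi_pi (fun _ => q) fun _ _ => measurableSet_singleton _]
  congr 1
  ext x
  simp [PiNat.cylinder, Set.mem_pi]

/-- A Bernoulli measure is the law of a sequence of pairs of digits that are independent: an
i.i.d. sequence of first digits, and second digits that are obtained by applying independent random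
functions to the first digits. -/
theorem IsBernoulli.exists_eq_map {m n : ℕ} (hn : 0 < n)
    {ν : Measure ((ℕ → Fin m) × (ℕ → Fin n))} [IsProbabilityMeasure ν] (h : IsBernoulli ν) :
    ∃ (ρ : Measure (Fin m)) (r : Measure (Fin m → Fin n)), IsProbabilityMeasure ρ ∧
      IsProbabilityMeasure r ∧
      ν = ((iidLaw ρ).prod (iidLaw r)).map fun z => (z.1, select z.2 z.1) := by
  obtain ⟨p, -, hp⟩ := h
  have : Nonempty (Fin n) := ⟨⟨0, hn⟩⟩
  have hcyl : ∀ (u : ℕ → Fin m) (v : ℕ → Fin n) (k : ℕ),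
      ν (PiNat.cylinder u k ×ˢ PiNat.cylinder v k) = ∏ s ∈ Finset.range k, (p (u s) (v s) : ℝ≥0∞) := by
    intro u v k
    induction k with
    | zero => simp
    | succ k ih => rw [hp, ih, Finset.prod_range_succ, mul_comm]
  let zip : (ℕ → Fin m) × (ℕ → Fin n) → ℕ → Fin m × Fin n := fun z k => (z.1 k, z.2 k)
  have hzip : Measurable zip := by fun_prop
  let unzip : (ℕ → Fin m × Fin n) → (ℕ → Fin m) × (ℕ → Fin n) := fun x =>
    (fun k => (x k).1, fun k => (x k).2)
  have hunzip : Measurable unzip := by fun_prop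
  have hzcyl : ∀ (a : ℕ → Fin m × Fin n) (k : ℕ), ν.map zip (PiNat.cylinder a k) =
      ∏ s ∈ Finset.range k, (p (a s).1 (a s).2 : ℝ≥0∞) := by
    intro a k
    have hcyl' : MeasurableSet (PiNat.cylinder a k) := measurableSet_prefix a k
    rw [Measure.map_apply hzip hcyl',
      ← hcyl (fun s => (a s).1) (fun s => (a s).2) k]
    congr 1
    ext z
    simp only [zip, PiNat.cylinder, mem_preimage, mem_ofPred_eq, Set.mem_prod, Prod.ext_iff]
    exact ⟨fun h => ⟨fun i hi => (h i hi).1, fun i hi => (h i hi).2⟩,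
      fun h i hi => ⟨h.1 i hi, h.2 i hi⟩⟩
  -- The law of the first pair of digits.
  let q : Measure (Fin m × Fin n) := (ν.map zip).map fun x => x 0
  have hzprob : IsProbabilityMeasure (ν.map zip) :=
    Measure.isProbabilityMeasure_map hzip.aemeasurable
  have hqprob : IsProbabilityMeasure q :=
    Measure.isProbabilityMeasure_map (measurable_pi_apply 0).aemeasurable
  have hq : ∀ a, q {a} = p a.1 a.2 := by
    intro a
    have := hzcyl (fun _ => a) 1
    rw [Finset.prod_range_one] at this
    rw [← this, Measure.map_apply (measurable_pi_apply 0) (measurableSet_singleton _)]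
    congr 1
    ext x
    simp [PiNat.cylinder]
  have hνq : ν.map zip = iidLaw q := by
    refine ext_of_cylinder fun a k => ?_
    rw [hzcyl, iidLaw_cylinder]
    exact Finset.prod_congr rfl fun s _ => (hq _).symm
  let r : Measure (Fin m → Fin n) := Measure.pi fun a => q.condKernel a
  have hsel : (q.fst.prod r).map (fun p => (p.1, p.2 p.1)) = q := by
    conv_rhs => rw [← q.disintegrate q.condKernel]
    ext s hs
    rw [Measure.map_apply (measurable_of_countable _) hs,
      Measure.prod_apply (measurable_of_countable _ hs), Measure.compProd_apply hs]
    refine lintegral_congr fun a => ?_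
    rw [← (measurePreserving_eval (fun a => q.condKernel a) a).measure_preimage
      MeasurableSet.of_discrete.nullMeasurableSet]
    rfl
  refine ⟨q.fst, r, inferInstance, inferInstance, ?_⟩
  have hmp := measurePreserving_zip_select q.fst r
  rw [hsel, ← hνq] at hmp
  have h1 : ν = (ν.map zip).map unzip := by
    rw [Measure.map_map hunzip hzip]
    exact Measure.map_id.symm
  rw [h1, ← hmp.map_eq, Measure.map_map hunzip hmp.measurable]
  rfl

/-- The admissible digits of a number are a measurable function of the number. -/
theorem exists_measurable_digits {b : ℕ} (hb : 1 < b) (f : Bool) :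
    ∃ g : ℝ → ℕ → Fin b, Measurable g ∧ ∀ X, Admissible f X → g (Real.ofDigits X) = X := by
  let D : Set (ℕ → Fin b) := {X | Admissible f X}
  have hD : MeasurableSet D := measurableSet_admissible _
  have hemb : MeasurableEmbedding fun X : D => Real.ofDigits (X : ℕ → Fin b) := by
    have := hD.standardBorel
    exact (measurable_ofDigits.comp measurable_subtype_coe).measurableEmbedding
      ((injOn_ofDigits hb).injective)
  have : Nonempty (ℕ → Fin b) := ⟨fun _ => ⟨0, by omega⟩⟩
  obtain ⟨g, hg, hgD⟩ := hemb.exists_measurable_extend measurable_subtype_coe fun _ => this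
  exact ⟨g, hg, fun X hX => congrFun hgD ⟨X, hX⟩⟩

section FibreMeasure

variable {m n : ℕ} (ρ : Measure (Fin m)) (r : Measure (Fin m → Fin n)) [IsProbabilityMeasure ρ]
  [IsProbabilityMeasure r]

theorem measurable_ofDigits_select_right (u : ℕ → Fin m) :
    Measurable fun R : ℕ → Fin m → Fin n => Real.ofDigits (select R u) :=
  measurable_ofDigits.comp (measurable_select.comp measurable_prodMk_right)

/-- The law of the second coordinate given that the first coordinate has digits `u`. -/
noncomputable def fibreKernel : Kernel (ℕ → Fin m) ℝ where
  toFun u := (iidLaw r).map fun R => Real.ofDigits (select R u)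
  measurable' := by
    refine Measure.measurable_of_measurable_coe _ fun s hs => ?_
    have h1 : Measurable fun p : (ℕ → Fin m) × (ℕ → Fin m → Fin n) =>
        Real.ofDigits (select p.2 p.1) :=
      measurable_ofDigits.comp (measurable_select.comp measurable_swap)
    have h2 : ∀ u : ℕ → Fin m, (iidLaw r).map (fun R => Real.ofDigits (select R u)) s =
        iidLaw r (Prod.mk u ⁻¹' ((fun p : (ℕ → Fin m) × (ℕ → Fin m → Fin n) =>
          Real.ofDigits (select p.2 p.1)) ⁻¹' s)) := fun u => by
      rw [Measure.map_apply (measurable_ofDigits_select_right u) hs]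
      rfl
    simp_rw [h2]
    exact measurable_measure_prodMk_left (h1 hs)

theorem fibreKernel_apply (u : ℕ → Fin m) :
    fibreKernel r u = (iidLaw r).map fun R => Real.ofDigits (select R u) := rfl

instance : IsMarkovKernel (fibreKernel r) :=
  ⟨fun u => Measure.isProbabilityMeasure_map (measurable_ofDigits_select_right u).aemeasurable⟩

variable {μ : ProbabilityMeasure (ℝ × ℝ)}
  (hμ : (μ : Measure (ℝ × ℝ)) = ((iidLaw ρ).prod (iidLaw r)).map
    fun z => (Real.ofDigits z.1, Real.ofDigits (select z.2 z.1)))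
include hμ

omit [IsProbabilityMeasure ρ] in
theorem fst_eq_map_ofDigits :
    (μ : Measure (ℝ × ℝ)).fst = (iidLaw ρ).map Real.ofDigits := by
  have h1 : Measurable fun z : (ℕ → Fin m) × (ℕ → Fin m → Fin n) =>
      (Real.ofDigits z.1, Real.ofDigits (select z.2 z.1)) :=
    (measurable_ofDigits.comp measurable_fst).prodMk
      (measurable_ofDigits.comp (measurable_select.comp measurable_swap))
  rw [hμ, Measure.fst, Measure.map_map measurable_fst h1]
  have h2 : (Prod.fst ∘ fun z : (ℕ → Fin m) × (ℕ → Fin m → Fin n) =>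
      (Real.ofDigits z.1, Real.ofDigits (select z.2 z.1))) = Real.ofDigits ∘ Prod.fst := rfl
  rw [h2, ← Measure.map_map measurable_ofDigits measurable_fst, ← Measure.fst, Measure.fst_prod]

/-- The conditional measures on the vertical fibres are the laws of the second coordinate given the
digits of the first one. -/
theorem ae_condKernel_eq (hm : 1 < m) :
    ∀ᵐ u ∂iidLaw ρ, (μ : Measure (ℝ × ℝ)).condKernel (Real.ofDigits u) = fibreKernel r u := by
  obtain ⟨g, hg, hgD⟩ := exists_measurable_digits hm (lastFlag ρ)
  have hgu : ∀ᵐ u ∂iidLaw ρ, g (Real.ofDigits u) = u :=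
    (ae_admissible ρ).mono fun u hu => hgD u hu.1
  have h1 : Measurable fun z : (ℕ → Fin m) × (ℕ → Fin m → Fin n) =>
      (Real.ofDigits z.1, Real.ofDigits (select z.2 z.1)) :=
    (measurable_ofDigits.comp measurable_fst).prodMk
      (measurable_ofDigits.comp (measurable_select.comp measurable_swap))
  have hfst := fst_eq_map_ofDigits ρ r hμ
  have hcomp : (μ : Measure (ℝ × ℝ)) =
      (μ : Measure (ℝ × ℝ)).fst ⊗ₘ ((fibreKernel r).comap g hg) := by
    refine Measure.ext_prod fun {s t} hs ht => ?_
    rw [Measure.compProd_apply_prod hs ht, hfst,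
      setLIntegral_map hs ((Kernel.measurable_coe _ ht)) measurable_ofDigits, hμ,
      Measure.map_apply h1 (hs.prod ht), Measure.prod_apply (h1 (hs.prod ht)),
      ← lintegral_indicator (measurable_ofDigits hs)]
    refine lintegral_congr_ae ?_
    filter_upwards [hgu] with u hu
    by_cases hus : Real.ofDigits u ∈ s
    · rw [indicator_of_mem (by exact hus), Kernel.comap_apply, hu, fibreKernel_apply,
        Measure.map_apply (measurable_ofDigits_select_right u) ht]
      congr 1
      ext R
      simp [hus]
    · rw [indicator_of_notMem (by exact hus)]
      have : Prod.mk u ⁻¹' ((fun z : (ℕ → Fin m) × (ℕ → Fin m → Fin n) =>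
          (Real.ofDigits z.1, Real.ofDigits (select z.2 z.1))) ⁻¹' s ×ˢ t) = ∅ := by
        ext R
        simp [hus]
      rw [this, measure_empty]
  have hae := eq_condKernel_of_measure_eq_compProd ((fibreKernel r).comap g hg) hcomp
  rw [hfst] at hae
  filter_upwards [ae_of_ae_map measurable_ofDigits.aemeasurable hae, hgu] with u hu hgu
  rw [← hu, Kernel.comap_apply, hgu]

end FibreMeasure

/-! ### The limit measures -/

/-- Pointwise convergence of random variables implies weak convergence of their laws. -/
theorem tendsto_of_coe_eq_map {ι Ω X : Type*} [TopologicalSpace X] [MeasurableSpace X]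
    [TopologicalSpace.PseudoMetrizableSpace X] [OpensMeasurableSpace X]
    [MeasurableSpace Ω] {P : Measure Ω} [IsProbabilityMeasure P] {F : Filter ι}
    [F.IsCountablyGenerated] {Y : ι → Ω → X} {Y₀ : Ω → X} (hY : ∀ i, Measurable (Y i))
    (hY₀ : Measurable Y₀) {ν : ι → ProbabilityMeasure X} {ν₀ : ProbabilityMeasure X}
    (hν : ∀ i, (ν i : Measure X) = P.map (Y i)) (hν₀ : (ν₀ : Measure X) = P.map Y₀)
    (h : ∀ ω, Tendsto (fun i => Y i ω) F (𝓝 (Y₀ ω))) : Tendsto ν F (𝓝 ν₀) := by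
  rw [ProbabilityMeasure.tendsto_iff_forall_integral_tendsto]
  intro g
  rw [hν₀, integral_map hY₀.aemeasurable g.continuous.measurable.aestronglyMeasurable]
  have : ∀ i, ∫ x, g x ∂(ν i : Measure X) = ∫ ω, g (Y i ω) ∂P := fun i => by
    rw [hν, integral_map (hY i).aemeasurable g.continuous.measurable.aestronglyMeasurable]
  simp_rw [this]
  exact tendsto_integral_filter_of_dominated_convergence (fun _ => ‖g‖)
    (.of_forall fun i => (g.continuous.measurable.comp (hY i)).aestronglyMeasurable)
    (.of_forall fun i => ae_of_all _ fun ω => g.norm_coe_le_norm _) (integrable_const _)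
    (ae_of_all _ fun ω => (g.continuous.tendsto _).comp (h ω))

section LimitLaw

variable {m n : ℕ} (ρ : Measure (Fin m)) (r : Measure (Fin m → Fin n)) [IsProbabilityMeasure ρ]
  [IsProbabilityMeasure r]

theorem continuous_hyperbolicMap (hn : 0 < n) :
    Continuous fun p : ℝ × (ℝ × ℝ) => hyperbolicMap n p.1 p.2 := by
  have hn0 : (n : ℝ) ≠ 0 := by exact_mod_cast hn.ne'
  have h : Continuous fun t : ℝ => (n : ℝ) ^ t := Real.continuous_const_rpow hn0
  unfold hyperbolicMap
  exact ((h.comp (by fun_prop)).mul (by fun_prop)).prodMk ((h.comp (by fun_prop)).mul (by fun_prop))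

/-- The random point `S_t (x, y)`, where `x` has digits `X` and the digits of `y` are selected from
`R` by the letters of `v`. -/
noncomputable def limitPoint (n : ℕ) (t : ℝ) (v X : ℕ → Fin m) (R : ℕ → Fin m → Fin n) : ℝ × ℝ :=
  hyperbolicMap n t (Real.ofDigits X, Real.ofDigits (select R v))

theorem measurable_limitPoint :
    Measurable fun q : (ℝ × (ℕ → Fin m)) × ((ℕ → Fin m) × (ℕ → Fin m → Fin n)) =>
      limitPoint n q.1.1 q.1.2 q.2.1 q.2.2 := by
  have h1 : Measurable fun q : (ℝ × (ℕ → Fin m)) × ((ℕ → Fin m) × (ℕ → Fin m → Fin n)) =>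
      Real.ofDigits q.2.1 := measurable_ofDigits.comp (measurable_fst.comp measurable_snd)
  have h2 : Measurable fun q : (ℝ × (ℕ → Fin m)) × ((ℕ → Fin m) × (ℕ → Fin m → Fin n)) =>
      Real.ofDigits (select q.2.2 q.1.2) :=
    measurable_ofDigits.comp (measurable_select.comp
      ((measurable_snd.comp measurable_snd).prodMk (measurable_snd.comp measurable_fst)))
  unfold limitPoint hyperbolicMap
  fun_prop

theorem measurable_limitPoint_right (t : ℝ) (u : ℕ → Fin m) :
    Measurable fun z : (ℕ → Fin m) × (ℕ → Fin m → Fin n) => limitPoint n t u z.1 z.2 :=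
  measurable_limitPoint.comp (measurable_prodMk_left (x := (t, u)))

theorem continuous_limitPoint (hn : 0 < n) (X : ℕ → Fin m) (R : ℕ → Fin m → Fin n) :
    Continuous fun p : ℝ × (ℕ → Fin m) => limitPoint n p.1 p.2 X R :=
  (continuous_hyperbolicMap hn).comp (continuous_fst.prodMk (continuous_const.prodMk
    (Real.continuous_ofDigits.comp ((continuous_select R).comp continuous_snd))))

/-- The measure `S_t (π₁ μ × μ_x)`, where `x` has digits `u` and `μ` is the Bernoulli measure with
digit laws `ρ` and `r`. -/
noncomputable def limitLaw (t : ℝ) (u : ℕ → Fin m) : ProbabilityMeasure (ℝ × ℝ) :=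
  ⟨((iidLaw ρ).prod (iidLaw r)).map
      fun z : (ℕ → Fin m) × (ℕ → Fin m → Fin n) => limitPoint n t u z.1 z.2,
    Measure.isProbabilityMeasure_map (measurable_limitPoint_right t u).aemeasurable⟩

theorem coe_limitLaw (t : ℝ) (u : ℕ → Fin m) :
    (limitLaw ρ r t u : Measure (ℝ × ℝ)) =
      ((iidLaw ρ).prod (iidLaw r)).map fun z => limitPoint n t u z.1 z.2 := rfl

theorem continuous_limitLaw (hn : 0 < n) :
    Continuous fun p : ℝ × (ℕ → Fin m) => limitLaw ρ r p.1 p.2 := by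
  rw [continuous_iff_continuousAt]
  intro p
  exact tendsto_of_coe_eq_map (P := (iidLaw ρ).prod (iidLaw r))
    (Y := fun (p : ℝ × (ℕ → Fin m)) z => limitPoint n p.1 p.2 z.1 z.2)
    (Y₀ := fun z => limitPoint n p.1 p.2 z.1 z.2)
    (fun p => measurable_limitPoint_right p.1 p.2) (measurable_limitPoint_right p.1 p.2)
    (fun p => coe_limitLaw ρ r p.1 p.2) (coe_limitLaw ρ r p.1 p.2)
    fun ω => (continuous_limitPoint hn ω.1 ω.2).tendsto p

theorem measurable_limitLaw :
    Measurable fun p : ℝ × (ℕ → Fin m) => limitLaw ρ r p.1 p.2 := by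
  refine Measurable.subtype_mk (p := IsProbabilityMeasure)
    (f := fun p : ℝ × (ℕ → Fin m) => (limitLaw ρ r p.1 p.2 : Measure (ℝ × ℝ))) ?_
  refine Measure.measurable_of_measurable_coe _ fun s hs => ?_
  have h2 : ∀ p : ℝ × (ℕ → Fin m), (limitLaw ρ r p.1 p.2 : Measure (ℝ × ℝ)) s =
      ((iidLaw ρ).prod (iidLaw r)) (Prod.mk p ⁻¹'
        ((fun q : (ℝ × (ℕ → Fin m)) × ((ℕ → Fin m) × (ℕ → Fin m → Fin n)) =>
          limitPoint n q.1.1 q.1.2 q.2.1 q.2.2) ⁻¹' s)) := fun p => by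
    rw [coe_limitLaw ρ r, Measure.map_apply (measurable_limitPoint_right p.1 p.2) hs]
    rfl
  simp_rw [h2]
  exact measurable_measure_prodMk_left (measurable_limitPoint hs)

variable {μ : ProbabilityMeasure (ℝ × ℝ)}
  (hμ : (μ : Measure (ℝ × ℝ)) = ((iidLaw ρ).prod (iidLaw r)).map
    fun z => (Real.ofDigits z.1, Real.ofDigits (select z.2 z.1)))
include hμ

theorem ae_fibreProduct_eq_limitLaw (hm : 1 < m) :
    ∀ᵐ u ∂iidLaw ρ, ∀ t, fibreProduct n μ t (Real.ofDigits u) = limitLaw ρ r t u := by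
  filter_upwards [ae_condKernel_eq ρ r hμ hm] with u hu t
  refine Subtype.ext ?_
  change _ = (limitLaw ρ r t u : Measure (ℝ × ℝ))
  rw [coe_limitLaw ρ r, fibreProduct]
  simp only
  rw [hu, fst_eq_map_ofDigits ρ r hμ, fibreKernel_apply,
    Measure.map_prod_map _ _ measurable_ofDigits (measurable_ofDigits_select_right u),
    Measure.map_map (measurable_hyperbolicMap n t)
      (measurable_ofDigits.prodMap (measurable_ofDigits_select_right u))]
  rfl

end LimitLaw

/-! ### The skew product behind the chain -/

section Skew

variable {m n : ℕ}

/-- The data that determine the path of the chain: an eccentricity, the digits of the point whose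
fibre measure we see, and the first digits and the random functions giving the second digits of the
point along which we zoom. -/
abbrev Seed (m n : ℕ) : Type := ℝ × ((ℕ → Fin m) × ((ℕ → Fin m) × (ℕ → Fin m → Fin n)))

/-- Passing to the next state: the eccentricity is rotated, the first digits are shifted, and the
vertical data are shifted if the box is cut into rows. -/
noncomputable def skewMap (m n : ℕ) (ω : Seed m n) : Seed m n :=
  (angleRotation m n ω.1, shift^[carry m n ω.1] ω.2.1, shift ω.2.2.1,
    shift^[carry m n ω.1] ω.2.2.2)

theorem skewMap_iterate (k : ℕ) (t : ℝ) (u i : ℕ → Fin m) (R : ℕ → Fin m → Fin n) :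
    (skewMap m n)^[k] (t, u, i, R) = ((angleRotation m n)^[k] t, shift^[carries m n t k] u,
      shift^[k] i, shift^[carries m n t k] R) := by
  induction k with
  | zero => rfl
  | succ k ih =>
    rw [Function.iterate_succ_apply', ih, Function.iterate_succ_apply', Function.iterate_succ_apply',
      carries, Nat.add_comm, Function.iterate_add_apply, Function.iterate_add_apply]
    rfl

theorem measurable_shift_iterate_apply {α S : Type*} [MeasurableSpace α] [MeasurableSpace S]
    {N : α → ℕ} (hN : Measurable N) {x : α → ℕ → S} (hx : Measurable x) :
    Measurable fun a => shift^[N a] (x a) := by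
  have h1 : Measurable fun p : (ℕ → S) × ℕ => shift^[p.2] p.1 :=
    measurable_from_prod_countable_left fun k => measurable_shift.iterate k
  exact h1.comp (hx.prodMk hN)

theorem measurable_skewMap : Measurable (skewMap m n) := by
  have hc : Measurable fun ω : Seed m n =>
      carry m n ω.1 := measurable_carry.comp measurable_fst
  exact (measurable_angleRotation.comp measurable_fst).prodMk
    ((measurable_shift_iterate_apply hc (by fun_prop)).prodMk
      ((measurable_shift.comp (by fun_prop)).prodMk
        (measurable_shift_iterate_apply hc (by fun_prop))))

variable (ρ : Measure (Fin m)) (r : Measure (Fin m → Fin n)) [IsProbabilityMeasure ρ]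
  [IsProbabilityMeasure r] {τ : Measure ℝ} [IsProbabilityMeasure τ]

/-- The law of the digits `u` that determine the fibre measure, of the first digits `i` of the point
along which we zoom, and of the random functions `R` that yield its second digits. -/
noncomputable abbrev digitLaw : Measure ((ℕ → Fin m) × ((ℕ → Fin m) × (ℕ → Fin m → Fin n))) :=
  (iidLaw ρ).prod ((iidLaw ρ).prod (iidLaw r))

theorem measurePreserving_digitLaw (k l : ℕ) :
    MeasurePreserving (fun y : (ℕ → Fin m) × ((ℕ → Fin m) × (ℕ → Fin m → Fin n)) =>
      (shift^[l] y.1, shift^[k] y.2.1, shift^[l] y.2.2)) (digitLaw ρ r) (digitLaw ρ r) :=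
  (measurePreserving_shift_iterate ρ l).prod
    ((measurePreserving_shift_iterate ρ k).prod (measurePreserving_shift_iterate r l))

theorem measurePreserving_skewMap (hτ : MeasurePreserving (angleRotation m n) τ τ) :
    MeasurePreserving (skewMap m n) (τ.prod (digitLaw ρ r)) (τ.prod (digitLaw ρ r)) :=
  hτ.skew_product (μc := digitLaw ρ r) (μd := digitLaw ρ r)
    (g := fun t (y : (ℕ → Fin m) × ((ℕ → Fin m) × (ℕ → Fin m → Fin n))) =>
      (shift^[carry m n t] y.1, shift^[1] y.2.1,
      shift^[carry m n t] y.2.2)) measurable_skewMap.snd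
    (ae_of_all _ fun t => (measurePreserving_digitLaw ρ r 1 (carry m n t)).map_eq)

/-- Splicing the digits preserves their law. -/
theorem measurePreserving_splice_digitLaw (k l : ℕ) :
    MeasurePreserving (fun p : ((ℕ → Fin m) × ((ℕ → Fin m) × (ℕ → Fin m → Fin n))) ×
        ((ℕ → Fin m) × ((ℕ → Fin m) × (ℕ → Fin m → Fin n))) =>
      (splice l p.1.1 p.2.1, splice k p.1.2.1 p.2.2.1, splice l p.1.2.2 p.2.2.2))
      ((digitLaw ρ r).prod (digitLaw ρ r)) (digitLaw ρ r) :=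
  measurePreserving_splice_prod (measurePreserving_splice ρ l)
    (measurePreserving_splice_prod (measurePreserving_splice ρ k) (measurePreserving_splice r l))

theorem measurable_of_coordinates {α S₁ S₂ S₃ : Type*} [mα : MeasurableSpace α]
    [MeasurableSpace S₁] [MeasurableSpace S₂] [MeasurableSpace S₃]
    {f : α → (ℕ → S₁) × ((ℕ → S₂) × (ℕ → S₃))} (h₁ : ∀ s, Measurable fun a => (f a).1 s)
    (h₂ : ∀ s, Measurable fun a => (f a).2.1 s) (h₃ : ∀ s, Measurable fun a => (f a).2.2 s) :
    Measurable f :=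
  (measurable_pi_iff.2 h₁).prodMk ((measurable_pi_iff.2 h₂).prodMk (measurable_pi_iff.2 h₃))

/-- The zero-one law for the fibres of an invariant event of the skew product: such a fibre is a tail
event for the digits. -/
theorem fibre_zero_or_one (hm : 2 ≤ m) (hmn : m < n)
    {A : Set (Seed m n)} (mA : MeasurableSet A)
    (hA : skewMap m n ⁻¹' A = A) {t : ℝ} (ht : t ∈ Ico (0 : ℝ) 1) :
    digitLaw ρ r (Prod.mk t ⁻¹' A) = 0 ∨ digitLaw ρ r (Prod.mk t ⁻¹' A) = 1 := by
  refine zero_or_one_of_splice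
    (fun k => measurePreserving_splice_digitLaw ρ r k (carries m n t k)) ?_
    (measurable_prodMk_left mA) ?_
  · set C := {E : Set ((ℕ → Fin m) × ((ℕ → Fin m) × (ℕ → Fin m → Fin n))) | MeasurableSet E ∧
      ∀ᶠ k in atTop, (fun p : ((ℕ → Fin m) × ((ℕ → Fin m) × (ℕ → Fin m → Fin n))) ×
        ((ℕ → Fin m) × ((ℕ → Fin m) × (ℕ → Fin m → Fin n))) =>
      (splice (carries m n t k) p.1.1 p.2.1, splice k p.1.2.1 p.2.2.1,
        splice (carries m n t k) p.1.2.2 p.2.2.2)) ⁻¹' E = E ×ˢ univ}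
    have hl := tendsto_carries hm hmn ht
    have h1 : ∀ s, @Measurable _ _ (MeasurableSpace.generateFrom C) _
        (fun y : (ℕ → Fin m) × ((ℕ → Fin m) × (ℕ → Fin m → Fin n)) => y.1 s) := fun s => by
      refine fun D hD => MeasurableSpace.measurableSet_generateFrom ⟨?_, ?_⟩
      · exact (measurable_pi_apply s).comp measurable_fst hD
      · filter_upwards [hl.eventually_gt_atTop s] with k hk
        ext p
        simp [splice_apply_of_lt hk]
    have h2 : ∀ s, @Measurable _ _ (MeasurableSpace.generateFrom C) _
        (fun y : (ℕ → Fin m) × ((ℕ → Fin m) × (ℕ → Fin m → Fin n)) => y.2.1 s) := fun s => by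
      refine fun D hD => MeasurableSpace.measurableSet_generateFrom ⟨?_, ?_⟩
      · exact (measurable_pi_apply s).comp (measurable_fst.comp measurable_snd) hD
      · filter_upwards [eventually_gt_atTop s] with k hk
        ext p
        simp [splice_apply_of_lt hk]
    have h3 : ∀ s, @Measurable _ _ (MeasurableSpace.generateFrom C) _
        (fun y : (ℕ → Fin m) × ((ℕ → Fin m) × (ℕ → Fin m → Fin n)) => y.2.2 s) := fun s => by
      refine fun D hD => MeasurableSpace.measurableSet_generateFrom ⟨?_, ?_⟩
      · exact (measurable_pi_apply s).comp (measurable_snd.comp measurable_snd) hD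
      · filter_upwards [hl.eventually_gt_atTop s] with k hk
        ext p
        simp [splice_apply_of_lt hk]
    exact fun A hA => measurable_of_coordinates (mα := MeasurableSpace.generateFrom C) (f := id)
      h1 h2 h3 hA
  · intro k
    refine ⟨Prod.mk ((angleRotation m n)^[k] t) ⁻¹' A, ?_⟩
    have hk : (skewMap m n)^[k] ⁻¹' A = A := by
      rw [Set.preimage_iterate_eq]
      exact Function.iterate_fixed hA k
    ext p
    conv_lhs => rw [mem_preimage, mem_preimage, ← hk, mem_preimage, skewMap_iterate]
    simp [shift_iterate_splice]

/-- The skew product is ergodic as soon as the rotation is. -/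
theorem ergodic_skewMap (hm : 2 ≤ m) (hmn : m < n) (hτ : Ergodic (angleRotation m n) τ)
    (hτ' : ∀ᵐ t ∂τ, t ∈ Ico (0 : ℝ) 1) : Ergodic (skewMap m n) (τ.prod (digitLaw ρ r)) := by
  refine ⟨measurePreserving_skewMap ρ r hτ.toMeasurePreserving, ⟨fun A mA hA => ?_⟩⟩
  set h : ℝ → ℝ≥0∞ := fun t => digitLaw ρ r (Prod.mk t ⁻¹' A) with hh
  have mh : Measurable h := measurable_measure_prodMk_left mA
  have hinv : ∀ t, h (angleRotation m n t) = h t := fun t => by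
    have h1 := (measurePreserving_digitLaw ρ r 1 (carry m n t)).measure_preimage
      (measurable_prodMk_left (x := angleRotation m n t) mA).nullMeasurableSet
    rw [hh]
    simp only
    rw [← h1]
    congr 1
    ext y
    conv_rhs => rw [mem_preimage, ← hA]
    rfl
  have hH : MeasurableSet (h ⁻¹' {1}) := mh (measurableSet_singleton _)
  have hHinv : angleRotation m n ⁻¹' (h ⁻¹' {1}) = h ⁻¹' {1} := by
    ext t
    simp [hinv]
  rw [eventuallyConst_set']
  rcases eventuallyConst_set'.1 (hτ.aeconst_set hH hHinv) with h0 | h1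
  · left
    rw [ae_eq_empty, Measure.measure_prod_null mA]
    filter_upwards [hτ', h0.mem_iff] with t ht ht0
    exact (fibre_zero_or_one ρ r hm hmn mA hA ht).resolve_right fun h => (ht0.1 h).elim
  · right
    rw [ae_eq_univ, Measure.measure_prod_null mA.compl]
    filter_upwards [h1.mem_iff] with t ht1
    have : h t = 1 := ht1.2 trivial
    rw [preimage_compl]
    exact (prob_compl_eq_zero_iff (measurable_prodMk_left mA)).2 this

end Skew

/-! ### Measurability of boxes and blow-ups -/

namespace Box

theorem measurable_iff {α : Type*} [MeasurableSpace α] {F : α → Box} : Measurable F ↔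
    Measurable fun x => (((F x).left, (F x).right, (F x).bottom, (F x).top),
      ((F x).leftClosed, (F x).rightClosed, (F x).bottomClosed, (F x).topClosed)) :=
  measurable_comap_iff

theorem measurable_fields : Measurable fun B : Box => ((B.left, B.right, B.bottom, B.top),
      (B.leftClosed, B.rightClosed, B.bottomClosed, B.topClosed)) :=
  comap_measurable _

@[fun_prop] theorem measurable_left : Measurable Box.left := measurable_fields.fst.fst
@[fun_prop] theorem measurable_right : Measurable Box.right := measurable_fields.fst.snd.fst
@[fun_prop] theorem measurable_bottom : Measurable Box.bottom := measurable_fields.fst.snd.snd.fst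
@[fun_prop] theorem measurable_top : Measurable Box.top := measurable_fields.fst.snd.snd.snd
@[fun_prop] theorem measurable_leftClosed : Measurable Box.leftClosed := measurable_fields.snd.fst
@[fun_prop] theorem measurable_rightClosed : Measurable Box.rightClosed :=
  measurable_fields.snd.snd.fst
@[fun_prop] theorem measurable_bottomClosed : Measurable Box.bottomClosed :=
  measurable_fields.snd.snd.snd.fst
@[fun_prop] theorem measurable_topClosed : Measurable Box.topClosed :=
  measurable_fields.snd.snd.snd.snd

@[fun_prop] theorem measurable_width : Measurable width := by unfold width; fun_prop
@[fun_prop] theorem measurable_height : Measurable height := by unfold height; fun_prop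
@[fun_prop] theorem measurable_area : Measurable area := by unfold area; fun_prop

theorem measurable_eccentricity (n : ℕ) : Measurable (eccentricity n) := by
  unfold eccentricity Real.logb
  fun_prop

@[fun_prop] theorem measurable_normalise : Measurable normalise := by
  rw [measurable_iff]
  unfold normalise
  fun_prop

theorem measurable_gridCell (a b i j : ℕ) : Measurable fun B : Box => B.gridCell a b i j := by
  rw [measurable_iff]
  simp only [gridCell]
  split_ifs <;> fun_prop

theorem measurable_rescale_prod : Measurable fun p : Box × (ℝ × ℝ) => p.1.rescale p.2 := by
  unfold rescale
  fun_prop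

theorem measurableSet_mem_toSet {α : Type*} [MeasurableSpace α] {F : α → Box} (hF : Measurable F) :
    MeasurableSet {p : α × (ℝ × ℝ) | p.2 ∈ (F p.1).toSet} := by
  have hb : ∀ {f : α × (ℝ × ℝ) → Bool}, Measurable f → MeasurableSet {p | f p = true} :=
    fun hf => hf (measurableSet_singleton true)
  simp only [toSet, Set.mem_prod, mem_interval]
  have hlow : ∀ {f g : α × (ℝ × ℝ) → ℝ} {c : α × (ℝ × ℝ) → Bool}, Measurable f → Measurable g →
      Measurable c → MeasurableSet {p | f p < g p ∨ g p = f p ∧ c p = true} := fun hf hg hc =>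
    (measurableSet_lt hf hg).union ((measurableSet_eq_fun hg hf).inter (hb hc))
  have hupp : ∀ {f g : α × (ℝ × ℝ) → ℝ} {c : α × (ℝ × ℝ) → Bool}, Measurable f → Measurable g →
      Measurable c → MeasurableSet {p | f p < g p ∨ f p = g p ∧ c p = true} := fun hf hg hc =>
    (measurableSet_lt hf hg).union ((measurableSet_eq_fun hf hg).inter (hb hc))
  exact ((hlow (by fun_prop) (by fun_prop) (by fun_prop)).inter
      (hupp (by fun_prop) (by fun_prop) (by fun_prop))).inter
    ((hlow (by fun_prop) (by fun_prop) (by fun_prop)).inter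
      (hupp (by fun_prop) (by fun_prop) (by fun_prop)))

/-- The kernel `(a, μ) ↦ μ`. -/
noncomputable def sndKernel (α : Type*) [MeasurableSpace α] :
    Kernel (α × ProbabilityMeasure (ℝ × ℝ)) (ℝ × ℝ) where
  toFun p := (p.2 : Measure (ℝ × ℝ))
  measurable' := measurable_subtype_coe.comp measurable_snd

instance (α : Type*) [MeasurableSpace α] : IsMarkovKernel (sndKernel α) :=
  ⟨fun p => inferInstanceAs (IsProbabilityMeasure (p.2 : Measure (ℝ × ℝ)))⟩

theorem measurable_measure_section {α : Type*} [MeasurableSpace α] {s : Set (α × (ℝ × ℝ))}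
    (hs : MeasurableSet s) : Measurable fun p : α × ProbabilityMeasure (ℝ × ℝ) =>
      (p.2 : Measure (ℝ × ℝ)) (Prod.mk p.1 ⁻¹' s) := by
  have h1 : MeasurableSet {q : (α × ProbabilityMeasure (ℝ × ℝ)) × (ℝ × ℝ) | (q.1.1, q.2) ∈ s} :=
    (by fun_prop : Measurable fun q : (α × ProbabilityMeasure (ℝ × ℝ)) × (ℝ × ℝ) =>
      (q.1.1, q.2)) hs
  exact Kernel.measurable_kernel_prodMk_left (κ := sndKernel α) h1

theorem measurable_measure_toSet {α : Type*} [MeasurableSpace α] {F : α → Box}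
    (hF : Measurable F) : Measurable fun p : α × ProbabilityMeasure (ℝ × ℝ) =>
      (p.2 : Measure (ℝ × ℝ)) (F p.1).toSet :=
  measurable_measure_section (measurableSet_mem_toSet hF)

theorem measurable_blowUp :
    Measurable fun p : Box × ProbabilityMeasure (ℝ × ℝ) => p.1.blowUp p.2 := by
  refine Measurable.subtype_mk (p := IsProbabilityMeasure)
    (f := fun p : Box × ProbabilityMeasure (ℝ × ℝ) =>
      ((p.1.blowUp p.2 : ProbabilityMeasure (ℝ × ℝ)) : Measure (ℝ × ℝ))) ?_
  refine Measure.measurable_of_measurable_coe _ fun D hD => ?_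
  have h1 := measurable_measure_toSet (measurable_id (α := Box))
  have h2 : Measurable fun p : Box × ProbabilityMeasure (ℝ × ℝ) =>
      (p.2 : Measure (ℝ × ℝ)) (p.1.toSet ∩ p.1.rescale ⁻¹' D) :=
    measurable_measure_section
      ((measurableSet_mem_toSet (measurable_id (α := Box))).inter (measurable_rescale_prod hD))
  have h3 : Measurable fun p : Box × ProbabilityMeasure (ℝ × ℝ) => (p.2 : Measure (ℝ × ℝ)) D :=
    (Measure.measurable_coe hD).comp (measurable_subtype_coe.comp measurable_snd)
  classical
  have h4 : (fun p : Box × ProbabilityMeasure (ℝ × ℝ) =>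
      ((p.1.blowUp p.2 : ProbabilityMeasure (ℝ × ℝ)) : Measure (ℝ × ℝ)) D) = fun p =>
      if (p.2 : Measure (ℝ × ℝ)) p.1.toSet = 0 then (p.2 : Measure (ℝ × ℝ)) D else
        ((p.2 : Measure (ℝ × ℝ)) p.1.toSet)⁻¹ *
          (p.2 : Measure (ℝ × ℝ)) (p.1.toSet ∩ p.1.rescale ⁻¹' D) := by
    ext p
    split_ifs with h
    · have h5 : p.1.blowUp p.2 = p.2 := dif_neg (not_not.2 h)
      rw [h5]
    · rw [coe_blowUp h, Measure.map_apply p.1.measurable_rescale hD,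
        cond_apply p.1.measurableSet_toSet]
  rw [h4]
  exact Measurable.ite (h1 (measurableSet_singleton 0)) h3 (h1.inv.mul h2)

theorem normalise_eq_homothety (B : Box) :
    B.normalise = B.homothety (√B.area)⁻¹ (-(√B.area)⁻¹ * B.left, -(√B.area)⁻¹ * B.bottom) := by
  simp only [normalise, homothety, mk.injEq, width, height]
  refine ⟨?_, ?_, ?_, ?_, ?_⟩ <;> first | ring | trivial

theorem normalise_mem_approxSquares {n : ℕ} {B : Box} (hB : B ∈ approxSquares n) :
    B.normalise ∈ approxSquares n := by
  obtain ⟨hw, hh, he⟩ := hB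
  have hr : 0 < (√B.area)⁻¹ := inv_pos.2 (Real.sqrt_pos.2 (mul_pos hw hh))
  rw [normalise_eq_homothety]
  refine ⟨?_, ?_, ?_⟩
  · rw [width_homothety]; positivity
  · rw [height_homothety]; positivity
  · rwa [eccentricity_homothety n hr]

theorem rescale_mem_normalise {B : Box} (hw : 0 < B.width) (hh : 0 < B.height) {z : ℝ × ℝ}
    (hz : z ∈ B.toSet) : B.rescale z ∈ B.normalise.toSet := by
  have hr : 0 < √B.area := Real.sqrt_pos.2 (mul_pos hw hh)
  obtain ⟨h1, h2⟩ := hz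
  rw [mem_interval] at h1 h2
  refine ⟨?_, ?_⟩ <;> rw [mem_interval] <;> simp only [normalise, rescale, width, height]
  · rw [div_lt_div_iff_of_pos_right hr, div_left_inj' hr.ne', div_pos_iff_of_pos_right hr,
      div_eq_zero_iff, sub_eq_zero, sub_pos, sub_lt_sub_iff_right, sub_left_inj]
    simpa [hr.ne'] using h1
  · rw [div_lt_div_iff_of_pos_right hr, div_left_inj' hr.ne', div_pos_iff_of_pos_right hr,
      div_eq_zero_iff, sub_eq_zero, sub_pos, sub_lt_sub_iff_right, sub_left_inj]
    simpa [hr.ne'] using h2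

theorem blowUp_normalise {B : Box} (hw : 0 < B.width) (hh : 0 < B.height)
    {μ : ProbabilityMeasure (ℝ × ℝ)} (h : (μ : Measure (ℝ × ℝ)) B.toSet ≠ 0) :
    ((B.blowUp μ : ProbabilityMeasure (ℝ × ℝ)) : Measure (ℝ × ℝ)) B.normalise.toSet = 1 := by
  have hsub : B.toSet ⊆ B.rescale ⁻¹' B.normalise.toSet := fun z hz =>
    rescale_mem_normalise hw hh hz
  rw [coe_blowUp h, Measure.map_apply B.measurable_rescale B.normalise.measurableSet_toSet,
    cond_apply B.measurableSet_toSet, inter_eq_left.2 hsub,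
    ENNReal.inv_mul_cancel h (measure_ne_top _ _)]

end Box

/-! ### The transition kernel -/

theorem unitBox_mem_approxSquares (n : ℕ) : unitBox ∈ approxSquares n := by
  simp [approxSquares, unitBox, Box.width, Box.height, Box.eccentricity]

theorem normalise_unitBox : unitBox.normalise = unitBox := by
  simp [unitBox, Box.normalise, Box.width, Box.height, Box.area]

/-- The set of pairs underlying `CPState (approxSquares n)`. -/
def stateSet (n : ℕ) : Set (Box × ProbabilityMeasure (ℝ × ℝ)) :=
  {s | s.1 ∈ approxSquares n ∧ (s.2 : Measure (ℝ × ℝ)) s.1.normalise.toSet = 1}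

theorem measurableSet_approxSquares (n : ℕ) : MeasurableSet (approxSquares n) :=
  (measurableSet_lt measurable_const Box.measurable_width).inter
    ((measurableSet_lt measurable_const Box.measurable_height).inter
      (Box.measurable_eccentricity n measurableSet_Ico))

theorem measurableSet_stateSet (n : ℕ) : MeasurableSet (stateSet n) :=
  (measurable_fst (measurableSet_approxSquares n)).inter
    (Box.measurable_measure_toSet Box.measurable_normalise (measurableSet_singleton 1))

open Classical in
/-- The state given by a box and a measure; a fixed state if the measure does not live on the
normalised box. -/
noncomputable def toState (n : ℕ) (s : Box × ProbabilityMeasure (ℝ × ℝ)) :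
    CPState (approxSquares n) :=
  if h : s ∈ stateSet n then ⟨s, h⟩
  else ⟨(unitBox, ⟨Measure.dirac 0, inferInstance⟩), unitBox_mem_approxSquares n, by
    rw [normalise_unitBox]
    have : (0 : ℝ × ℝ) ∈ unitBox.toSet := by simp [unitBox, Box.toSet, Box.mem_interval]
    simp [this]⟩

theorem val_toState {n : ℕ} {s : Box × ProbabilityMeasure (ℝ × ℝ)} (h : s ∈ stateSet n) :
    (toState n s).val = s := congrArg Subtype.val (dif_pos h)

theorem measurable_val (n : ℕ) :
    Measurable (fun s : CPState (approxSquares n) => s.val) := measurable_subtype_coe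

theorem measurable_toState (n : ℕ) : Measurable (toState n) := by
  have h : Measurable fun s => (toState n s).val := by
    classical
    have h1 : (fun s => (toState n s).val) = fun s => if s ∈ stateSet n then s else
        (unitBox, ⟨Measure.dirac 0, inferInstance⟩) := by
      ext s : 1
      split_ifs with h
      · exact val_toState h
      · exact congrArg Subtype.val (dif_neg h)
    rw [h1]
    exact Measurable.ite (measurableSet_stateSet n) measurable_id measurable_const
  exact Measurable.subtype_mk (h := fun s => (toState n s).2) h

section Kernel

/-- The transition law for the subdivision of the normalised box into `a` columns and `b` rows. -/
noncomputable def gridLaw (a b : ℕ) (s : Box × ProbabilityMeasure (ℝ × ℝ)) :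
    Measure (Box × ProbabilityMeasure (ℝ × ℝ)) :=
  ∑ i ∈ Finset.range a, ∑ j ∈ Finset.range b,
    (s.2 : Measure (ℝ × ℝ)) (s.1.normalise.gridCell a b i j).toSet •
      Measure.dirac (s.1.normalise.gridCell a b i j,
        (s.1.normalise.gridCell a b i j).blowUp s.2)

theorem measurable_gridLaw (a b : ℕ) : Measurable (gridLaw a b) := by
  unfold gridLaw
  refine Measure.measurable_of_measurable_coe _ fun D hD => ?_
  simp only [Measure.finsetSum_apply, Measure.smul_apply, smul_eq_mul]
  refine Finset.measurable_sum _ fun i _ => Finset.measurable_sum _ fun j _ => ?_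
  have h1 : Measurable fun s : Box × ProbabilityMeasure (ℝ × ℝ) =>
      s.1.normalise.gridCell a b i j :=
    (Box.measurable_gridCell a b i j).comp (Box.measurable_normalise.comp measurable_fst)
  refine (Box.measurable_measure_toSet ((Box.measurable_gridCell a b i j).comp
    Box.measurable_normalise)).mul ?_
  exact (Measure.measurable_coe hD).comp (Measure.measurable_dirac.comp
    (h1.prodMk (Box.measurable_blowUp.comp (h1.prodMk measurable_snd))))

theorem countable_approxSquareOperator (m n : ℕ) (B : Box) : Countable (approxSquareOperator m n B) := by
  rw [approxSquareOperator_eq]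
  refine Set.Countable.to_subtype (Set.Countable.mono (s₂ := range fun p : ℕ × ℕ =>
    B.gridCell m (rowCount m n B) p.1 p.2) ?_ (countable_range _))
  rintro _ ⟨i, -, j, -, rfl⟩
  exact ⟨(i, j), rfl⟩

variable {m n : ℕ} (hm : 2 ≤ m) (hmn : m < n)
include hm hmn

theorem furstenbergLaw_eq_gridLaw {s : Box × ProbabilityMeasure (ℝ × ℝ)}
    (hs : s.1 ∈ approxSquares n) :
    furstenbergLaw (approxSquareOperator m n) s =
      gridLaw m (rowCount m n s.1.normalise) s := by
  obtain ⟨hw, hh, -⟩ := Box.normalise_mem_approxSquares hs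
  set B := s.1.normalise with hB
  set b := rowCount m n B with hb
  have hb0 : 0 < b := rowCount_pos hm hmn B
  have hm0 : (0 : ℝ) < m := by exact_mod_cast (by omega : 0 < m)
  have hb0' : (0 : ℝ) < b := by exact_mod_cast hb0
  let e : Fin m × Fin b ≃ approxSquareOperator m n B := by
    refine Equiv.ofBijective (fun p => ⟨B.gridCell m b p.1 p.2, ?_⟩) ⟨fun p q hpq => ?_, ?_⟩
    · rw [approxSquareOperator_eq]
      exact ⟨p.1, p.1.2, p.2, p.2.2, rfl⟩
    · obtain ⟨z, hz⟩ := Box.toSet_nonempty (B := B.gridCell m b p.1 p.2)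
        (by rw [Box.width_gridCell]; positivity) (by rw [Box.height_gridCell]; positivity)
      have hz' : z ∈ (B.gridCell m b q.1 q.2).toSet := by
        have hpq' : B.gridCell m b p.1 p.2 = B.gridCell m b q.1 q.2 := congrArg Subtype.val hpq
        rw [← hpq']; exact hz
      obtain ⟨h1, h2⟩ := Box.eq_of_mem_gridCell hw hh p.1.2 p.2.2 q.1.2 q.2.2 hz hz'
      exact Prod.ext (Fin.ext h1) (Fin.ext h2)
    · rintro ⟨A, hA⟩
      rw [approxSquareOperator_eq] at hA
      obtain ⟨i, hi, j, hj, rfl⟩ := hA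
      exact ⟨(⟨i, hi⟩, ⟨j, hj⟩), rfl⟩
  ext D hD
  rw [furstenbergLaw, Measure.sum_apply _ hD, gridLaw]
  rw [← e.tsum_eq, tsum_fintype, Fintype.sum_prod_type]
  simp only [Measure.finsetSum_apply]
  rw [← Fin.sum_univ_eq_sum_range (fun i => ∑ j ∈ Finset.range b,
    ((s.2 : Measure (ℝ × ℝ)) (B.gridCell m b i j).toSet •
      Measure.dirac (B.gridCell m b i j, (B.gridCell m b i j).blowUp s.2)) D)]
  refine Finset.sum_congr rfl fun i _ => ?_
  rw [← Fin.sum_univ_eq_sum_range (fun j =>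
    ((s.2 : Measure (ℝ × ℝ)) (B.gridCell m b i j).toSet •
      Measure.dirac (B.gridCell m b i j, (B.gridCell m b i j).blowUp s.2)) D)]
  rfl

theorem furstenbergLaw_univ {s : Box × ProbabilityMeasure (ℝ × ℝ)} (hs : s ∈ stateSet n) :
    furstenbergLaw (approxSquareOperator m n) s univ = 1 := by
  have hB := Box.normalise_mem_approxSquares hs.1
  have hop := isPartitionOperator_approxSquareOperator hm hmn
  have := countable_approxSquareOperator m n s.1.normalise
  rw [furstenbergLaw, Measure.sum_apply _ .univ]
  simp only [Measure.smul_apply, measure_univ, smul_eq_mul, mul_one]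
  rw [← measure_biUnion (s := approxSquareOperator m n s.1.normalise) (f := Box.toSet)
    (Set.countable_coe_iff.1 this) (hop.pairwiseDisjoint _ hB) fun A _ => A.measurableSet_toSet,
    hop.iUnion_eq _ hB, hs.2]

theorem ae_furstenbergLaw_mem_stateSet {s : Box × ProbabilityMeasure (ℝ × ℝ)}
    (hs : s ∈ stateSet n) :
    ∀ᵐ s' ∂furstenbergLaw (approxSquareOperator m n) s, s' ∈ stateSet n := by
  have hB := Box.normalise_mem_approxSquares hs.1
  have hop := isPartitionOperator_approxSquareOperator hm hmn
  have := countable_approxSquareOperator m n s.1.normalise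
  rw [furstenbergLaw, Measure.ae_sum_iff' (p := fun s' => s' ∈ stateSet n) (measurableSet_stateSet n)]
  intro A
  rw [ae_iff, Measure.smul_apply, smul_eq_mul, mul_eq_zero]
  by_cases h0 : (s.2 : Measure (ℝ × ℝ)) A.1.toSet = 0
  · exact .inl h0
  · right
    have hA := hop.subset _ hB A.2
    change Measure.dirac _ (stateSet n)ᶜ = 0
    rw [Measure.dirac_apply' _ (measurableSet_stateSet n).compl]
    refine indicator_of_notMem ?_ _
    exact fun h => h ⟨hA, Box.blowUp_normalise hA.1 hA.2.1 h0⟩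

/-- The Furstenberg kernel on the state space. -/
theorem exists_furstenbergKernel :
    ∃ κ : Kernel (CPState (approxSquares n)) (CPState (approxSquares n)), IsMarkovKernel κ ∧
      (∀ s, (κ s).map Subtype.val = furstenbergLaw (approxSquareOperator m n) s.1) ∧
      ∀ s, κ s = (furstenbergLaw (approxSquareOperator m n) s.1).map (toState n) := by
  have hmeas : Measurable fun s : CPState (approxSquares n) =>
      furstenbergLaw (approxSquareOperator m n) s.1 := by
    have h1 : (fun s : CPState (approxSquares n) =>
        furstenbergLaw (approxSquareOperator m n) s.1) = fun s =>
        open Classical in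
        if 1 - rotationAngle m n ≤ s.1.1.normalise.eccentricity n then gridLaw m n s.1
        else gridLaw m 1 s.1 := by
      ext s : 1
      rw [furstenbergLaw_eq_gridLaw hm hmn s.2.1, rowCount]
      split_ifs <;> rfl
    rw [h1]
    refine Measurable.ite (measurableSet_le measurable_const ?_)
      ((measurable_gridLaw _ _).comp (measurable_val n))
      ((measurable_gridLaw _ _).comp (measurable_val n))
    exact (Box.measurable_eccentricity n).comp (Box.measurable_normalise.comp
      (measurable_fst.comp (measurable_val n)))
  have hcoe : ∀ s : CPState (approxSquares n),
      IsProbabilityMeasure (furstenbergLaw (approxSquareOperator m n) s.1) := fun s =>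
    ⟨furstenbergLaw_univ hm hmn s.2⟩
  refine ⟨⟨fun s => (furstenbergLaw (approxSquareOperator m n) s.1).map (toState n),
    (Measure.measurable_map _ (measurable_toState n)).comp hmeas⟩, ⟨fun s => ?_⟩, fun s => ?_,
    fun s => rfl⟩
  · have := hcoe s
    exact Measure.isProbabilityMeasure_map (measurable_toState n).aemeasurable
  · change ((furstenbergLaw (approxSquareOperator m n) s.1).map (toState n)).map
      (fun s : CPState (approxSquares n) => s.val) = _
    rw [Measure.map_map (measurable_val n) (measurable_toState n)]
    conv_rhs => rw [← Measure.map_id (μ := furstenbergLaw (approxSquareOperator m n) s.1)]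
    refine Measure.map_congr ?_
    filter_upwards [ae_furstenbergLaw_mem_stateSet hm hmn s.2] with s' hs'
    exact val_toState hs'

end Kernel

/-! ### The states of the chain -/

namespace Box

variable {m n : ℕ}

theorem digitCell_mem_approxSquareOperator (hm : 0 < m) (hn : 0 < n) (B : Box) (a : ℕ → Fin m)
    (c : ℕ → Fin n) (k l : ℕ) :
    B.digitCell a c (k + 1) (l + carry m n ((B.digitCell a c k l).eccentricity n)) ∈
      approxSquareOperator m n (B.digitCell a c k l) := by
  unfold carry approxSquareOperator
  split_ifs with h
  · exact ⟨a k, (a k).2, c l, (c l).2, digitCell_succ_succ hm hn B a c k l⟩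
  · exact ⟨a k, (a k).2, digitCell_succ hm B a c k l⟩

theorem eccentricity_of_mem_approxSquareOperator (hm : 2 ≤ m) (hmn : m < n) {A B : Box}
    (hB : B ∈ approxSquares n) (hA : A ∈ approxSquareOperator m n B) :
    A.eccentricity n = angleRotation m n (B.eccentricity n) := by
  rw [approxSquareOperator_eq] at hA
  obtain ⟨i, -, j, -, rfl⟩ := hA
  exact eccentricity_gridCell hm hmn hB i j

theorem digitCell_congr (B : Box) {a a' : ℕ → Fin m} {c c' : ℕ → Fin n} {k l : ℕ}
    (ha : ∀ s < k, a s = a' s) (hc : ∀ s < l, c s = c' s) :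
    B.digitCell a c k l = B.digitCell a' c' k l := by
  have h1 : (∀ s < k, (a s : ℕ) + 1 = m) ↔ ∀ s < k, (a' s : ℕ) + 1 = m :=
    forall₂_congr fun s hs => by rw [ha s hs]
  have h2 : (∀ s < l, (c s : ℕ) + 1 = n) ↔ ∀ s < l, (c' s : ℕ) + 1 = n :=
    forall₂_congr fun s hs => by rw [hc s hs]
  simp only [digitCell, prefixValue_congr ha, prefixValue_congr hc, h1, h2]

theorem measurableSet_singleton (B : Box) : MeasurableSet {B} := by
  refine ⟨{((B.left, B.right, B.bottom, B.top),
    (B.leftClosed, B.rightClosed, B.bottomClosed, B.topClosed))},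
    MeasurableSet.singleton _, ?_⟩
  ext A
  cases A
  cases B
  simp only [mem_preimage, mem_singleton_iff, Prod.mk.injEq, mk.injEq]
  tauto

theorem measurable_prefixValue (k : ℕ) : Measurable fun a : ℕ → Fin m => prefixValue a k := by
  refine Finset.measurable_sum _ fun i _ => ?_
  have h : Measurable fun x : Fin m => (x : ℝ) := measurable_of_countable _
  exact (h.comp (measurable_pi_apply i)).mul_const _

theorem measurable_decide_last (k : ℕ) :
    Measurable fun a : ℕ → Fin m => decide (∀ s < k, (a s : ℕ) + 1 = m) := by
  refine measurable_to_bool ?_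
  have h : (fun a : ℕ → Fin m => decide (∀ s < k, (a s : ℕ) + 1 = m)) ⁻¹' {true} =
      ⋂ s, ⋂ (_ : s < k), (fun a : ℕ → Fin m => a s) ⁻¹' {x | (x : ℕ) + 1 = m} := by
    ext; simp
  rw [h]
  exact MeasurableSet.iInter fun s => MeasurableSet.iInter fun _ =>
    measurable_pi_apply s MeasurableSet.of_discrete

theorem measurable_digitCell_normalised (rc tc : Bool) (k : ℕ) : Measurable
    fun p : (ℝ × ((ℕ → Fin m) × (ℕ → Fin n))) × ℕ =>
      (normalised n p.1.1 rc tc).digitCell p.1.2.1 p.1.2.2 k p.2 := by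
  refine measurable_from_prod_countable_left fun l => ?_
  have h1 := measurable_prefixValue (m := m) k
  have h2 := measurable_prefixValue (m := n) l
  have h3 := measurable_decide_last (m := m) k
  have h4 := measurable_decide_last (m := n) l
  have hand : Measurable fun p : Bool × Bool => (p.1 && p.2) := measurable_of_countable _
  rw [measurable_iff]
  simp only [digitCell, normalised, width, height]
  have h5 : Measurable fun p : ℝ × ((ℕ → Fin m) × (ℕ → Fin n)) => prefixValue p.2.1 k :=
    h1.comp (by fun_prop)
  have h6 : Measurable fun p : ℝ × ((ℕ → Fin m) × (ℕ → Fin n)) => prefixValue p.2.2 l :=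
    h2.comp (by fun_prop)
  have h7 : Measurable fun p : ℝ × ((ℕ → Fin m) × (ℕ → Fin n)) =>
      (rc && decide (∀ s < k, (p.2.1 s : ℕ) + 1 = m)) :=
    hand.comp (measurable_const.prodMk (h3.comp (by fun_prop)))
  have h8 : Measurable fun p : ℝ × ((ℕ → Fin m) × (ℕ → Fin n)) =>
      (tc && decide (∀ s < l, (p.2.2 s : ℕ) + 1 = n)) :=
    hand.comp (measurable_const.prodMk (h4.comp (by fun_prop)))
  exact Measurable.prodMk (by fun_prop) (measurable_const.prodMk (h7.prodMk
    (measurable_const.prodMk h8)))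

end Box

section States

variable {m n : ℕ} (ρ : Measure (Fin m)) (r : Measure (Fin m → Fin n)) [IsProbabilityMeasure ρ]
  [IsProbabilityMeasure r]

/-- The normalised box of eccentricity `t` that contains exactly those of its sides that are
inherited, almost surely, by the boxes along a path of the chain. -/
noncomputable def chainBox (t : ℝ) : Box :=
  Box.normalised n t (lastFlag ρ) (lastFlag (rowLaw ρ r))

/-- The cell of the subdivision of the normalised box that is chosen by the seed. -/
noncomputable def childBox (ω : Seed m n) : Box :=
  (chainBox ρ r ω.1).digitCell ω.2.2.1 (select ω.2.2.2 ω.2.1) 1 (carry m n ω.1)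

/-- The box and the measure of the state of the chain given by the seed. -/
noncomputable def rawState (ω : Seed m n) : Box × ProbabilityMeasure (ℝ × ℝ) :=
  (childBox ρ r ω, limitLaw ρ r (angleRotation m n ω.1) (shift^[carry m n ω.1] ω.2.1))

/-- The state of the chain given by the seed. -/
noncomputable def seedState (ω : Seed m n) : CPState (approxSquares n) := toState n (rawState ρ r ω)

omit [IsProbabilityMeasure ρ] [IsProbabilityMeasure r] in
theorem measurable_childBox : Measurable (childBox ρ r : Seed m n → Box) := by
  have h1 : Measurable fun ω : Seed m n => select ω.2.2.2 ω.2.1 :=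
    measurable_select.comp
      (by fun_prop : Measurable fun ω : Seed m n => (ω.2.2.2, ω.2.1))
  have h2 : Measurable fun ω : Seed m n =>
      ((ω.1, (ω.2.2.1, select ω.2.2.2 ω.2.1)), carry m n ω.1) :=
    (measurable_fst.prodMk (measurable_snd.snd.fst.prodMk h1)).prodMk
      (measurable_carry.comp measurable_fst)
  have h3 := Box.measurable_digitCell_normalised (m := m) (n := n) (lastFlag ρ)
    (lastFlag (rowLaw ρ r)) 1
  have h4 := h3.comp h2
  unfold childBox chainBox
  exact h4

theorem measurable_rawState :
    Measurable (rawState ρ r : Seed m n → Box × ProbabilityMeasure (ℝ × ℝ)) :=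
  (measurable_childBox ρ r).prodMk ((measurable_limitLaw ρ r).comp
    (measurable_skewMap.fst.prodMk measurable_skewMap.snd.fst))

theorem measurable_seedState : Measurable (seedState ρ r : Seed m n → CPState (approxSquares n)) :=
  (measurable_toState n).comp (measurable_rawState ρ r)

/-- The digits `z` are typical, given the digits `u` of the fibre. -/
def IsTypical (u : ℕ → Fin m) (z : (ℕ → Fin m) × (ℕ → Fin m → Fin n)) : Prop :=
  (Admissible (lastFlag ρ) z.1 ∧ (lastFlag ρ = true → ∀ k, (z.1 k : ℕ) + 1 = m)) ∧
    Admissible (lastFlag (rowLaw ρ r)) (select z.2 u) ∧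
      (lastFlag (rowLaw ρ r) = true → ∀ k, ((select z.2 u k : Fin n) : ℕ) + 1 = n)

theorem ae_ae_isTypical :
    ∀ᵐ u ∂iidLaw ρ, ∀ᵐ z ∂(iidLaw ρ).prod (iidLaw r), IsTypical ρ r u z := by
  filter_upwards [Measure.ae_ae_of_ae_prod (ae_admissible_select ρ r)] with u hu
  have h1 := Measure.quasiMeasurePreserving_fst (μ := iidLaw ρ) (ν := iidLaw r) |>.ae
    (ae_admissible ρ)
  have h2 := Measure.quasiMeasurePreserving_snd (μ := iidLaw ρ) (ν := iidLaw r) |>.ae hu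
  filter_upwards [h1, h2] with z hz1 hz2
  exact ⟨hz1, hz2⟩

variable (hm : 2 ≤ m) (hmn : m < n)
include hm hmn

omit [IsProbabilityMeasure ρ] [IsProbabilityMeasure r] in
theorem chainBox_mem {t : ℝ} (ht : t ∈ Ico (0 : ℝ) 1) :
    (chainBox ρ r t : Box) ∈ approxSquares n :=
  Box.normalised_mem_approxSquares (by omega) ht _ _

omit [IsProbabilityMeasure ρ] [IsProbabilityMeasure r] in
theorem childBox_mem (ω : Seed m n) :
    childBox ρ r ω ∈ approxSquareOperator m n (chainBox ρ r ω.1) := by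
  have h := Box.digitCell_mem_approxSquareOperator (by omega) (by omega) (chainBox ρ r ω.1) ω.2.2.1
    (select ω.2.2.2 ω.2.1) 0 0
  rw [Box.digitCell_zero rfl rfl, chainBox, Box.eccentricity_normalised (by omega), zero_add,
    zero_add] at h
  exact h

omit [IsProbabilityMeasure ρ] [IsProbabilityMeasure r] in
theorem eccentricity_childBox {ω : Seed m n} (ht : ω.1 ∈ Ico (0 : ℝ) 1) :
    (childBox ρ r ω).eccentricity n = angleRotation m n ω.1 := by
  rw [Box.eccentricity_of_mem_approxSquareOperator hm hmn (chainBox_mem ρ r hm hmn ht)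
    (childBox_mem ρ r hm hmn ω), chainBox, Box.eccentricity_normalised (by omega)]

omit [IsProbabilityMeasure ρ] [IsProbabilityMeasure r] in
theorem childBox_mem_approxSquares {ω : Seed m n} (ht : ω.1 ∈ Ico (0 : ℝ) 1) :
    childBox ρ r ω ∈ approxSquares n :=
  (isPartitionOperator_approxSquareOperator hm hmn).subset _ (chainBox_mem ρ r hm hmn ht)
    (childBox_mem ρ r hm hmn ω)

omit [IsProbabilityMeasure ρ] [IsProbabilityMeasure r] in
theorem normalise_childBox {ω : Seed m n} (ht : ω.1 ∈ Ico (0 : ℝ) 1)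
    (hω : IsTypical ρ r ω.2.1 ω.2.2) :
    (childBox ρ r ω).normalise = chainBox ρ r (angleRotation m n ω.1) := by
  rw [Box.normalise_eq_normalised (by omega) (childBox_mem_approxSquares ρ r hm hmn ht) rfl rfl,
    eccentricity_childBox ρ r hm hmn ht, chainBox]
  have h1 : (childBox ρ r ω).rightClosed = lastFlag ρ := by
    change (lastFlag ρ && decide _) = _
    cases h : lastFlag ρ
    · rfl
    · simp [hω.1.2 h]
  have h2 : (childBox ρ r ω).topClosed = lastFlag (rowLaw ρ r) := by
    change (lastFlag (rowLaw ρ r) && decide _) = _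
    cases h : lastFlag (rowLaw ρ r)
    · rfl
    · simp [hω.2.2 h]
  rw [h1, h2]

omit [IsProbabilityMeasure ρ] [IsProbabilityMeasure r] in
theorem exists_childBox_eq (t : ℝ) (u : ℕ → Fin m) {A : Box}
    (hA : A ∈ approxSquareOperator m n (chainBox ρ r t)) :
    ∃ z, childBox ρ r (t, u, z) = A := by
  have he : (chainBox ρ r t : Box).eccentricity n = t :=
    Box.eccentricity_normalised (by omega) _ _ _
  unfold approxSquareOperator at hA
  rw [he] at hA
  split_ifs at hA with h
  · obtain ⟨i, hi, j, hj, rfl⟩ := hA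
    refine ⟨(fun _ => ⟨i, hi⟩, fun _ _ => ⟨j, hj⟩), ?_⟩
    simp only [childBox, carry, if_pos h]
    rw [← zero_add 1, Box.digitCell_succ_succ (by omega) (by omega), Box.digitCell_zero rfl rfl]
    rfl
  · obtain ⟨i, hi, rfl⟩ := hA
    refine ⟨(fun _ => ⟨i, hi⟩, fun _ _ => ⟨0, by omega⟩), ?_⟩
    simp only [childBox, carry, if_neg h]
    rw [← zero_add 1, Box.digitCell_succ (by omega), Box.digitCell_zero rfl rfl]

omit hm hmn in
theorem coe_limitLaw_eq_map_digitPoint (t : ℝ) (u : ℕ → Fin m) :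
    (limitLaw ρ r t u : Measure (ℝ × ℝ)) = ((iidLaw ρ).prod (iidLaw r)).map
      fun z => (chainBox ρ r t).digitPoint (z.1, select z.2 u) := by
  simp only [chainBox, Box.digitPoint_normalised]
  rfl

omit hm hmn in
theorem measurable_fst_select (u : ℕ → Fin m) :
    Measurable fun z : (ℕ → Fin m) × (ℕ → Fin m → Fin n) => (z.1, select z.2 u) :=
  measurable_fst.prodMk (measurable_select.comp (measurable_snd.prodMk measurable_const))

theorem limitLaw_chainBox {t : ℝ} {u : ℕ → Fin m}
    (hu : ∀ᵐ z ∂(iidLaw ρ).prod (iidLaw r), IsTypical ρ r u z) :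
    (limitLaw ρ r t u : Measure (ℝ × ℝ)) (chainBox ρ r t : Box).toSet = 1 := by
  have h := Box.measure_digitCell (B := chainBox ρ r t) (measurable_fst_select u)
    (Box.width_normalised_pos (by omega) _ _ _)
    (Box.height_normalised_pos (by omega) _ _ _) (by omega) (by omega)
    (hu.mono fun z hz => ⟨hz.1.1, hz.2.1⟩) (coe_limitLaw_eq_map_digitPoint ρ r t u)
    (fun _ => ⟨0, by omega⟩) (fun _ => ⟨0, by omega⟩) 0 0
  rw [Box.digitCell_zero rfl rfl] at h
  simpa using h

theorem rawState_mem_stateSet {ω : Seed m n} (ht : ω.1 ∈ Ico (0 : ℝ) 1)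
    (hω : IsTypical ρ r ω.2.1 ω.2.2)
    (hu : ∀ᵐ z ∂(iidLaw ρ).prod (iidLaw r), IsTypical ρ r (shift^[carry m n ω.1] ω.2.1) z) :
    rawState ρ r ω ∈ stateSet n := by
  refine ⟨childBox_mem_approxSquares ρ r hm hmn ht, ?_⟩
  change (limitLaw ρ r _ _ : Measure (ℝ × ℝ)) (childBox ρ r ω).normalise.toSet = 1
  rw [normalise_childBox ρ r hm hmn ht hω]
  exact limitLaw_chainBox ρ r hm hmn hu

/-- Prescribing the first digits of a random point, the remaining digits keep their law. -/
theorem blowUp_childBox {t : ℝ} (ht : t ∈ Ico (0 : ℝ) 1) {u : ℕ → Fin m}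
    (hu : ∀ᵐ z ∂(iidLaw ρ).prod (iidLaw r), IsTypical ρ r u z)
    (z₀ : (ℕ → Fin m) × (ℕ → Fin m → Fin n)) :
    (limitLaw ρ r t u : Measure (ℝ × ℝ)) (childBox ρ r (t, u, z₀)).toSet =
        (iidLaw ρ).prod (iidLaw r) {z | childBox ρ r (t, u, z) = childBox ρ r (t, u, z₀)} ∧
      ((limitLaw ρ r t u : Measure (ℝ × ℝ)) (childBox ρ r (t, u, z₀)).toSet ≠ 0 →
        (childBox ρ r (t, u, z₀)).blowUp (limitLaw ρ r t u) =
          limitLaw ρ r (angleRotation m n t) (shift^[carry m n t] u)) := by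
  set l := carry m n t with hl
  have hw : 0 < (chainBox ρ r t : Box).width := Box.width_normalised_pos (by omega) t _ _
  have hh : 0 < (chainBox ρ r t : Box).height := Box.height_normalised_pos (by omega) t _ _
  have hadm : ∀ᵐ z ∂(iidLaw ρ).prod (iidLaw r), Admissible (chainBox ρ r t).rightClosed z.1 ∧
      Admissible (chainBox ρ r t).topClosed (select z.2 u) := hu.mono fun z hz => ⟨hz.1.1, hz.2.1⟩
  set E := {z : (ℕ → Fin m) × (ℕ → Fin m → Fin n) | (∀ s < 1, z.1 s = z₀.1 s) ∧
    ∀ s < l, select z.2 u s = select z₀.2 u s} with hE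
  have hmeas : (limitLaw ρ r t u : Measure (ℝ × ℝ)) (childBox ρ r (t, u, z₀)).toSet =
      (iidLaw ρ).prod (iidLaw r) E :=
    Box.measure_digitCell (measurable_fst_select u) hw hh (by omega) (by omega) hadm
      (coe_limitLaw_eq_map_digitPoint ρ r t u) z₀.1 (select z₀.2 u) 1 l
  refine ⟨?_, fun h0 => ?_⟩
  · rw [hmeas]
    refine measure_congr ?_
    filter_upwards [hadm] with z hz
    have hiff := fun z₁ : (ℕ → Fin m) × (ℕ → Fin m → Fin n) =>
      Box.digitPoint_mem_digitCell_iff (z := (z.1, select z.2 u)) (by omega) (by omega) hw hh hz.1 hz.2 z₁.1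
      (select z₁.2 u) 1 l
    refine propext ⟨fun h => Box.digitCell_congr _ h.1 h.2, fun h => ?_⟩
    have h1 := (hiff z).2 ⟨fun _ _ => rfl, fun _ _ => rfl⟩
    have h2 : (chainBox ρ r t).digitCell z.1 (select z.2 u) 1 l =
      (chainBox ρ r t).digitCell z₀.1 (select z₀.2 u) 1 l := h
    rw [h2] at h1
    exact (hiff z₀).1 h1
  · rw [hmeas] at h0
    have hb := Box.blowUp_digitCell (measurable_fst_select u) hw hh (by omega) (by omega) hadm
      (coe_limitLaw_eq_map_digitPoint ρ r t u) z₀.1 (select z₀.2 u) 1 l h0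
    have hA := childBox_mem_approxSquares ρ r hm hmn (ω := (t, u, z₀)) ht
    obtain ⟨e1, e2⟩ := Box.width_div_sqrt_area (by omega) hA
    rw [eccentricity_childBox ρ r hm hmn (ω := (t, u, z₀)) ht] at e1 e2
    have e3 : (chainBox ρ r t).digitCell z₀.1 (select z₀.2 u) 1 l = childBox ρ r (t, u, z₀) := rfl
    rw [e3, e1, e2] at hb
    refine Subtype.ext ?_
    refine hb.trans ?_
    have hsplice := measurePreserving_splice_prod (measurePreserving_splice ρ 1)
      (measurePreserving_splice r l)
    have mE : MeasurableSet E := ((measurable_fst_select u).fst (measurableSet_prefix _ _)).inter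
      ((measurable_fst_select u).snd (measurableSet_prefix _ _))
    have mσ : Measurable fun z : (ℕ → Fin m) × (ℕ → Fin m → Fin n) =>
        (shift^[1] z.1, shift^[l] z.2) :=
      ((measurable_shift.iterate 1).comp measurable_fst).prodMk
        ((measurable_shift.iterate l).comp measurable_snd)
    have hcond := map_cond_of_splice hsplice (E := E) (by
      ext p
      simp only [hE, mem_preimage, mem_ofPred_eq, Set.mem_prod, mem_univ, and_true, select]
      refine and_congr (forall₂_congr fun s hs => by rw [splice_apply_of_lt hs])
        (forall₂_congr fun s hs => by rw [splice_apply_of_lt hs])) mE h0 mσ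
      (fun p => by simp only [shift_iterate_splice])
    change _ = (limitLaw ρ r (angleRotation m n t) (shift^[l] u) : Measure (ℝ × ℝ))
    rw [coe_limitLaw]
    conv_rhs => rw [← hcond, Measure.map_map (measurable_limitPoint_right _ _) mσ]
    congr 1
    ext z : 1
    simp only [shift_iterate_select]
    rfl

/-- The Furstenberg law of a state is the law of the next state. -/
theorem furstenbergLaw_eq_map_rawState {t : ℝ} (ht : t ∈ Ico (0 : ℝ) 1) {u : ℕ → Fin m}
    (hu : ∀ᵐ z ∂(iidLaw ρ).prod (iidLaw r), IsTypical ρ r u z) {A : Box}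
    (hA : A.normalise = chainBox ρ r t) :
    furstenbergLaw (approxSquareOperator m n) (A, limitLaw ρ r t u) =
      ((iidLaw ρ).prod (iidLaw r)).map fun z => rawState ρ r (t, u, z) := by
  set K := (iidLaw ρ).prod (iidLaw r) with hK
  have hraw : Measurable fun z : (ℕ → Fin m) × (ℕ → Fin m → Fin n) => rawState ρ r (t, u, z) :=
    (measurable_rawState ρ r).comp (measurable_prodMk_left.comp measurable_prodMk_left)
  have hcount := countable_approxSquareOperator m n A.normalise
  ext D hD
  rw [Measure.map_apply hraw hD, furstenbergLaw, Measure.sum_apply _ hD]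
  have hpart : (fun z => rawState ρ r (t, u, z)) ⁻¹' D =
      ⋃ A' : approxSquareOperator m n A.normalise, {z | childBox ρ r (t, u, z) = A'.1 ∧
        rawState ρ r (t, u, z) ∈ D} := by
    ext z
    simp only [mem_preimage, mem_iUnion, mem_ofPred_eq]
    refine ⟨fun h => ⟨⟨childBox ρ r (t, u, z), ?_⟩, rfl, h⟩, fun ⟨_, _, h⟩ => h⟩
    rw [hA]
    exact childBox_mem ρ r hm hmn (t, u, z)
  have hsing : ∀ A' : Box, MeasurableSet {z : (ℕ → Fin m) × (ℕ → Fin m → Fin n) |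
      childBox ρ r (t, u, z) = A'} := fun A' => hraw.fst (Box.measurableSet_singleton A')
  rw [hpart, measure_iUnion]
  · refine tsum_congr fun A' => ?_
    obtain ⟨z₀, hz₀⟩ := exists_childBox_eq ρ r hm hmn t u (by rw [← hA]; exact A'.2)
    obtain ⟨h1, h2⟩ := blowUp_childBox ρ r hm hmn ht hu z₀
    rw [hz₀] at h1 h2
    rw [Measure.smul_apply, smul_eq_mul, Measure.dirac_apply' _ hD]
    by_cases h0 : (limitLaw ρ r t u : Measure (ℝ × ℝ)) A'.1.toSet = 0
    · rw [h0, zero_mul]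
      rw [h0] at h1
      exact (measure_mono_null (fun z hz => hz.1) h1.symm).symm
    · have hval : ∀ z, childBox ρ r (t, u, z) = A'.1 → rawState ρ r (t, u, z) =
          (A'.1, A'.1.blowUp (limitLaw ρ r t u)) := fun z hz => by
        rw [h2 h0, ← hz]; rfl
      by_cases hmem : (A'.1, A'.1.blowUp (limitLaw ρ r t u)) ∈ D
      · rw [indicator_of_mem hmem, Pi.one_apply, mul_one, h1]
        congr 1
        ext z
        exact ⟨fun hz => ⟨hz, by rw [hval z hz]; exact hmem⟩, fun hz => hz.1⟩
      · rw [indicator_of_notMem hmem, mul_zero]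
        have : {z | childBox ρ r (t, u, z) = A'.1 ∧ rawState ρ r (t, u, z) ∈ D} = ∅ := by
          ext z
          simp only [mem_ofPred_eq, mem_empty_iff_false, iff_false, not_and]
          intro hz
          rw [hval z hz]
          exact hmem
        rw [this, measure_empty]
  · intro A₁ A₂ hne
    refine Set.disjoint_left.2 fun z h1 h2 => hne (Subtype.ext (h1.1.symm.trans h2.1))
  · exact fun A' => (hsing A'.1).inter (hraw hD)

end States

/-! ### The chain of approximate squares -/

section Chain

variable {m n : ℕ} (ρ : Measure (Fin m)) (r : Measure (Fin m → Fin n)) [IsProbabilityMeasure ρ]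
  [IsProbabilityMeasure r] (τ : Measure ℝ) [IsProbabilityMeasure τ]

/-- The path of states that is coded by a seed. -/
noncomputable def statePath (ω : Seed m n) : ℕ → CPState (approxSquares n) :=
  fun k => seedState ρ r ((skewMap m n)^[k] ω)

theorem measurable_seedState_iterate (k : ℕ) :
    Measurable fun ω : Seed m n => seedState ρ r ((skewMap m n)^[k] ω) :=
  (measurable_seedState ρ r).comp (measurable_skewMap.iterate k)

theorem measurable_statePath : Measurable (statePath ρ r : Seed m n → _) :=
  measurable_pi_lambda _ fun k => measurable_seedState_iterate ρ r k

/-- The law of the path of states. -/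
noncomputable def chainLaw : Measure (ℕ → CPState (approxSquares n)) :=
  (τ.prod (digitLaw ρ r)).map (statePath ρ r)

instance : IsProbabilityMeasure (chainLaw ρ r τ) :=
  Measure.isProbabilityMeasure_map (measurable_statePath ρ r).aemeasurable

theorem shift_statePath (ω : Seed m n) :
    shift (statePath ρ r ω) = statePath ρ r (skewMap m n ω) := by
  ext k
  simp only [shift, statePath, Function.iterate_succ_apply]

omit [IsProbabilityMeasure τ] in
theorem measurePreserving_statePath :
    MeasurePreserving (statePath ρ r) (τ.prod (digitLaw ρ r)) (chainLaw ρ r τ) :=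
  ⟨measurable_statePath ρ r, rfl⟩

variable {τ}

theorem measurePreserving_shift_chainLaw (hτ : MeasurePreserving (angleRotation m n) τ τ) :
    MeasurePreserving shift (chainLaw ρ r τ) (chainLaw ρ r τ) := by
  refine ⟨measurable_shift, ?_⟩
  have h1 : shift ∘ statePath ρ r = statePath ρ r ∘ skewMap m n :=
    funext fun ω => shift_statePath ρ r ω
  rw [chainLaw, Measure.map_map measurable_shift (measurable_statePath ρ r), h1,
    ← Measure.map_map (measurable_statePath ρ r) measurable_skewMap,
    (measurePreserving_skewMap ρ r hτ).map_eq]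

theorem ergodic_shift_chainLaw (hm : 2 ≤ m) (hmn : m < n) (hτ : Ergodic (angleRotation m n) τ)
    (hτ' : ∀ᵐ t ∂τ, t ∈ Ico (0 : ℝ) 1) : Ergodic shift (chainLaw ρ r τ) :=
  (measurePreserving_statePath ρ r τ).ergodic_of_ergodic_semiconj
    (ergodic_skewMap ρ r hm hmn hτ hτ') measurable_shift
    (fun ω => (shift_statePath ρ r ω).symm)

/-- The first `k + 1` states only depend on finitely many digits. -/
theorem seedState_iterate_splice {j k : ℕ} (hjk : j ≤ k) (t : ℝ) (u : ℕ → Fin m)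
    (z z' : (ℕ → Fin m) × (ℕ → Fin m → Fin n)) :
    seedState ρ r ((skewMap m n)^[j] (t, u, splice (k + 1) z.1 z'.1,
      splice (carries m n t (k + 1)) z.2 z'.2)) =
      seedState ρ r ((skewMap m n)^[j] (t, u, z)) := by
  have hmono := carries_mono (m := m) (n := n) t (by omega : j + 1 ≤ k + 1)
  simp only [carries] at hmono
  rw [← Prod.mk.eta (p := z)]
  simp only [skewMap_iterate]
  unfold seedState rawState
  congr 2
  refine Box.digitCell_congr _ (fun s hs => ?_) fun s hs => ?_
  · simp only [shift_iterate_apply]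
    exact splice_apply_of_lt (by omega) _ _
  · simp only [select, shift_iterate_apply]
    rw [splice_apply_of_lt]
    simp only [carries]
    change s < carry m n ((angleRotation m n)^[j] t) at hs
    omega

theorem ae_isTypical (hτ : ∀ᵐ t ∂τ, t ∈ Ico (0 : ℝ) 1) :
    ∀ᵐ ω : Seed m n ∂τ.prod (digitLaw ρ r), ω.1 ∈ Ico (0 : ℝ) 1 ∧ IsTypical ρ r ω.2.1 ω.2.2 ∧
      ∀ᵐ z ∂(iidLaw ρ).prod (iidLaw r), IsTypical ρ r ω.2.1 z := by
  have e1 : MeasurePreserving (fun ω : Seed m n => ω.2) (τ.prod (digitLaw ρ r)) (digitLaw ρ r) :=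
    measurePreserving_snd
  have e2 : MeasurePreserving (fun ω : Seed m n => ω.2.1) (τ.prod (digitLaw ρ r)) (iidLaw ρ) :=
    measurePreserving_fst.comp e1
  have e3 : MeasurePreserving (fun ω : Seed m n => ω.2.2.1) (τ.prod (digitLaw ρ r)) (iidLaw ρ) :=
    measurePreserving_fst.comp (measurePreserving_snd.comp e1)
  have e4 : MeasurePreserving (fun ω : Seed m n => (ω.2.1, ω.2.2.2)) (τ.prod (digitLaw ρ r))
      ((iidLaw ρ).prod (iidLaw r)) :=
    ((MeasurePreserving.id (iidLaw ρ)).prod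
      (measurePreserving_snd (μ := iidLaw ρ) (ν := iidLaw r))).comp e1
  filter_upwards [(measurePreserving_fst (μ := τ) (ν := digitLaw ρ r)).quasiMeasurePreserving.ae hτ,
    e2.quasiMeasurePreserving.ae (ae_ae_isTypical ρ r),
    e3.quasiMeasurePreserving.ae (ae_admissible ρ),
    e4.quasiMeasurePreserving.ae (ae_admissible_select ρ r)] with ω h1 h2 h3 h4
  exact ⟨h1, ⟨h3, h4⟩, h2⟩

variable (hm : 2 ≤ m) (hmn : m < n) (hτ : MeasurePreserving (angleRotation m n) τ τ)
  (hτ' : ∀ᵐ t ∂τ, t ∈ Ico (0 : ℝ) 1)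
include hm hmn hτ hτ'

theorem ae_rawState_mem_stateSet :
    ∀ᵐ ω : Seed m n ∂τ.prod (digitLaw ρ r), rawState ρ r ω ∈ stateSet n := by
  filter_upwards [ae_isTypical ρ r hτ',
    (measurePreserving_skewMap ρ r hτ).quasiMeasurePreserving.ae (ae_isTypical ρ r hτ')] with ω h h'
  exact rawState_mem_stateSet ρ r hm hmn h.1 h.2.1 h'.2.2

theorem ae_transition {κ : Kernel (CPState (approxSquares n)) (CPState (approxSquares n))}
    (hκ : ∀ s, κ s = (furstenbergLaw (approxSquareOperator m n) s.1).map (toState n)) :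
    ∀ᵐ ω : Seed m n ∂τ.prod (digitLaw ρ r), κ (seedState ρ r ω) =
      ((iidLaw ρ).prod (iidLaw r)).map fun z =>
        seedState ρ r ((skewMap m n ω).1, (skewMap m n ω).2.1, z) := by
  filter_upwards [ae_isTypical ρ r hτ',
    (measurePreserving_skewMap ρ r hτ).quasiMeasurePreserving.ae (ae_isTypical ρ r hτ'),
    ae_rawState_mem_stateSet ρ r hm hmn hτ hτ'] with ω h h' hω
  have h1 : (seedState ρ r ω).val = rawState ρ r ω := val_toState hω
  have h2 := furstenbergLaw_eq_map_rawState ρ r hm hmn h'.1 h'.2.2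
    (normalise_childBox ρ r hm hmn h.1 h.2.1)
  have hraw : Measurable fun z : (ℕ → Fin m) × (ℕ → Fin m → Fin n) =>
      rawState ρ r ((skewMap m n ω).1, (skewMap m n ω).2.1, z) :=
    (measurable_rawState ρ r).comp (measurable_prodMk_left.comp measurable_prodMk_left)
  have h3 : furstenbergLaw (approxSquareOperator m n) (rawState ρ r ω) =
    ((iidLaw ρ).prod (iidLaw r)).map fun z =>
      rawState ρ r ((skewMap m n ω).1, (skewMap m n ω).2.1, z) := h2
  rw [hκ, h1, h3, Measure.map_map (measurable_toState n) hraw]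
  rfl

theorem isMarkovLaw_chainLaw {κ : Kernel (CPState (approxSquares n)) (CPState (approxSquares n))}
    [IsMarkovKernel κ]
    (hκ : ∀ s, κ s = (furstenbergLaw (approxSquareOperator m n) s.1).map (toState n)) :
    IsMarkovLaw κ (chainLaw ρ r τ) := by
  intro k
  set P := τ.prod (digitLaw ρ r) with hP
  set K := (iidLaw ρ).prod (iidLaw r) with hK
  let H : Seed m n → Fin (k + 1) → CPState (approxSquares n) := fun ω l => statePath ρ r ω l
  have mH : Measurable H :=
    measurable_pi_lambda _ fun l => measurable_seedState_iterate ρ r l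
  have mN := measurable_seedState_iterate ρ r (k + 1)
  have hmap1 : (chainLaw ρ r τ).map (fun ω => ((fun l : Fin (k + 1) => ω l), ω (k + 1))) =
      P.map fun ω => (H ω, seedState ρ r ((skewMap m n)^[k + 1] ω)) := by
    rw [chainLaw, Measure.map_map (by fun_prop) (measurable_statePath ρ r)]
    rfl
  have hmap2 : (chainLaw ρ r τ).map (fun ω => (fun l : Fin (k + 1) => ω l)) = P.map H := by
    rw [chainLaw, Measure.map_map (by fun_prop) (measurable_statePath ρ r)]
    rfl
  have : IsProbabilityMeasure (P.map H) := Measure.isProbabilityMeasure_map mH.aemeasurable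
  rw [hmap1, hmap2]
  refine Measure.ext_prod fun {S D} hS hD => ?_
  -- The probability that the next state lies in `D`, given the past.
  let f : Seed m n → ℝ≥0∞ := fun ω => K {z | seedState ρ r (ω.1, ω.2.1, z) ∈ D}
  have mf : Measurable f := by
    have h1 : MeasurableSet {q : Seed m n × ((ℕ → Fin m) × (ℕ → Fin m → Fin n)) |
        seedState ρ r (q.1.1, q.1.2.1, q.2) ∈ D} :=
      ((measurable_seedState ρ r).comp (by fun_prop : Measurable
        fun q : Seed m n × ((ℕ → Fin m) × (ℕ → Fin m → Fin n)) =>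
          ((q.1.1, q.1.2.1, q.2) : Seed m n))) hD
    exact measurable_measure_prodMk_left h1
  have hker : ∀ᵐ ω ∂P, κ (seedState ρ r ((skewMap m n)^[k] ω)) D = f ((skewMap m n)^[k + 1] ω) := by
    have h1 := ((measurePreserving_skewMap ρ r hτ).iterate k).quasiMeasurePreserving.ae
      (ae_transition ρ r hm hmn hτ hτ' hκ)
    filter_upwards [h1] with ω hω
    have hs : Measurable fun z : (ℕ → Fin m) × (ℕ → Fin m → Fin n) => seedState ρ r
        ((skewMap m n ((skewMap m n)^[k] ω)).1, (skewMap m n ((skewMap m n)^[k] ω)).2.1, z) :=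
      (measurable_seedState ρ r).comp (measurable_prodMk_left.comp measurable_prodMk_left)
    rw [hω, Measure.map_apply hs hD, Function.iterate_succ_apply']
    rfl
  have hP' := (measurePreserving_prodAssoc τ (iidLaw ρ) K)
  have mNS : MeasurableSet {ω | H ω ∈ S ∧ seedState ρ r ((skewMap m n)^[k + 1] ω) ∈ D} :=
    (mH hS).inter (mN hD)
  have mf' : Measurable fun ω => f ((skewMap m n)^[k + 1] ω) :=
    mf.comp (measurable_skewMap.iterate (k + 1))
  rw [Measure.map_apply (mH.prodMk mN) (hS.prod hD), Measure.compProd_apply_prod hS hD,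
    setLIntegral_map hS (Kernel.measurable_coe _ hD) mH]
  have hrhs : ∫⁻ ω in H ⁻¹' S, (κ.comap (fun h : Fin (k + 1) → CPState (approxSquares n) =>
      h (Fin.last k)) (measurable_pi_apply _)) (H ω) D ∂P =
      ∫⁻ ω, (H ⁻¹' S).indicator (fun ω => f ((skewMap m n)^[k + 1] ω)) ω ∂P := by
    rw [lintegral_indicator (mH hS)]
    refine lintegral_congr_ae (ae_restrict_of_ae ?_)
    filter_upwards [hker] with ω hω
    rw [← hω]
    rfl
  have hlhs : P ((fun ω => (H ω, seedState ρ r ((skewMap m n)^[k + 1] ω))) ⁻¹' S ×ˢ D) =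
      P {ω | H ω ∈ S ∧ seedState ρ r ((skewMap m n)^[k + 1] ω) ∈ D} := rfl
  rw [hrhs, hlhs, ← hP'.measure_preimage mNS.nullMeasurableSet,
    Measure.prod_apply (hP'.measurable mNS), ← hP'.lintegral_comp (mf'.indicator (mH hS)),
    lintegral_prod (fun a => (H ⁻¹' S).indicator (fun ω => f ((skewMap m n)^[k + 1] ω))
      (MeasurableEquiv.prodAssoc a)) ((mf'.indicator (mH hS)).comp hP'.measurable).aemeasurable]
  refine lintegral_congr fun w => ?_
  obtain ⟨t, u⟩ := w
  -- For fixed `t` and `u` the past and the next state depend on disjoint sets of digits.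
  have hsplice := measurePreserving_splice_prod (measurePreserving_splice ρ (k + 1))
      (measurePreserving_splice r (carries m n t (k + 1)))
  have mtu : Measurable fun z : (ℕ → Fin m) × (ℕ → Fin m → Fin n) => ((t, u, z) : Seed m n) :=
    measurable_prodMk_left.comp measurable_prodMk_left
  have mE : MeasurableSet {z | H (t, u, z) ∈ S} := (mH.comp mtu) hS
  have hind := measure_inter_of_splice hsplice (E := {z | H (t, u, z) ∈ S})
    (A := {z | seedState ρ r ((skewMap m n)^[k + 1] (t, u, z)) ∈ D})
    (B := {z | seedState ρ r ((angleRotation m n)^[k + 1] t, shift^[carries m n t (k + 1)] u, z)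
      ∈ D}) (by
      ext p
      have : H (t, u, splice (k + 1) p.1.1 p.2.1, splice (carries m n t (k + 1)) p.1.2 p.2.2) =
          H (t, u, p.1) := funext fun l =>
        seedState_iterate_splice ρ r (Nat.lt_succ_iff.1 l.2) t u p.1 p.2
      simp [this]) (by
      ext p
      simp only [mem_preimage, mem_ofPred_eq, Set.mem_prod, mem_univ, true_and, skewMap_iterate,
        shift_iterate_splice]) mE ((mN.comp mtu) hD)
  have hf : ∀ z : (ℕ → Fin m) × (ℕ → Fin m → Fin n), f ((skewMap m n)^[k + 1] (t, u, z)) =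
      K {z | seedState ρ r ((angleRotation m n)^[k + 1] t, shift^[carries m n t (k + 1)] u, z)
        ∈ D} := fun z => by
    rw [← Prod.mk.eta (p := z), skewMap_iterate]
  refine hind.trans ?_
  have : ∀ z, (H ⁻¹' S).indicator (fun ω => f ((skewMap m n)^[k + 1] ω))
      (MeasurableEquiv.prodAssoc ((t, u), z)) =
      {z | H (t, u, z) ∈ S}.indicator (fun _ => K {z | seedState ρ r
        ((angleRotation m n)^[k + 1] t, shift^[carries m n t (k + 1)] u, z) ∈ D}) z := fun z => by
    rw [← hf z]; rfl
  rw [lintegral_congr this, lintegral_indicator_const mE, mul_comm]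

theorem isCPChain_chainLaw :
    IsCPChain (1 / (m : ℝ)) (approxSquares n) (approxSquareOperator m n) (chainLaw ρ r τ) where
  delta_mem := by
    have h1 : (1 : ℝ) < m := by exact_mod_cast hm
    exact ⟨by positivity, by rw [div_lt_one (by linarith)]; exact h1⟩
  partitionOperator := isPartitionOperator_approxSquareOperator hm hmn
  regular := isRegularOperator_approxSquareOperator hm hmn
  isProbabilityMeasure := inferInstance
  markov := by
    obtain ⟨κ, h1, h2, h3⟩ := exists_furstenbergKernel hm hmn
    exact ⟨κ, h1, h2, isMarkovLaw_chainLaw ρ r hm hmn hτ hτ' h3⟩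
  stationary := measurePreserving_shift_chainLaw ρ r hτ

theorem measureComponent_chainLaw : measureComponent (chainLaw ρ r τ) =
    (τ.prod (iidLaw ρ)).map fun p => limitLaw ρ r p.1 p.2 := by
  have hval : Measurable fun ω : ℕ → CPState (approxSquares n) => (ω 0).1.2 :=
    (measurable_val n).snd.comp (measurable_pi_apply 0)
  have hT := measurePreserving_skewMap ρ r hτ
  have mL : Measurable fun ω : Seed m n => limitLaw ρ r ω.1 ω.2.1 :=
    (measurable_limitLaw ρ r).comp (by fun_prop : Measurable fun ω : Seed m n => (ω.1, ω.2.1))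
  have e1 : MeasurePreserving (fun ω : Seed m n => (ω.1, ω.2.1)) (τ.prod (digitLaw ρ r))
      (τ.prod (iidLaw ρ)) := (MeasurePreserving.id τ).prod measurePreserving_fst
  rw [measureComponent, chainLaw, Measure.map_map hval (measurable_statePath ρ r),
    ← e1.map_eq, Measure.map_map (measurable_limitLaw ρ r) e1.measurable]
  have h1 : (τ.prod (digitLaw ρ r)).map ((fun ω : ℕ → CPState (approxSquares n) => (ω 0).1.2) ∘
      statePath ρ r) =
      (τ.prod (digitLaw ρ r)).map ((fun ω : Seed m n => limitLaw ρ r ω.1 ω.2.1) ∘ skewMap m n) := by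
    refine Measure.map_congr ?_
    filter_upwards [ae_rawState_mem_stateSet ρ r hm hmn hτ hτ'] with ω hω
    have : (statePath ρ r ω 0).val = rawState ρ r ω := val_toState hω
    simp only [Function.comp]
    exact congrArg Prod.snd this
  rw [h1, ← Measure.map_map mL measurable_skewMap, hT.map_eq]
  rfl

end Chain

section FibreProduct

variable {m n : ℕ} (ρ : Measure (Fin m)) (r : Measure (Fin m → Fin n)) [IsProbabilityMeasure ρ]
  [IsProbabilityMeasure r] (τ : Measure ℝ) [IsProbabilityMeasure τ] {μ : ProbabilityMeasure (ℝ × ℝ)}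

theorem measurable_fibreProduct (μ : ProbabilityMeasure (ℝ × ℝ)) :
    Measurable fun p : ℝ × ℝ => fibreProduct n μ p.1 p.2 := by
  refine Measurable.subtype_mk (p := IsProbabilityMeasure)
    (f := fun p : ℝ × ℝ => (fibreProduct n μ p.1 p.2 : Measure (ℝ × ℝ))) ?_
  refine Measure.measurable_of_measurable_coe _ fun D hD => ?_
  let κ : Kernel (ℝ × ℝ) (ℝ × ℝ) := ((Kernel.const ℝ (μ : Measure (ℝ × ℝ)).fst) ×ₖ
    (μ : Measure (ℝ × ℝ)).condKernel).comap Prod.snd measurable_snd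
  have h1 : MeasurableSet {q : (ℝ × ℝ) × (ℝ × ℝ) | hyperbolicMap n q.1.1 q.2 ∈ D} := by
    have : Measurable fun q : (ℝ × ℝ) × (ℝ × ℝ) => hyperbolicMap n q.1.1 q.2 := by
      unfold hyperbolicMap
      fun_prop
    exact this hD
  have h2 : ∀ p : ℝ × ℝ, (fibreProduct n μ p.1 p.2 : Measure (ℝ × ℝ)) D =
      κ p (Prod.mk p ⁻¹' {q : (ℝ × ℝ) × (ℝ × ℝ) | hyperbolicMap n q.1.1 q.2 ∈ D}) := fun p => by
    rw [Kernel.comap_apply, Kernel.prod_apply, Kernel.const_apply]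
    exact Measure.map_apply (measurable_hyperbolicMap n p.1) hD
  simp_rw [h2]
  exact Kernel.measurable_kernel_prodMk_left h1

theorem fibreProductLaw_eq_map_limitLaw (hm : 1 < m)
    (hμ : (μ : Measure (ℝ × ℝ)) = ((iidLaw ρ).prod (iidLaw r)).map
      fun z => (Real.ofDigits z.1, Real.ofDigits (select z.2 z.1))) :
    fibreProductLaw n μ τ = (τ.prod (iidLaw ρ)).map fun p => limitLaw ρ r p.1 p.2 := by
  have h1 : τ.prod ((iidLaw ρ).map Real.ofDigits) =
      (τ.prod (iidLaw ρ)).map (Prod.map id Real.ofDigits) := by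
    rw [← Measure.map_prod_map _ _ measurable_id measurable_ofDigits, Measure.map_id]
  rw [fibreProductLaw, fst_eq_map_ofDigits ρ r hμ, h1,
    Measure.map_map (measurable_fibreProduct μ) (measurable_id.prodMap measurable_ofDigits)]
  refine Measure.map_congr ?_
  filter_upwards [Measure.quasiMeasurePreserving_snd.ae (ae_fibreProduct_eq_limitLaw ρ r hμ hm)]
    with p hp
  exact hp p.1

end FibreProduct

/-! ### Sceneries along the approximate squares -/

/-- Almost sure statements are transported along a map that has a measurable left inverse. -/
theorem ae_map_of_ae_of_leftInverse {X Y : Type*} [MeasurableSpace X] [MeasurableSpace Y]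
    [MeasurableEq Y] {ν : Measure X} {f : X → Y} {g : Y → X} (hf : Measurable f)
    (hg : Measurable g) (hgf : ∀ᵐ x ∂ν, g (f x) = x) {p : Y → Prop} (h : ∀ᵐ x ∂ν, p (f x)) :
    ∀ᵐ y ∂ν.map f, p y := by
  obtain ⟨S, hS, mS, hSp⟩ := h.exists_measurable_mem
  have hset : MeasurableSet {y | g y ∈ S ∧ f (g y) = y} :=
    (hg mS).inter (measurableSet_eq_fun (hf.comp hg) measurable_id)
  have h1 : ∀ᵐ y ∂ν.map f, y ∈ {y | g y ∈ S ∧ f (g y) = y} := by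
    refine (ae_map_iff hf.aemeasurable hset).2 ?_
    filter_upwards [hS, hgf] with x hx hx'
    exact ⟨by rwa [hx'], by rw [hx']⟩
  filter_upwards [h1] with y hy
  rw [← hy.2]
  exact hSp _ hy.1

/-- Almost surely a random variable with countably many values takes a value of positive
probability. -/
theorem ae_measure_fibre_ne_zero {X T : Type*} [MeasurableSpace X] [Countable T] (ν : Measure X)
    (q : X → T) : ∀ᵐ x ∂ν, ν (q ⁻¹' {q x}) ≠ 0 := by
  rw [ae_iff]
  refine measure_mono_null (t := ⋃ t ∈ {t | ν (q ⁻¹' {t}) = 0}, q ⁻¹' {t}) ?_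
    ((measure_biUnion_null_iff (to_countable _)).2 fun t ht => ht)
  intro x hx
  simp only [ne_eq, not_not, mem_ofPred_eq] at hx
  exact mem_biUnion (show q x ∈ {t | ν (q ⁻¹' {t}) = 0} from hx) rfl

section Scenery

variable {m n : ℕ} (ρ : Measure (Fin m)) (r : Measure (Fin m → Fin n)) [IsProbabilityMeasure ρ]
  [IsProbabilityMeasure r]

theorem measurable_prodMk_select : Measurable
    fun z : (ℕ → Fin m) × (ℕ → Fin m → Fin n) => (z.1, select z.2 z.1) :=
  measurable_fst.prodMk (measurable_select.comp measurable_swap)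

theorem measurable_limitPoint_splice (t : ℝ) (v : ℕ → Fin m) (N : ℕ) : Measurable
    fun z : (ℕ → Fin m) × (ℕ → Fin m → Fin n) => limitPoint n t (splice N v z.1) z.1 z.2 := by
  have h : Measurable fun z : (ℕ → Fin m) × (ℕ → Fin m → Fin n) => splice N v z.1 :=
    (measurable_splice N).comp (measurable_const.prodMk measurable_fst)
  exact measurable_limitPoint.comp ((measurable_const.prodMk h).prodMk measurable_id)

/-- The blow-up of a Bernoulli measure along an approximate square. The letters that select the
second digits are prescribed as long as they are seen by the columns of the approximate square;
afterwards they agree with the digits of the first coordinate. -/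
theorem exists_blowUp_digitCell (hm : 2 ≤ m) (hmn : m < n) {μ : ProbabilityMeasure (ℝ × ℝ)}
    (hμ : (μ : Measure (ℝ × ℝ)) = ((iidLaw ρ).prod (iidLaw r)).map
      fun z => unitBox.digitPoint (z.1, select z.2 z.1))
    (X : ℕ → Fin m) (Y : ℕ → Fin n) {k l : ℕ} (hlk : l ≤ k)
    (h0 : (iidLaw ρ).prod (iidLaw r) {z | (∀ s < k, z.1 s = X s) ∧
      ∀ s < l, select z.2 z.1 s = Y s} ≠ 0)
    (hA : unitBox.digitCell X Y k l ∈ approxSquares n) :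
    (((unitBox.digitCell X Y k l).blowUp μ : ProbabilityMeasure (ℝ × ℝ)) : Measure (ℝ × ℝ)) =
      ((iidLaw ρ).prod (iidLaw r)).map fun z =>
        limitPoint n ((unitBox.digitCell X Y k l).eccentricity n)
          (splice (k - l) (shift^[l] X) z.1) z.1 z.2 := by
  set K := (iidLaw ρ).prod (iidLaw r) with hK
  set E := {z : (ℕ → Fin m) × (ℕ → Fin m → Fin n) | (∀ s < k, z.1 s = X s) ∧
      ∀ s < l, select z.2 z.1 s = Y s} with hE
  have hadm : ∀ᵐ z ∂K, Admissible unitBox.rightClosed z.1 ∧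
      Admissible unitBox.topClosed (select z.2 z.1) := by
    filter_upwards [Measure.quasiMeasurePreserving_fst.ae (ae_admissible ρ),
      ae_admissible_select ρ r] with z h1 h2
    exact ⟨h1.1.of_true, h2.1.of_true⟩
  have hb := Box.blowUp_digitCell (P := K) measurable_prodMk_select (B := unitBox)
    (by simp [unitBox, Box.width]) (by simp [unitBox, Box.height]) (by omega) (by omega) hadm hμ X Y
    k l h0
  obtain ⟨e1, e2⟩ := Box.width_div_sqrt_area (by omega) hA
  rw [e1, e2] at hb
  refine hb.trans ?_
  have mE : MeasurableSet E :=
    (measurable_prodMk_select.fst (measurableSet_prefix _ _)).inter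
      (measurable_prodMk_select.snd (measurableSet_prefix _ _))
  have mσ : Measurable fun z : (ℕ → Fin m) × (ℕ → Fin m → Fin n) =>
      (shift^[k] z.1, shift^[l] z.2) :=
    ((measurable_shift.iterate k).comp measurable_fst).prodMk
      ((measurable_shift.iterate l).comp measurable_snd)
  have hcond := map_cond_of_splice (measurePreserving_splice_prod (measurePreserving_splice ρ k)
    (measurePreserving_splice r l)) (E := E) (by
      ext p
      simp only [hE, mem_preimage, mem_ofPred_eq, Set.mem_prod, mem_univ, and_true, select]
      refine and_congr (forall₂_congr fun s hs => by rw [splice_apply_of_lt hs])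
        (forall₂_congr fun s hs => ?_)
      rw [splice_apply_of_lt hs, splice_apply_of_lt (by omega)]) mE h0 mσ
      (fun p => by simp only [shift_iterate_splice])
  have hlp := measurable_limitPoint_splice (n := n) ((unitBox.digitCell X Y k l).eccentricity n)
    (shift^[l] X) (k - l)
  conv_rhs => rw [hK, ← hcond, Measure.map_map hlp mσ]
  refine Measure.map_congr ?_
  filter_upwards [ae_cond_mem mE] with z hz
  have hsplice : splice (k - l) (shift^[l] X) (shift^[k] z.1) = shift^[l] z.1 := by
    have h1 : shift^[k] z.1 = shift^[k - l] (shift^[l] z.1) := by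
      rw [← Function.iterate_add_apply, Nat.sub_add_cancel hlk]
    rw [h1]
    refine splice_shift_iterate _ _ _ fun s hs => ?_
    rw [shift_iterate_apply, shift_iterate_apply]
    exact hz.1 _ (by omega)
  simp only [Function.comp, hsplice, shift_iterate_select]
  rfl

/-- If long prefixes of the selecting letters are prescribed, the law of the random point is close
to the limit law. -/
theorem tendsto_sub_limitLaw (hn : 0 < n) {t : ℕ → ℝ} (ht : ∀ k, t k ∈ Icc (0 : ℝ) 1)
    (v : ℕ → ℕ → Fin m) {N : ℕ → ℕ} (hN : Tendsto N atTop atTop)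
    {ν : ℕ → ProbabilityMeasure (ℝ × ℝ)}
    (hν : ∀ k, (ν k : Measure (ℝ × ℝ)) = ((iidLaw ρ).prod (iidLaw r)).map fun z =>
      limitPoint n (t k) (splice (N k) (v k) z.1) z.1 z.2)
    {f : ProbabilityMeasure (ℝ × ℝ) → ℝ} (hf : Continuous f) :
    Tendsto (fun k => f (ν k) - f (limitLaw ρ r (t k) (v k))) atTop (𝓝 0) := by
  refine tendsto_of_subseq_tendsto fun ns hns => ?_
  have hcpt : IsCompact (Icc (0 : ℝ) 1 ×ˢ (univ : Set (ℕ → Fin m))) :=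
    isCompact_Icc.prod isCompact_univ
  obtain ⟨⟨t₀, v₀⟩, -, φ, hφ, hlim⟩ := hcpt.tendsto_subseq
    (x := fun k => (t (ns k), v (ns k))) fun k => ⟨ht _, mem_univ _⟩
  refine ⟨φ, ?_⟩
  have hL : Tendsto (fun k => limitLaw ρ r (t (ns (φ k))) (v (ns (φ k)))) atTop
      (𝓝 (limitLaw ρ r t₀ v₀)) := by
    have h := ((continuous_limitLaw ρ r hn).tendsto (t₀, v₀)).comp hlim
    simpa only [Function.comp_def] using h
  have hN' : Tendsto (fun k => N (ns (φ k))) atTop atTop :=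
    hN.comp (hns.comp hφ.tendsto_atTop)
  have hν' : Tendsto (fun k => ν (ns (φ k))) atTop (𝓝 (limitLaw ρ r t₀ v₀)) := by
    refine tendsto_of_coe_eq_map (P := (iidLaw ρ).prod (iidLaw r))
      (Y := fun k z => limitPoint n (t (ns (φ k)))
        (splice (N (ns (φ k))) (v (ns (φ k))) z.1) z.1 z.2)
      (Y₀ := fun z => limitPoint n t₀ v₀ z.1 z.2)
      (fun k => measurable_limitPoint_splice _ _ _) (measurable_limitPoint_right _ _)
      (fun k => hν _) (coe_limitLaw ρ r t₀ v₀) fun z => ?_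
    have hs : Tendsto (fun k => splice (N (ns (φ k))) (v (ns (φ k))) z.1) atTop (𝓝 v₀) := by
      rw [tendsto_pi_nhds]
      intro s
      have h1 := tendsto_pi_nhds.1 ((continuous_snd.tendsto (t₀, v₀)).comp hlim) s
      refine h1.congr' ?_
      filter_upwards [hN'.eventually_gt_atTop s] with k hk
      exact (splice_apply_of_lt hk _ _).symm
    have h2 : Tendsto (fun k => t (ns (φ k))) atTop (𝓝 t₀) :=
      (continuous_fst.tendsto (t₀, v₀)).comp hlim
    have h3 := ((continuous_limitPoint hn z.1 z.2).tendsto (t₀, v₀)).comp (h2.prodMk_nhds hs)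
    simpa only [Function.comp_def] using h3
  have h := ((hf.tendsto _).comp hν').sub ((hf.tendsto _).comp hL)
  simpa only [Function.comp_def, sub_self] using h

theorem digitCell_mem_iterPartition (hm : 2 ≤ m) (hmn : m < n) (X : ℕ → Fin m) (Y : ℕ → Fin n)
    (k : ℕ) : unitBox.digitCell X Y k (carries m n 0 k) ∈ approxSquares n ∧
      unitBox.digitCell X Y k (carries m n 0 k) ∈
        iterPartition (approxSquareOperator m n) unitBox k ∧
      (unitBox.digitCell X Y k (carries m n 0 k)).eccentricity n = (angleRotation m n)^[k] 0 := by
  induction k with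
  | zero =>
    have h : unitBox.digitCell X Y 0 (carries m n 0 0) = unitBox := Box.digitCell_zero rfl rfl X Y
    rw [h]
    exact ⟨unitBox_mem_approxSquares n, rfl, by
      simp [unitBox, Box.width, Box.height, Box.eccentricity]⟩
  | succ k ih =>
    obtain ⟨h1, h2, h3⟩ := ih
    have hmem := Box.digitCell_mem_approxSquareOperator (by omega) (by omega) unitBox X Y k
      (carries m n 0 k)
    rw [h3] at hmem
    refine ⟨(isPartitionOperator_approxSquareOperator hm hmn).subset _ h1 hmem,
      mem_biUnion h2 hmem, ?_⟩
    rw [Function.iterate_succ_apply', ← h3]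
    exact Box.eccentricity_of_mem_approxSquareOperator hm hmn h1 hmem

/-- For a Bernoulli measure, the sceneries along the approximate squares, sampled every `q` steps,
converge to the law of the limit measures, where `τ` is the limit distribution of the
eccentricities. -/
theorem ae_sceneryConverges (hm : 2 ≤ m) (hmn : m < n) {μ : ProbabilityMeasure (ℝ × ℝ)}
    (hμ : (μ : Measure (ℝ × ℝ)) = ((iidLaw ρ).prod (iidLaw r)).map
      fun z => (Real.ofDigits z.1, Real.ofDigits (select z.2 z.1)))
    {q : ℕ} (hq : 1 ≤ q) {τ : Measure ℝ} [IsProbabilityMeasure τ]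
    (hτ : ∀ᵐ t ∂τ, t ∈ Icc (0 : ℝ) 1)
    (hqτ : Equidistributed (fun k => (angleRotation m n)^[q * k] 0) τ) :
    ∀ᵐ x ∂(μ : Measure (ℝ × ℝ)), SceneryConverges (approxSquareOperator m n) unitBox μ q x
      ((τ.prod (iidLaw ρ)).map fun p => limitLaw ρ r p.1 p.2) := by
  set K := (iidLaw ρ).prod (iidLaw r) with hK
  have hpoint : ∀ z : (ℕ → Fin m) × (ℕ → Fin n),
      unitBox.digitPoint z = (Real.ofDigits z.1, Real.ofDigits z.2) := fun z => by
    simp [Box.digitPoint, unitBox, Box.width, Box.height]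
  have hμ' : (μ : Measure (ℝ × ℝ)) = K.map fun z => unitBox.digitPoint (z.1, select z.2 z.1) := by
    simp only [hpoint]
    exact hμ
  -- The law of the pair of digit sequences.
  set ν : Measure ((ℕ → Fin m) × (ℕ → Fin n)) := K.map fun z => (z.1, select z.2 z.1) with hν
  have hsel : MeasurePreserving (fun z : (ℕ → Fin m) × (ℕ → Fin m → Fin n) =>
    (z.1, select z.2 z.1)) K ν := ⟨measurable_prodMk_select, rfl⟩
  have hμν : (μ : Measure (ℝ × ℝ)) = ν.map unitBox.digitPoint := by
    rw [hμ', hν, Measure.map_map unitBox.measurable_digitPoint measurable_prodMk_select]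
    rfl
  have hfst : MeasurePreserving Prod.fst ν (iidLaw ρ) := by
    refine ⟨measurable_fst, ?_⟩
    rw [hν, Measure.map_map measurable_fst measurable_prodMk_select]
    exact (measurePreserving_fst (μ := iidLaw ρ) (ν := iidLaw r)).map_eq
  have hadm : ∀ᵐ w ∂ν, Admissible true w.1 ∧ Admissible true w.2 := by
    have hset : MeasurableSet {w : (ℕ → Fin m) × (ℕ → Fin n) |
        Admissible true w.1 ∧ Admissible true w.2} :=
      (measurable_fst (measurableSet_admissible true)).inter
        (measurable_snd (measurableSet_admissible true))
    rw [hν]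
    refine (ae_map_iff measurable_prodMk_select.aemeasurable hset).2 ?_
    filter_upwards [Measure.quasiMeasurePreserving_fst.ae (ae_admissible ρ),
      ae_admissible_select ρ r] with z h1 h2
    exact ⟨h1.1.of_true, h2.1.of_true⟩
  obtain ⟨g₁, hg₁, hg₁'⟩ := exists_measurable_digits (b := m) (by omega) true
  obtain ⟨g₂, hg₂, hg₂'⟩ := exists_measurable_digits (b := n) (by omega) true
  rw [hμν]
  refine ae_map_of_ae_of_leftInverse (g := Prod.map g₁ g₂) unitBox.measurable_digitPoint
    (hg₁.prodMap hg₂) ?_ ?_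
  · filter_upwards [hadm] with w hw
    rw [hpoint, Prod.map_apply, hg₁' _ hw.1, hg₂' _ hw.2]
  have hpos : ∀ᵐ w ∂ν, ∀ k l : ℕ, K {z | (∀ s < k, z.1 s = w.1 s) ∧
      ∀ s < l, select z.2 z.1 s = w.2 s} ≠ 0 := by
    rw [ae_all_iff]
    intro k
    rw [ae_all_iff]
    intro l
    filter_upwards [ae_measure_fibre_ne_zero ν fun w : (ℕ → Fin m) × (ℕ → Fin n) =>
      ((fun s : Fin k => w.1 s), (fun s : Fin l => w.2 s))] with w hw h0
    refine hw ?_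
    have hset : (fun w : (ℕ → Fin m) × (ℕ → Fin n) => ((fun s : Fin k => w.1 s),
        (fun s : Fin l => w.2 s))) ⁻¹' {((fun s : Fin k => w.1 s), (fun s : Fin l => w.2 s))} =
        {w' | ∀ s < k, w'.1 s = w.1 s} ∩ {w' | ∀ s < l, w'.2 s = w.2 s} := by
      ext w'
      simp [funext_iff, Fin.forall_iff]
    have mset : MeasurableSet ({w' : (ℕ → Fin m) × (ℕ → Fin n) | ∀ s < k, w'.1 s = w.1 s} ∩
        {w' | ∀ s < l, w'.2 s = w.2 s}) :=
      (measurable_fst (measurableSet_prefix w.1 k)).inter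
        (measurable_snd (measurableSet_prefix w.2 l))
    rw [hset, ← hsel.measure_preimage mset.nullMeasurableSet]
    exact h0
  have hgen := hfst.quasiMeasurePreserving.ae (ae_equidistributed_sparse_shift ρ
    (fun k => Ico_subset_Icc_self (angleRotation_iterate_mem_Ico ⟨le_rfl, one_pos⟩ (q * k))) hτ hqτ
    (exists_carries_add_le hm hmn hq))
  filter_upwards [hadm, hpos, hgen] with w hw hw0 hwgen f
  set A : ℕ → Box := fun k => unitBox.digitCell w.1 w.2 k (carries m n 0 k) with hA
  have hcell : ∀ k, cellAt (approxSquareOperator m n) unitBox k (unitBox.digitPoint w) = A k :=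
    fun k => (isPartitionOperator_approxSquareOperator hm hmn).cellAt_eq
      (unitBox_mem_approxSquares n) (digitCell_mem_iterPartition hm hmn w.1 w.2 k).2.1
      ((Box.digitPoint_mem_digitCell_iff (by omega) (by omega) (by simp [unitBox, Box.width])
        (by simp [unitBox, Box.height]) hw.1 hw.2 _ _ _ _).2 ⟨fun _ _ => rfl, fun _ _ => rfl⟩)
  have hdiff : Tendsto (fun k => f ((A k).blowUp μ) - f (limitLaw ρ r ((angleRotation m n)^[k] 0)
      (shift^[carries m n 0 k] w.1))) atTop (𝓝 0) := by
    refine tendsto_sub_limitLaw ρ r (by omega)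
      (fun k => Ico_subset_Icc_self (angleRotation_iterate_mem_Ico ⟨le_rfl, one_pos⟩ k))
      (fun k => shift^[carries m n 0 k] w.1) (tendsto_sub_carries hm hmn) (fun k => ?_) f.continuous
    obtain ⟨h1, -, h3⟩ := digitCell_mem_iterPartition hm hmn w.1 w.2 k
    rw [← h3]
    exact exists_blowUp_digitCell ρ r hm hmn hμ' w.1 w.2 (carries_le 0 k) (hw0 k _) h1
  have hcont : Continuous fun p : ℝ × (ℕ → Fin m) => f (limitLaw ρ r p.1 p.2) :=
    f.continuous.comp (continuous_limitLaw ρ r (by omega))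
  have hmeas : Measurable (f : ProbabilityMeasure (ℝ × ℝ) → ℝ) :=
    measurable_of_continuous_probabilityMeasure f.continuous
  have hint : ∫ ν', f ν' ∂((τ.prod (iidLaw ρ)).map fun p => limitLaw ρ r p.1 p.2) =
      ∫ t, ∫ u, f (limitLaw ρ r t u) ∂iidLaw ρ ∂τ := by
    rw [integral_map (measurable_limitLaw ρ r).aemeasurable hmeas.aestronglyMeasurable,
      integral_prod]
    exact Integrable.of_bound (hmeas.comp (measurable_limitLaw ρ r)).aestronglyMeasurable ‖f‖
      (ae_of_all _ fun p => f.norm_coe_le_norm _)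
  rw [hint]
  have hq' : Tendsto (fun k => q * k) atTop atTop :=
    tendsto_id.const_mul_atTop' (by omega)
  have h1 := (hwgen _ hcont).add (hdiff.comp hq').cesaro
  rw [add_zero] at h1
  refine h1.congr fun N => ?_
  rw [one_div, ← mul_add, ← Finset.sum_add_distrib]
  congr 1
  refine Finset.sum_congr rfl fun k _ => ?_
  simp only [Function.comp, hcell]
  ring

end Scenery

/-! ### Generation of the chain -/

theorem ae_uniform_dirac_mem {x : ℕ → ℝ} {s : Set ℝ} (hs : MeasurableSet s) (hx : ∀ k, x k ∈ s)
    (q : ℕ) : ∀ᵐ t ∂((q : ℝ≥0∞)⁻¹ • ∑ k ∈ Finset.range q, Measure.dirac (x k)), t ∈ s := by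
  refine Measure.ae_smul_measure ?_ _
  rw [← Measure.sum_coe_finset]
  refine (Measure.ae_sum_iff' (p := fun t => t ∈ s) hs).2 fun k => ?_
  exact (ae_dirac_iff hs).2 (hx k)

/-- A Bernoulli measure generates the ergodic CP-chain over the rotation with any ergodic law `τ`
along which the eccentricities equidistribute. -/
theorem exists_generated_chain {m n : ℕ} (hm : 2 ≤ m) (hmn : m < n) {μ : ProbabilityMeasure (ℝ × ℝ)}
    (hμ : IsBernoulliFor m n μ) {τ : Measure ℝ} [IsProbabilityMeasure τ]
    (hτ : Ergodic (angleRotation m n) τ) (hτ' : ∀ᵐ t ∂τ, t ∈ Ico (0 : ℝ) 1)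
    (hequi : Equidistributed (fun k => (angleRotation m n)^[k] 0) τ)
    (hsparse : ∀ q : ℕ, 1 ≤ q → ∃ τ' : Measure ℝ, IsProbabilityMeasure τ' ∧
      (∀ᵐ t ∂τ', t ∈ Icc (0 : ℝ) 1) ∧
      Equidistributed (fun k => (angleRotation m n)^[q * k] 0) τ') :
    ∃ Q : Measure (ℕ → CPState (approxSquares n)),
      IsCPChain (1 / (m : ℝ)) (approxSquares n) (approxSquareOperator m n) Q ∧
      Ergodic shift Q ∧ Generates (approxSquareOperator m n) unitBox μ Q ∧
      measureComponent Q = fibreProductLaw n μ τ := by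
  obtain ⟨ν, hν, hB, hμν⟩ := hμ
  obtain ⟨ρ, r, hρ, hr, rfl⟩ := hB.exists_eq_map (by omega)
  have hcode : Measurable (codingMap m n) :=
    (measurable_ofDigits.comp measurable_fst).prodMk (measurable_ofDigits.comp measurable_snd)
  have hμ : (μ : Measure (ℝ × ℝ)) = ((iidLaw ρ).prod (iidLaw r)).map
      fun z => (Real.ofDigits z.1, Real.ofDigits (select z.2 z.1)) := by
    rw [hμν, Measure.map_map hcode measurable_prodMk_select]
    rfl
  have hcomp := measureComponent_chainLaw ρ r hm hmn hτ.toMeasurePreserving hτ'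
  refine ⟨chainLaw ρ r τ, isCPChain_chainLaw ρ r hm hmn hτ.toMeasurePreserving hτ',
    ergodic_shift_chainLaw ρ r hm hmn hτ hτ', ⟨unitBox_mem_approxSquares n, ?_, ?_, ?_⟩, ?_⟩
  · rw [normalise_unitBox]
    have h1 : ∀ᵐ z ∂(μ : Measure (ℝ × ℝ)), z ∈ unitBox.toSet := by
      rw [hμν, Measure.map_map hcode measurable_prodMk_select]
      refine (ae_map_iff (hcode.comp measurable_prodMk_select).aemeasurable
        unitBox.measurableSet_toSet).2 (ae_of_all _ fun z => ?_)
      have h01 : ∀ {b : ℕ} (X : ℕ → Fin b), Real.ofDigits X ∈ Box.interval 0 1 true true :=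
        fun X => ⟨Real.ofDigits_nonneg X, Real.ofDigits_le_one X⟩
      exact ⟨h01 _, h01 _⟩
    exact (prob_compl_eq_zero_iff unitBox.measurableSet_toSet).1 h1
  · rw [normalise_unitBox, hcomp]
    refine ae_sceneryConverges ρ r hm hmn hμ le_rfl
      (hτ'.mono fun t ht => Ico_subset_Icc_self ht) ?_
    simpa only [one_mul] using hequi
  · intro q hq
    obtain ⟨τ', h1, h2, h3⟩ := hsparse q hq
    rw [normalise_unitBox]
    exact ⟨_, Measure.isProbabilityMeasure_map (measurable_limitLaw ρ r).aemeasurable,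
      ae_sceneryConverges ρ r hm hmn hμ hq h2 h3⟩
  · rw [hcomp, fibreProductLaw_eq_map_limitLaw ρ r τ (by omega) hμ]

theorem theorem1p2 (m n : ℕ) (hm : 2 ≤ m) (hmn : m < n) (μ : ProbabilityMeasure (ℝ × ℝ))
    (hμ : IsBernoulliFor m n μ) :
    (Irrational (Real.log m / Real.log n) →
      ∃ Q : Measure (ℕ → CPState (approxSquares n)),
        IsCPChain (1 / (m : ℝ)) (approxSquares n) (approxSquareOperator m n) Q ∧
        Ergodic shift Q ∧
        Generates (approxSquareOperator m n) unitBox μ Q ∧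
        measureComponent Q = fibreProductLaw n μ (volume.restrict (Set.Ico (0 : ℝ) 1))) ∧
    (∀ p q : ℕ, 0 < q → Nat.Coprime p q → Real.log m / Real.log n = (p : ℝ) / (q : ℝ) →
      ∃ Q : Measure (ℕ → CPState (approxSquares n)),
        IsCPChain (1 / (m : ℝ)) (approxSquares n) (approxSquareOperator m n) Q ∧
        Ergodic shift Q ∧
        Generates (approxSquareOperator m n) unitBox μ Q ∧
        measureComponent Q = fibreProductLaw n μ (periodicLaw m n q)) := by
  have hmem : ∀ k, (angleRotation m n)^[k] 0 ∈ Ico (0 : ℝ) 1 := fun k =>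
    angleRotation_iterate_mem_Ico ⟨le_rfl, one_pos⟩ k
  constructor
  · intro hα
    have hα : Irrational (rotationAngle m n) := hα
    have hprob : IsProbabilityMeasure (volume.restrict (Ico (0 : ℝ) 1)) := ⟨by simp⟩
    have hIco : ∀ᵐ t ∂volume.restrict (Ico (0 : ℝ) 1), t ∈ Ico (0 : ℝ) 1 :=
      ae_restrict_mem measurableSet_Ico
    have hequi : ∀ q : ℕ, 1 ≤ q → Equidistributed (fun k => (angleRotation m n)^[q * k] 0)
        (volume.restrict (Ico (0 : ℝ) 1)) := by
      intro q hq
      have h1 : Irrational (q * rotationAngle m n) := hα.natCast_mul (by omega)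
      have h2 := equidistributed_fract_of_irrational h1
      have h3 : (fun k => (angleRotation m n)^[q * k] 0) =
          fun k : ℕ => Int.fract (k * (q * rotationAngle m n)) := by
        ext k
        rw [angleRotation_iterate_zero]
        push_cast
        ring_nf
      rwa [h3]
    refine exists_generated_chain hm hmn hμ (ergodic_angleRotation_of_irrational hα) hIco ?_
      fun q hq => ⟨_, hprob, hIco.mono fun t ht => Ico_subset_Icc_self ht, hequi q hq⟩
    simpa only [one_mul] using hequi 1 le_rfl
  · intro p q hq _ hα
    have hα : rotationAngle m n = p / q := hα
    have hper : Function.Periodic (fun k => (angleRotation m n)^[k] (0 : ℝ)) q :=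
      angleRotation_iterate_zero_add hq hα
    have hprob : IsProbabilityMeasure (periodicLaw m n q) := isProbabilityMeasure_uniform_dirac hq _
    refine exists_generated_chain hm hmn hμ (ergodic_angleRotation_periodicLaw hq hα)
      (ae_uniform_dirac_mem measurableSet_Ico hmem q) (equidistributed_of_periodic hq hper)
      fun s hs => ⟨_, isProbabilityMeasure_uniform_dirac hq fun k => (angleRotation m n)^[s * k] 0,
        ae_uniform_dirac_mem measurableSet_Icc (fun k => Ico_subset_Icc_self (hmem _)) q,
        equidistributed_of_periodic hq fun k => ?_⟩
    have := hper.nat_mul s (s * k)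
    simp only [Nat.cast_id] at this
    rw [mul_add]
    exact this
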